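/- Let $\xi=x+iy:\mathbb R\to\mathbb C$ be a twice continuously differentiable parameterization of a curve $\mathcal C$ such that: (chord-arc) there is $K>0$ with $\left|\frac{\xi(\alpha)-\xi(\alpha')}{\alpha-\alpha'}\right|\ge K$ for all $\alpha\ne\alpha'$; there is $M>0$ with $\frac1M\le|\xi_\alpha|\le M$ on $\mathbb R$; and $\xi(\alpha)-\alpha=f_1+f_2$ with $f_1\in L^2(\mathbb R)$, $f_2\in L^\infty(\mathbb R)$. Let $\gamma:\mathbb R\to\mathbb R$ be locally $L^2$, and suppose that there are a constant $c\in\mathbb R$ and an antiderivative $\Gamma$ of $\tilde\gamma:=\gamma-c$ which grows sublinearly: for some $\varepsilon>0$, $C>0$, $0\le\beta<1$, $|\Gamma(\alpha)|\le C|\alpha|^\beta$ whenever $|\alpha|>\varepsilon$. Suppose that $c=0$, or that $\mathrm{PV}\int_{-\infty}^\infty\frac{d\alpha'}{\xi(\alpha)-\xi(\alpha')}$ converges for all $\alpha\in\mathbb R$ (principal value at $\alpha'=\alpha$ and at infinity) and $\mathrm{PV}_\infty\int_{-\infty}^\infty\frac{d\alpha'}{z-\xi(\alpha')}$ converges for all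 $z$ with $\mathrm{dist}(z,\mathcal C)>0$. Here $\mathrm{PV}_\infty\int g=L$ means that $\int_{p-M_n}^{p+M_n}g\to L$ for some $p\in\mathbb R$ and some $M_n\nearrow\infty$, and that no other choice of $p$ and $(M_n)$ yields a different limit. Let $a\in C^\infty(\mathbb R;\mathbb R)$ satisfy $a(s)=1$ for $|s|\le1$, $a(s)=0$ for $|s|\ge2$, with $a$ increasing on $[-2,-1]$ and decreasing on $[1,2]$ (monotonically, not necessarily strictly). For $z\in\mathbb C$ put $$f_0=\frac{c}{z-\xi},\quad f_1^{a}=\frac{a(|z-\xi|^2)\tilde\gamma}{z-\xi},\quad f_2^{a}=\frac{2a'(|z-\xi|^2)\,\mathrm{Re}\big(\xi_\alpha\overline{(z-\xi)}\big)\Gamma}{z-\xi},\quad f_3^{a}=\frac{(1-a(|z-\xi|^2))\,\xi_\alpha\Gamma}{(z-\xi)^2},$$ functions of the parameter $\alpha'$ of the curve. For $z\notin\mathcal C$ the velocity $(u,v)(z)$, identified with $u+iv$, is defined by $$u-iv=\frac1{2\pi i}\Big(\mathrm{PV}_\infty\!\int f_0\,d\alpha'+\int f_1^{a}\,d\alpha'-\int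 f_2^{a}\,d\alpha'-\int f_3^{a}\,d\alpha'\Big),$$ and the Birkhoff–Rott integral $W(\alpha)$ is defined by giving $W^*(\alpha)=\overline{W(\alpha)}$ by the same formula with $z=\xi(\alpha)$, the integrals of $f_0$ and $f_1^{a}$ being principal values at $\alpha'=\alpha$ (and at infinity). Let $s_\alpha=|\xi_\alpha|$, $\hat{\mathbf t}=(x_\alpha,y_\alpha)/s_\alpha$ and $\hat{\mathbf n}=(-y_\alpha,x_\alpha)/s_\alpha$; "above" $\mathcal C$ is the side into which $\hat{\mathbf n}$ points, "below" the side into which $-\hat{\mathbf n}$ points. Then all integrals defining $(u,v)(z)$ converge for every $z\notin\mathcal C$, and the following holds. (1) For almost every $\alpha\in\mathbb R$ all integrals defining $W(\alpha)$ converge and, as $z\to\xi(\alpha)$ nontangentially (that is, within $\{|z-\xi(\alpha)|\le A\,\mathrm{dist}(z,\mathcal C)\}$, for any fixed $A$), $$(u,v)(z)\to W(\alpha)-\frac{\gamma(\alpha)}{2s_\alpha}\hat{\mathbf t}\ \text{ from above},\qquad (u,v)(z)\to W(\alpha)+\frac{\gamma(\alpha)}{2s_\alpha}\hat{\mathbf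 t}\ \text{ from below}.$$ (2) For every $\alpha$ in a neighbourhood of which $\gamma$ is Hölder continuous, $W(\alpha)$ converges and the same two limits hold for unrestricted approach $z\to\xi(\alpha)$ from above, respectively from below. In both cases the normal components (along $\hat{\mathbf n}$) of the two limits agree, so there is no jump in normal velocity, and the tangential component (along $\hat{\mathbf t}$) of the limit from below minus that of the limit from above equals $\gamma(\alpha)/s_\alpha$, the sheet strength per unit arclength. -/

import Mathlib

open MeasureTheory Filter Topology Set
open scoped ContDiff ComplexConjugate

noncomputable section

/-- `HasPVInfty g L`: the principal value at infinity of `∫ g` is well defined and equals `L`.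
Some centre `a` and some sequence `M n ↗ ∞` give `∫_{a - M n}^{a + M n} g → L`, and every other
choice of centre and sequence for which the limit exists gives the same limit. -/
def HasPVInfty (g : ℝ → ℂ) (L : ℂ) : Prop :=
  LocallyIntegrable g ∧
  (∃ (a : ℝ) (M : ℕ → ℝ), Monotone M ∧ Tendsto M atTop atTop ∧
    Tendsto (fun n => ∫ s in (a - M n)..(a + M n), g s) atTop (𝓝 L)) ∧
  ∀ (a : ℝ) (M : ℕ → ℝ) (L' : ℂ), Monotone M → Tendsto M atTop atTop →
    Tendsto (fun n => ∫ s in (a - M n)..(a + M n), g s) atTop (𝓝 L') → L' = L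

/-- `HasPV g p L`: the integral `∫ g` converges to `L` as a principal value both at the finite
point `p` and at infinity. The line is split at distance `1` from `p`. -/
def HasPV (g : ℝ → ℂ) (p : ℝ) (L : ℂ) : Prop :=
  ∃ N F : ℂ,
    (∀ ε : ℝ, 0 < ε → IntegrableOn g {s | ε < |s - p| ∧ |s - p| ≤ 1}) ∧
    Tendsto (fun ε : ℝ => ∫ s in {s | ε < |s - p| ∧ |s - p| ≤ 1}, g s) (𝓝[>] 0) (𝓝 N) ∧
    HasPVInfty ({s | 1 < |s - p|}.indicator g) F ∧
    L = N + F

/-- A principal value at infinity is unique. -/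
theorem HasPVInfty.unique {g : ℝ → ℂ} {L L' : ℂ} (h : HasPVInfty g L) (h' : HasPVInfty g L') :
    L = L' := by
  obtain ⟨a, M, hM, hM', hl⟩ := h.2.1
  exact h'.2.2 a M L hM hM' hl

/-- A principal value is unique. -/
theorem HasPV.unique {g : ℝ → ℂ} {p : ℝ} {L L' : ℂ} (h : HasPV g p L) (h' : HasPV g p L') :
    L = L' := by
  obtain ⟨N, F, -, hN, hF, rfl⟩ := h
  obtain ⟨N', F', -, hN', hF', rfl⟩ := h'
  rw [tendsto_nhds_unique hN hN', hF.unique hF']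

/-- `γ` is locally square integrable. -/
def LocallyL2 (γ : ℝ → ℝ) : Prop :=
  ∀ R : ℝ, MemLp γ 2 (volume.restrict (Icc (-R) R))

/-- `Γ` is an antiderivative of `γ - c`, and it grows sublinearly: `|Γ(α)| / |α|^β ≤ C` for
`|α| > ε`, for some `0 ≤ β < 1`. -/
def IsSublinearPrimitive (γ : ℝ → ℝ) (c : ℝ) (Γ : ℝ → ℝ) : Prop :=
  (∀ p q : ℝ, Γ q - Γ p = ∫ s in p..q, (γ s - c)) ∧
  ∃ ε > (0 : ℝ), ∃ C > (0 : ℝ), ∃ β : ℝ, 0 ≤ β ∧ β < 1 ∧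
    ∀ α : ℝ, ε < |α| → |Γ α| / |α| ^ β ≤ C

/-- The principal value integrals of `1 / (ξ(α) - ξ(α'))` and of `1 / (z - ξ(α'))`, for `z` at a
positive distance from the curve, converge. -/
def PVKernelConverges (ξ : ℝ → ℂ) : Prop :=
  (∀ α : ℝ, ∃ L : ℂ, HasPV (fun s => 1 / (ξ α - ξ s)) α L) ∧
  ∀ z : ℂ, 0 < Metric.infDist z (range ξ) → ∃ L : ℂ, HasPVInfty (fun s => 1 / (z - ξ s)) L

/-- The chord-arc condition. -/
def ChordArc (ξ : ℝ → ℂ) : Prop :=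
  ∃ K > (0 : ℝ), ∀ α α' : ℝ, α ≠ α' → K ≤ ‖(ξ α - ξ α') / ((α - α' : ℝ) : ℂ)‖

/-- The cutoff functions: smooth, `1` on `[-1, 1]`, `0` off `(-2, 2)`, and monotone on the two
transition intervals. -/
structure IsCutoff (a : ℝ → ℝ) : Prop where
  smooth : ContDiff ℝ ∞ a
  eq_one : ∀ s, |s| ≤ 1 → a s = 1
  eq_zero : ∀ s, 2 ≤ |s| → a s = 0
  mono : MonotoneOn a (Icc (-2) (-1))
  anti : AntitoneOn a (Icc 1 2)

/-! The four integrands at a point `z` of the plane, as functions of the parameter `s` on the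
curve. For the velocity `z` lies off the curve; for the Birkhoff-Rott integral `z = ξ α`. -/

/-- `c / (z - ξ)`. -/
def integrand₀ (ξ : ℝ → ℂ) (c : ℝ) (z : ℂ) (s : ℝ) : ℂ :=
  (c : ℂ) / (z - ξ s)

/-- `a(|z - ξ|²) (γ - c) / (z - ξ)`. -/
def integrand₁ (ξ : ℝ → ℂ) (γ a : ℝ → ℝ) (c : ℝ) (z : ℂ) (s : ℝ) : ℂ :=
  ((a (‖z - ξ s‖ ^ 2) * (γ s - c) : ℝ) : ℂ) / (z - ξ s)

/-- `2 a'(|z - ξ|²) Re(ξ_α conj(z - ξ)) Γ / (z - ξ)`. The factor `2` is the one produced by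
`∂_s |z - ξ(s)|² = -2 Re(ξ_α conj(z - ξ))`. -/
def integrand₂ (ξ : ℝ → ℂ) (a Γ : ℝ → ℝ) (z : ℂ) (s : ℝ) : ℂ :=
  ((2 * deriv a (‖z - ξ s‖ ^ 2) * (deriv ξ s * conj (z - ξ s)).re * Γ s : ℝ) : ℂ) / (z - ξ s)

/-- `(1 - a(|z - ξ|²)) ξ_α Γ / (z - ξ)²`. -/
def integrand₃ (ξ : ℝ → ℂ) (a Γ : ℝ → ℝ) (z : ℂ) (s : ℝ) : ℂ :=
  ((1 - a (‖z - ξ s‖ ^ 2) : ℝ) : ℂ) * deriv ξ s * (Γ s : ℂ) / (z - ξ s) ^ 2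

/-- All integrals defining the velocity `v = u₁ + i u₂` at the point `z` off the curve converge,
and the conjugate `u₁ - i u₂` is `(2πi)⁻¹ (PV_∞ ∫ f₀ + ∫ f₁ - ∫ f₂ - ∫ f₃)`. -/
def IsSheetVelocity (ξ : ℝ → ℂ) (γ a : ℝ → ℝ) (c : ℝ) (Γ : ℝ → ℝ) (z v : ℂ) : Prop :=
  Integrable (integrand₁ ξ γ a c z) ∧ Integrable (integrand₂ ξ a Γ z) ∧
  Integrable (integrand₃ ξ a Γ z) ∧
  ∃ L₀ : ℂ, HasPVInfty (integrand₀ ξ c z) L₀ ∧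
    conj v = 1 / (2 * (Real.pi : ℂ) * Complex.I) *
      (L₀ + (∫ s, integrand₁ ξ γ a c z s) - (∫ s, integrand₂ ξ a Γ z s)
        - ∫ s, integrand₃ ξ a Γ z s)

/-- All integrals defining the Birkhoff-Rott integral `W = W₁ + i W₂` at the parameter `α`
converge, the first two as principal values, and their combination is the conjugate of `w`. -/
def IsBirkhoffRott (ξ : ℝ → ℂ) (γ a : ℝ → ℝ) (c : ℝ) (Γ : ℝ → ℝ) (α : ℝ) (w : ℂ) : Prop :=
  Integrable (integrand₂ ξ a Γ (ξ α)) ∧ Integrable (integrand₃ ξ a Γ (ξ α)) ∧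
  ∃ L₀ L₁ : ℂ, HasPV (integrand₀ ξ c (ξ α)) α L₀ ∧ HasPV (integrand₁ ξ γ a c (ξ α)) α L₁ ∧
    conj w = 1 / (2 * (Real.pi : ℂ) * Complex.I) *
      (L₀ + L₁ - (∫ s, integrand₂ ξ a Γ (ξ α) s) - ∫ s, integrand₃ ξ a Γ (ξ α) s)

/-- The arclength element `s_α = |ξ_α|`. -/
def arclengthElement (ξ : ℝ → ℂ) (α : ℝ) : ℝ := ‖deriv ξ α‖

/-- The unit tangent `(x_α, y_α) / s_α`. -/
def unitTangent (ξ : ℝ → ℂ) (α : ℝ) : ℂ := deriv ξ α / (arclengthElement ξ α : ℂ)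

/-- The unit normal `(-y_α, x_α) / s_α`. -/
def unitNormal (ξ : ℝ → ℂ) (α : ℝ) : ℂ :=
  (⟨-(deriv ξ α).im, (deriv ξ α).re⟩ : ℂ) / (arclengthElement ξ α : ℂ)

/-- Unrestricted approach to `ξ α` from above: `z = ξ β + r n̂(β)` with `(β, r) → (α, 0)`, `r > 0`.
For a regular simple `C²` curve the points `ξ β + r n̂(β)` with `β` near `α` and `|r|` small fill a
neighbourhood of `ξ α`, and `r > 0` is the side into which `n̂` points. -/
def approachAbove (ξ : ℝ → ℂ) (α : ℝ) : Filter ℂ :=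
  map (fun p : ℝ × ℝ => ξ p.1 + (p.2 : ℂ) * unitNormal ξ p.1) (𝓝 α ×ˢ 𝓝[>] 0)

/-- Unrestricted approach to `ξ α` from below, the side into which `-n̂` points. -/
def approachBelow (ξ : ℝ → ℂ) (α : ℝ) : Filter ℂ :=
  map (fun p : ℝ × ℝ => ξ p.1 + (p.2 : ℂ) * unitNormal ξ p.1) (𝓝 α ×ˢ 𝓝[<] 0)

/-- The nontangential approach region of aperture `A` at `ξ α`. -/
def nontangentialRegion (ξ : ℝ → ℂ) (α A : ℝ) : Set ℂ :=
  {z | ‖z - ξ α‖ ≤ A * Metric.infDist z (range ξ)}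

/-- `γ` is Hölder continuous on a neighbourhood of `α`. -/
def HolderNear (γ : ℝ → ℝ) (α : ℝ) : Prop :=
  ∃ δ > (0 : ℝ), ∃ H > (0 : ℝ), ∃ θ > (0 : ℝ), ∀ s ∈ Ioo (α - δ) (α + δ),
    ∀ t ∈ Ioo (α - δ) (α + δ), |γ s - γ t| ≤ H * |s - t| ^ θ

/-- Jump relations at `ξ α` for the velocity field `V`, with limits taken along the filters
`above` and `below`: the limits are `w ∓ γ/(2 s_α) t̂`, the normal components of the two limits
agree, and the tangential components differ by `γ/s_α`. -/
def JumpRelations (ξ : ℝ → ℂ) (γ : ℝ → ℝ) (V : ℂ → ℂ) (α : ℝ) (w : ℂ)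
    (above below : Filter ℂ) : Prop :=
  ∃ Vabove Vbelow : ℂ,
    Tendsto V above (𝓝 Vabove) ∧ Tendsto V below (𝓝 Vbelow) ∧
    Vabove = w - ((γ α / (2 * arclengthElement ξ α) : ℝ) : ℂ) * unitTangent ξ α ∧
    Vbelow = w + ((γ α / (2 * arclengthElement ξ α) : ℝ) : ℂ) * unitTangent ξ α ∧
    inner ℝ Vabove (unitNormal ξ α) = inner ℝ Vbelow (unitNormal ξ α) ∧
    inner ℝ Vbelow (unitTangent ξ α) - inner ℝ Vabove (unitTangent ξ α)
      = γ α / arclengthElement ξ α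

end

/-!
Write `u = γ - c`. Both the velocity and the Birkhoff-Rott integral are `(2πi)⁻¹` times the sum of a
Cauchy integral of the constant density `c`, a cut off Cauchy integral of `u`, and two integrals of
`Γ` without singularity. The last two are continuous functions of `z` in the whole plane
(`integrand₂_regular`, `integrand₃_regular`): `a'(|z - ξ|²)` and `1 - a(|z - ξ|²)` vanish near
`z = ξ`, and the quadratic decay of the last kernel outweighs the sublinear growth of `Γ`. Split the
first two at `|s - α| = δ`. The far part of the second is continuous at `ξ α` (`far_integrand₁`), and the far
part of the first differs from its value at `ξ α` by an absolutely convergent integral that tends to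
zero (`far_integrand₀`), so that no information on the principal value at infinity is needed beyond
its existence at `ξ α`. The problem is thus reduced, in `exists_isBirkhoffRott_jumpRelations`, to
Plemelj's formula for the near parts: the limits of `∫ h / (z - ξ)` from the two sides are
`PV ∓ π i h(α) / ξ'(α)`. Since `conj (1 / ξ') = ξ' / |ξ'|²`, this jump is tangential.

*Hölder continuous densities* (`exists_plemelj_of_isHolderDensity`). Near `ξ α` use normal
coordinates `z = ξ β + r n̂(β)`, in which `|z - ξ(β + t)|` dominates `|r| + |t|`. Subtract from the
integrand the integrand of the constant density `h β` on the tangent line at `ξ β`. The difference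
is dominated by a multiple of `|t|^(θ - 1)` near `t = 0`, uniformly in `(β, r)`, so its integral is
continuous up to `r = 0`. What was subtracted integrates to an arctangent of a multiple of `1 / r`,
which jumps at `r = 0`.

*Densities that are locally `L²`* (`ae_exists_plemelj`). On the real line the Cauchy integral of
`f ∈ L²` in the upper half-plane is, by Plancherel, the Poisson integral of a frequency projection
of `f` (`exists_cauchy_eq_poisson`), hence it has vertical limits at all Lebesgue points of the
projection. At a Lebesgue point of `f`, and nontangentially, the Cauchy integral of `f - f(α)` and
its truncation at `|s - α| > |z - ξ α|` are asymptotically equal, because the difference of the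
kernels is dominated by an averaging kernel (`norm_kernel_sub_truncated_le`). Applied to the line,
this turns vertical limits into principal values; Taylor's formula transports the principal values
from the tangent line to the curve (`exists_hasCauchyPV_of_line`); applied to the curve, it turns the
principal values into nontangential limits. The constant density `f(α)` is Hölder continuous and
supplies the jump.
-/

/-! ### Averaging kernels at Lebesgue points -/

theorem lintegral_Ioi_two_mul_div_cube {ε t : ℝ} (hε : 0 < ε) (ht : 0 ≤ t) :
    ∫⁻ r in Ioi t, ENNReal.ofReal (2 * ε / (ε + r) ^ 3) = ENNReal.ofReal (ε / (ε + t) ^ 2) := by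
  have hd : ∀ x ∈ Ioi t, HasDerivAt (fun r => -(ε / (ε + r) ^ 2)) (2 * ε / (ε + x) ^ 3) x := by
    intro x hx
    have hx0 : ε + x ≠ 0 := by
      have : t < x := hx
      exact (by linarith : 0 < ε + x).ne'
    have h1 : HasDerivAt (fun r => (ε + r) ^ 2) (2 * (ε + x)) x := by
      simpa using ((hasDerivAt_id x).const_add ε).fun_pow 2
    have h2 := ((hasDerivAt_const x ε).fun_div h1 (by positivity)).fun_neg
    refine h2.congr_deriv ?_
    field_simp
    ring
  have hc : ContinuousWithinAt (fun r => -(ε / (ε + r) ^ 2)) (Ici t) t := by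
    apply ContinuousAt.continuousWithinAt
    have : (ε + t) ^ 2 ≠ 0 := by positivity
    fun_prop (disch := assumption)
  have hnn : ∀ x ∈ Ioi t, 0 ≤ 2 * ε / (ε + x) ^ 3 := by
    intro x hx
    have : t < x := hx
    have : 0 < ε + x := by linarith
    positivity
  have hlim : Tendsto (fun r => -(ε / (ε + r) ^ 2)) atTop (𝓝 0) := by
    rw [← neg_zero]
    apply Tendsto.neg
    apply Tendsto.div_atTop tendsto_const_nhds
    exact (tendsto_pow_atTop two_ne_zero).comp (tendsto_atTop_add_const_left _ _ tendsto_id)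
  have hi := integrableOn_Ioi_deriv_of_nonneg hc hd hnn hlim
  have hv := integral_Ioi_of_hasDerivAt_of_nonneg hc hd hnn hlim
  rw [← ofReal_integral_eq_lintegral_ofReal hi
    ((ae_restrict_iff' measurableSet_Ioi).2 (ae_of_all _ hnn)), hv]
  simp

theorem lintegral_Ioi_div_sq {ε : ℝ} (hε : 0 < ε) :
    ∫⁻ r in Ioi 0, ENNReal.ofReal (2 * ε / (ε + r) ^ 2) = 2 := by
  have hd : ∀ x ∈ Ioi (0 : ℝ), HasDerivAt (fun r => -(2 * ε / (ε + r))) (2 * ε / (ε + x) ^ 2) x := by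
    intro x hx
    have hx0 : ε + x ≠ 0 := by
      have : 0 < x := hx
      positivity
    have h1 : HasDerivAt (fun r => (ε + r)) 1 x := (hasDerivAt_id x).const_add ε
    have h2 := ((hasDerivAt_const x (2 * ε)).fun_div h1 hx0).fun_neg
    refine h2.congr_deriv ?_
    field_simp
    ring
  have hc : ContinuousWithinAt (fun r => -(2 * ε / (ε + r))) (Ici 0) 0 := by
    apply ContinuousAt.continuousWithinAt
    have : (ε + 0) ≠ 0 := by positivity
    fun_prop (disch := assumption)
  have hnn : ∀ x ∈ Ioi (0 : ℝ), 0 ≤ 2 * ε / (ε + x) ^ 2 := fun x hx => by positivity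
  have hlim : Tendsto (fun r => -(2 * ε / (ε + r))) atTop (𝓝 0) := by
    rw [← neg_zero]
    apply Tendsto.neg
    apply Tendsto.div_atTop tendsto_const_nhds
    exact (tendsto_atTop_add_const_left _ _ tendsto_id)
  have hi := integrableOn_Ioi_deriv_of_nonneg hc hd hnn hlim
  have hv := integral_Ioi_of_hasDerivAt_of_nonneg hc hd hnn hlim
  rw [← ofReal_integral_eq_lintegral_ofReal hi
    ((ae_restrict_iff' measurableSet_Ioi).2 (ae_of_all _ hnn)), hv]
  have : 2 * ε / ε = 2 := by field_simp
  simp [this]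

/-- Bounds on the averages of `φ` over small balls about `x` bound its averages against
`ε / (ε + |s - x|)²`: the kernel is the superposition of the indicators of `|s - x| < r` with
weights `2 ε / (ε + r)³`. -/
theorem lintegral_mul_kernel_le {φ : ℝ → ENNReal} {x ρ η ε : ℝ} (hφ : AEMeasurable φ)
    (hη : 0 ≤ η) (hε : 0 < ε) (hρ : 0 < ρ)
    (h : ∀ r, 0 < r → r ≤ ρ →
      ∫⁻ s in Metric.closedBall x r, φ s ≤ ENNReal.ofReal (η * r)) :
    ∫⁻ s in Metric.closedBall x ρ, φ s * ENNReal.ofReal (ε / (ε + |s - x|) ^ 2)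
      ≤ ENNReal.ofReal (2 * η) := by
  set κ : ℝ → ENNReal := fun r => ENNReal.ofReal (2 * ε / (ε + r) ^ 3) with hκ
  have hκm : Measurable κ := by fun_prop
  have hS : MeasurableSet {p : ℝ × ℝ | |p.1 - x| < p.2} :=
    measurableSet_lt (by fun_prop) (by fun_prop)
  calc
    _ = ∫⁻ s in Metric.closedBall x ρ, ∫⁻ r in Ioi 0,
          {p : ℝ × ℝ | |p.1 - x| < p.2}.indicator (fun p => φ p.1 * κ p.2) (s, r) := by
        refine lintegral_congr fun s => ?_
        rw [← lintegral_Ioi_two_mul_div_cube hε (abs_nonneg (s - x)),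
          ← lintegral_const_mul _ hκm]
        have : ∀ r, {p : ℝ × ℝ | |p.1 - x| < p.2}.indicator (fun p => φ p.1 * κ p.2) (s, r)
            = (Ioi |s - x|).indicator (fun r => φ s * κ r) r := by
          intro r
          simp [indicator]
        simp_rw [this]
        rw [lintegral_indicator measurableSet_Ioi, Measure.restrict_restrict measurableSet_Ioi,
          inter_eq_self_of_subset_left (Ioi_subset_Ioi (abs_nonneg _))]
    _ = ∫⁻ r in Ioi 0, ∫⁻ s in Metric.closedBall x ρ,
          {p : ℝ × ℝ | |p.1 - x| < p.2}.indicator (fun p => φ p.1 * κ p.2) (s, r) := by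
        apply lintegral_lintegral_swap
        refine AEMeasurable.indicator (AEMeasurable.mul ?_ ?_) hS
        · exact hφ.restrict.comp_quasiMeasurePreserving Measure.quasiMeasurePreserving_fst
        · exact (hκm.comp measurable_snd).aemeasurable
    _ ≤ ∫⁻ r in Ioi 0, ENNReal.ofReal η * ENNReal.ofReal (2 * ε / (ε + r) ^ 2) := by
        refine setLIntegral_mono (by fun_prop) fun r (hr : 0 < r) => ?_
        have e1 : ∀ s, {p : ℝ × ℝ | |p.1 - x| < p.2}.indicator (fun p => φ p.1 * κ p.2) (s, r)
            = (Metric.ball x r).indicator φ s * κ r := by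
          intro s
          simp [indicator, Real.dist_eq]
        simp_rw [e1]
        rw [lintegral_mul_const' _ _ ENNReal.ofReal_ne_top,
          lintegral_indicator measurableSet_ball, Measure.restrict_restrict measurableSet_ball]
        have e2 : ∫⁻ s in Metric.ball x r ∩ Metric.closedBall x ρ, φ s
            ≤ ENNReal.ofReal (η * r) := by
          rcases le_total r ρ with hr' | hr'
          · exact (lintegral_mono_set (inter_subset_left.trans Metric.ball_subset_closedBall)).trans
              (h r hr hr')
          · exact ((lintegral_mono_set inter_subset_right).trans (h ρ hρ le_rfl)).trans
              (ENNReal.ofReal_le_ofReal (by gcongr))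
        refine (mul_le_mul_left e2 _).trans ?_
        rw [← ENNReal.ofReal_mul (by positivity), ← ENNReal.ofReal_mul hη]
        refine ENNReal.ofReal_le_ofReal ?_
        have : r / (ε + r) ≤ 1 := by rw [div_le_one (by positivity)]; linarith
        calc η * r * (2 * ε / (ε + r) ^ 3) = η * (2 * ε / (ε + r) ^ 2) * (r / (ε + r)) := by
              field_simp
          _ ≤ η * (2 * ε / (ε + r) ^ 2) * 1 := by gcongr
          _ = _ := mul_one _
    _ = ENNReal.ofReal (2 * η) := by
        rw [lintegral_const_mul' _ _ ENNReal.ofReal_ne_top, lintegral_Ioi_div_sq hε, mul_comm,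
          ENNReal.ofReal_mul (by norm_num)]
        simp

/-- `x` is a Lebesgue point of `f`: the integral of `|f - f(x)|` over `[x - r, x + r]` is `o(r)`.
The value `f x` itself is used, not that of another representative. -/
def IsLebesguePoint (f : ℝ → ℂ) (x : ℝ) : Prop :=
  ∀ η > (0 : ℝ), ∀ᶠ r in 𝓝[>] (0 : ℝ), ∫ s in Metric.closedBall x r, ‖f s - f x‖ ≤ η * r

theorem ae_isLebesguePoint {f : ℝ → ℂ} (hf : LocallyIntegrable f) :
    ∀ᵐ x, IsLebesguePoint f x := by
  filter_upwards [IsUnifLocDoublingMeasure.ae_tendsto_average_norm_sub volume hf 1] with x hx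
  intro η hη
  have h := hx (fun _ : ℝ => x) (fun r => r) tendsto_id (by
    filter_upwards [self_mem_nhdsWithin] with r hr
    simpa using le_of_lt hr)
  filter_upwards [h.eventually (gt_mem_nhds (half_pos hη)), self_mem_nhdsWithin] with r hr hr0
  have hr0 : 0 < r := hr0
  rw [setAverage_eq] at hr
  have hv : volume.real (Metric.closedBall x r) = 2 * r := by
    rw [Measure.real, Real.volume_closedBall, ENNReal.toReal_ofReal (by positivity)]
  rw [hv, smul_eq_mul, inv_mul_lt_iff₀ (by positivity)] at hr
  linarith

/-- At a Lebesgue point the mean oscillation of `f`, averaged against the kernel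
`ε / (ε + |s - x|)²`, vanishes as `ε → 0`. -/
theorem IsLebesguePoint.tendsto_kernel {f : ℝ → ℂ} {x δ : ℝ} (hx : IsLebesguePoint f x)
    (hf : LocallyIntegrable f) :
    Tendsto (fun ε => ∫ s in Metric.closedBall x δ, ‖f s - f x‖ * (ε / (ε + |s - x|) ^ 2))
      (𝓝[>] 0) (𝓝 0) := by
  have hfi : ∀ r, IntegrableOn (fun s => ‖f s - f x‖) (Metric.closedBall x r) := fun r =>
    ((hf.integrableOn_isCompact (isCompact_closedBall x r)).sub
      (integrableOn_const measure_closedBall_lt_top.ne)).norm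
  have hsm : AEMeasurable fun s => ENNReal.ofReal ‖f s - f x‖ := by
    have : AEStronglyMeasurable f := hf.aestronglyMeasurable
    exact ((this.sub aestronglyMeasurable_const).norm.aemeasurable).ennreal_ofReal
  rw [Metric.tendsto_nhds]
  intro e he
  -- near `x` the averages are small; away from `x` the kernel is at most `ε / ρ ^ 2`
  obtain ⟨ρ, hρ0, hρ⟩ : ∃ ρ > 0, ∀ r, 0 < r → r ≤ ρ →
      ∫ s in Metric.closedBall x r, ‖f s - f x‖ ≤ e / 8 * r := by
    obtain ⟨u, hu, hu'⟩ := (mem_nhdsGT_iff_exists_Ioc_subset).1 (hx (e / 8) (by positivity))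
    exact ⟨u, hu, fun r h1 h2 => hu' ⟨h1, h2⟩⟩
  set I := ∫ s in Metric.closedBall x δ, ‖f s - f x‖ with hI
  have hI0 : 0 ≤ I := integral_nonneg fun _ => norm_nonneg _
  have hsmall : ∀ᶠ ε in 𝓝[>] (0 : ℝ), I * (ε / ρ ^ 2) < e / 4 := by
    have : Tendsto (fun ε : ℝ => I * (ε / ρ ^ 2)) (𝓝[>] 0) (𝓝 (I * (0 / ρ ^ 2))) := by
      apply Tendsto.mono_left _ nhdsWithin_le_nhds
      exact (tendsto_id.div_const _).const_mul _
    exact this.eventually (gt_mem_nhds (by simpa using he))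
  filter_upwards [hsmall, self_mem_nhdsWithin] with ε hε hε0
  have hε0 : 0 < ε := hε0
  have hk : ∀ s, 0 ≤ ε / (ε + |s - x|) ^ 2 := fun s => by positivity
  have hkb : ∀ s, ε / (ε + |s - x|) ^ 2 ≤ 1 / ε := fun s => by
    rw [div_le_div_iff₀ (by positivity) hε0]
    nlinarith [abs_nonneg (s - x), mul_nonneg hε0.le (abs_nonneg (s - x))]
  have hcont : Continuous fun s => ε / (ε + |s - x|) ^ 2 := by
    have : ∀ s, (ε + |s - x|) ^ 2 ≠ 0 := fun s => by positivity
    fun_prop (disch := assumption)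
  have hint : ∀ r, IntegrableOn (fun s => ‖f s - f x‖ * (ε / (ε + |s - x|) ^ 2))
      (Metric.closedBall x r) := fun r => by
    refine (hfi r).mul_bdd (c := 1 / ε) hcont.aestronglyMeasurable (ae_of_all _ fun s => ?_)
    rw [Real.norm_of_nonneg (hk s)]
    exact hkb s
  have hnear : ∫ s in Metric.closedBall x ρ, ‖f s - f x‖ * (ε / (ε + |s - x|) ^ 2) ≤ e / 4 := by
    have h := lintegral_mul_kernel_le (x := x) (ρ := ρ) (η := e / 8) hsm (by positivity) hε0 hρ0
      (fun r h1 h2 => by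
        rw [← ofReal_integral_eq_lintegral_ofReal (hfi r) (ae_of_all _ fun _ => norm_nonneg _)]
        exact ENNReal.ofReal_le_ofReal (hρ r h1 h2))
    simp_rw [← ENNReal.ofReal_mul (norm_nonneg _)] at h
    rw [← ofReal_integral_eq_lintegral_ofReal (hint ρ)
      (ae_of_all _ fun s => mul_nonneg (norm_nonneg _) (hk s)),
      ENNReal.ofReal_le_ofReal_iff (by positivity)] at h
    linarith
  have hfar : ∫ s in Metric.closedBall x δ \ Metric.closedBall x ρ,
      ‖f s - f x‖ * (ε / (ε + |s - x|) ^ 2) ≤ I * (ε / ρ ^ 2) := by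
    calc _ ≤ ∫ s in Metric.closedBall x δ \ Metric.closedBall x ρ,
            ‖f s - f x‖ * (ε / ρ ^ 2) := by
          refine setIntegral_mono_on ((hint δ).mono_set sdiff_subset)
            (((hfi δ).mono_set sdiff_subset).mul_const _)
            (measurableSet_closedBall.diff measurableSet_closedBall) fun s hs => ?_
          have : ρ < |s - x| := by simpa [Real.dist_eq] using hs.2
          gcongr
          linarith
      _ ≤ ∫ s in Metric.closedBall x δ, ‖f s - f x‖ * (ε / ρ ^ 2) :=
          setIntegral_mono_set ((hfi δ).mul_const _)
            (ae_of_all _ fun s => mul_nonneg (norm_nonneg _) (by positivity))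
            sdiff_subset.eventuallyLE
      _ = _ := integral_mul_const _ _
  have hsplit : ∫ s in Metric.closedBall x δ, ‖f s - f x‖ * (ε / (ε + |s - x|) ^ 2)
      ≤ (∫ s in Metric.closedBall x ρ, ‖f s - f x‖ * (ε / (ε + |s - x|) ^ 2)) +
        ∫ s in Metric.closedBall x δ \ Metric.closedBall x ρ,
          ‖f s - f x‖ * (ε / (ε + |s - x|) ^ 2) := by
    rw [← integral_inter_add_sdiff measurableSet_closedBall (hint δ) (t := Metric.closedBall x ρ)]
    have := setIntegral_mono_set (hint ρ)
      (ae_of_all _ fun s => mul_nonneg (norm_nonneg _) (hk s))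
      (inter_subset_right (s := Metric.closedBall x δ)).eventuallyLE
    linarith
  have hpos : 0 ≤ ∫ s in Metric.closedBall x δ, ‖f s - f x‖ * (ε / (ε + |s - x|) ^ 2) :=
    integral_nonneg fun s => mul_nonneg (norm_nonneg _) (hk s)
  rw [Real.dist_eq, sub_zero, abs_of_nonneg hpos]
  linarith

/-! ### The Fourier transform on `L¹ ∩ L²` -/

open FourierTransform in
/-- On `L¹ ∩ L²` the Plancherel extension of the Fourier transform is the Fourier integral. -/
theorem fourier_toLp_ae_eq {e : ℝ → ℂ} (h1 : Integrable e) (h2 : MemLp e 2) :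
    ((𝓕 (h2.toLp e) : Lp ℂ 2 (volume : Measure ℝ)) : ℝ → ℂ) =ᵐ[volume] 𝓕 e := by
  apply ae_eq_of_integral_contDiff_smul_eq
  · exact (Lp.memLp _).locallyIntegrable (by norm_num)
  · exact (VectorFourier.fourierIntegral_continuous Real.continuous_fourierChar
      (by exact continuous_inner) h1).locallyIntegrable
  · intro g hg hgc
    have hg₁ : HasCompactSupport (Complex.ofRealCLM ∘ g) := hgc.comp_left rfl
    have hg₂ : ContDiff ℝ ∞ (Complex.ofRealCLM ∘ g) := by fun_prop
    set G : SchwartzMap ℝ ℂ := hg₁.toSchwartzMap hg₂ with hG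
    have hGg : ∀ x, G x = (g x : ℂ) := fun x => by simp [hG]
    have key : ∫ x, G x • ((𝓕 (h2.toLp e) : Lp ℂ 2 (volume : Measure ℝ)) : ℝ → ℂ) x
        = ∫ x, (𝓕 G) x • e x := by
      rw [← Lp.toTemperedDistribution_apply, ← Lp.fourier_toTemperedDistribution_eq,
        TemperedDistribution.fourier_apply, Lp.toTemperedDistribution_apply]
      refine integral_congr_ae ?_
      filter_upwards [h2.coeFn_toLp] with x hx
      rw [hx]
    have flip := VectorFourier.integral_fourierIntegral_smul_eq_flip (μ := volume) (ν := volume)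
      (L := innerₗ ℝ) (f := (G : ℝ → ℂ)) (g := e) Real.continuous_fourierChar
      continuous_inner G.integrable h1
    simp only [← Complex.coe_smul, ← hGg]
    rw [key]
    simp only [flip_innerₗ] at flip
    exact flip

/-! ### Boundary values of Cauchy integrals on the line -/

/-- The one-sided exponential: `e^{-a k}` for `k > 0` and `0` for `k ≤ 0`. -/
noncomputable def oneSidedExp (a : ℂ) (k : ℝ) : ℂ :=
  (Ioi (0 : ℝ)).indicator (fun k : ℝ => Complex.exp (-a * k)) k

theorem integrable_oneSidedExp {a : ℂ} (ha : 0 < a.re) : Integrable (oneSidedExp a) := by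
  have := integrableOn_exp_mul_complex_Ioi (a := -a) (by simpa using ha) 0
  exact this.integrable_indicator measurableSet_Ioi

theorem memLp_two_oneSidedExp {a : ℂ} (ha : 0 < a.re) : MemLp (oneSidedExp a) 2 := by
  rw [memLp_two_iff_integrable_sq_norm (integrable_oneSidedExp ha).aestronglyMeasurable]
  have h2 : 0 < ((2 : ℂ) * a).re := by simpa using ha
  refine (integrable_oneSidedExp h2).norm.congr (ae_of_all _ fun k => ?_)
  by_cases hk : k ∈ Ioi (0 : ℝ)
  · simp only [oneSidedExp, indicator_of_mem hk, Complex.norm_exp, ← Real.exp_nat_mul]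
    congr 1
    simp
    ring
  · simp [oneSidedExp, indicator_of_notMem hk]

open FourierTransform in
theorem fourier_oneSidedExp {a : ℂ} (ha : 0 < a.re) (s : ℝ) :
    𝓕 (oneSidedExp a) s = 1 / (a + 2 * Real.pi * Complex.I * s) := by
  rw [Real.fourier_eq']
  have : ∀ k : ℝ, Complex.exp (↑(-2 * Real.pi * inner ℝ k s) * Complex.I) • oneSidedExp a k
      = (Ioi (0 : ℝ)).indicator
        (fun k : ℝ => Complex.exp (-(a + 2 * Real.pi * Complex.I * s) * k)) k := by
    intro k
    by_cases hk : k ∈ Ioi (0 : ℝ)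
    · simp only [oneSidedExp, indicator_of_mem hk, smul_eq_mul, ← Complex.exp_add]
      congr 1
      simp
      ring
    · simp [oneSidedExp, indicator_of_notMem hk]
  simp_rw [this]
  rw [integral_indicator measurableSet_Ioi, integral_exp_mul_complex_Ioi (by simpa using ha)]
  rw [Complex.ofReal_zero, mul_zero, Complex.exp_zero, neg_div_neg_eq]

open FourierTransform in
theorem fourier_oneSidedExp_neg {a : ℂ} (ha : 0 < a.re) (s : ℝ) :
    𝓕 (fun k => oneSidedExp a (-k)) s = 1 / (a - 2 * Real.pi * Complex.I * s) := by
  have h := fourier_oneSidedExp ha (-s)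
  rw [Real.fourier_eq'] at h ⊢
  rw [← integral_neg_eq_self] at h
  simpa [sub_eq_add_neg] using h

/-- The Poisson kernel is the sum of the Fourier transforms of two exponentials, supported on
`k > 0` and on `k < 0`. -/
theorem poisson_kernel_eq (x y s : ℝ) (hy : 0 < y) :
    1 / ((2 * Real.pi * (y - x * Complex.I) : ℂ) + 2 * Real.pi * Complex.I * s)
      + 1 / ((2 * Real.pi * (y + x * Complex.I) : ℂ) - 2 * Real.pi * Complex.I * s)
    = ((1 / Real.pi * (y / (y ^ 2 + (s - x) ^ 2)) : ℝ) : ℂ) := by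
  have hpi : (Real.pi : ℂ) ≠ 0 := by exact_mod_cast Real.pi_ne_zero
  have h1 : (y + (s - x) * Complex.I : ℂ) ≠ 0 := fun h => hy.ne' (by simpa using congrArg Complex.re h)
  have h2 : (y - (s - x) * Complex.I : ℂ) ≠ 0 := fun h => hy.ne' (by simpa using congrArg Complex.re h)
  have h3 : ((y : ℂ) ^ 2 + (s - x) ^ 2) = (y + (s - x) * Complex.I) * (y - (s - x) * Complex.I) := by
    linear_combination ((s - x : ℂ) ^ 2) * Complex.I_sq
  push_cast
  rw [h3, show (2 * Real.pi * (y - x * Complex.I) : ℂ) + 2 * Real.pi * Complex.I * s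
    = 2 * Real.pi * (y + (s - x) * Complex.I) by ring,
    show (2 * Real.pi * (y + x * Complex.I) : ℂ) - 2 * Real.pi * Complex.I * s
    = 2 * Real.pi * (y - (s - x) * Complex.I) by ring]
  field_simp
  ring

/-- The Cauchy kernel is a multiple of the Fourier transform of the first of these exponentials
alone. -/
theorem cauchy_kernel_eq (x y s : ℝ) :
    1 / ((x : ℂ) + y * Complex.I - s)
      = (-2 * Real.pi * Complex.I) *
        (1 / ((2 * Real.pi * (y - x * Complex.I) : ℂ) + 2 * Real.pi * Complex.I * s)) := by
  have hpi : (Real.pi : ℂ) ≠ 0 := by exact_mod_cast Real.pi_ne_zero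
  rw [show (2 * Real.pi * (y - x * Complex.I) : ℂ) + 2 * Real.pi * Complex.I * s
    = (-2 * Real.pi * Complex.I) * (x + y * Complex.I - s) by
      linear_combination (2 * Real.pi * y) * Complex.I_sq]
  rw [one_div, one_div, mul_inv, ← mul_assoc, mul_inv_cancel₀ (by simp [hpi]), one_mul]

open FourierTransform in
/-- In the upper half-plane the Cauchy integral of `f ∈ L²(ℝ)` is the Poisson integral of some
`g ∈ L²(ℝ)`: `g` is a multiple of the projection of `f` to a half-line of frequencies. -/
theorem exists_cauchy_eq_poisson {f : ℝ → ℂ} (hf : MemLp f 2) :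
    ∃ g : ℝ → ℂ, MemLp g 2 ∧ ∀ x y : ℝ, 0 < y →
      ∫ s, f s / ((x : ℂ) + y * Complex.I - s)
        = ∫ s, g s * ((y / (y ^ 2 + (s - x) ^ 2) : ℝ) : ℂ) := by
  -- the inner product is conjugate linear in its first argument
  have hfc : MemLp (fun s => conj (f s)) 2 := hf.star
  set F : Lp ℂ 2 (volume : Measure ℝ) := hfc.toLp _ with hF
  set H : Lp ℂ 2 (volume : Measure ℝ) := 𝓕⁻ F with hH
  have hHp : MemLp ((Ioi (0 : ℝ)).indicator H) 2 := (Lp.memLp H).indicator measurableSet_Ioi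
  set G : Lp ℂ 2 (volume : Measure ℝ) := 𝓕 (hHp.toLp _) with hG
  refine ⟨fun s => (-2 * Complex.I) * conj (G s), ((Lp.memLp G).star).const_mul _,
    fun x y hy => ?_⟩
  have hpi : (Real.pi : ℂ) ≠ 0 := by exact_mod_cast Real.pi_ne_zero
  set a : ℂ := 2 * Real.pi * (y - x * Complex.I) with ha
  set b : ℂ := 2 * Real.pi * (y + x * Complex.I) with hb
  have har : 0 < a.re := by simp [ha]; positivity
  have hbr : 0 < b.re := by simp [hb]; positivity
  have e1 := integrable_oneSidedExp har
  have e2 := memLp_two_oneSidedExp har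
  have n1 : Integrable fun k => oneSidedExp b (-k) := (integrable_oneSidedExp hbr).comp_neg
  have n2 : MemLp (fun k => oneSidedExp b (-k)) 2 :=
    (memLp_two_oneSidedExp hbr).comp_measurePreserving (Measure.measurePreserving_neg volume)
  have p1 : Integrable fun k => oneSidedExp a k + oneSidedExp b (-k) := e1.add n1
  have p2 : MemLp (fun k => oneSidedExp a k + oneSidedExp b (-k)) 2 := e2.add n2
  have hFe : ∀ s, 𝓕 (oneSidedExp a) s = 1 / (a + 2 * Real.pi * Complex.I * s) :=
    fourier_oneSidedExp har
  have hFp : ∀ s, 𝓕 (fun k => oneSidedExp a k + oneSidedExp b (-k)) s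
      = ((1 / Real.pi * (y / (y ^ 2 + (s - x) ^ 2)) : ℝ) : ℂ) := by
    intro s
    rw [← poisson_kernel_eq x y s hy, ← ha, ← hb, ← hFe, ← fourier_oneSidedExp_neg hbr]
    simp only [Real.fourier_eq, smul_add]
    refine integral_add ?_ ?_
    · exact (Real.fourierIntegral_convergent_iff s).2 e1
    · exact (Real.fourierIntegral_convergent_iff s).2 n1
  -- Plancherel; the exponential on `k < 0` does not see `H` restricted to `k > 0`
  have key : inner ℂ F (𝓕 (e2.toLp _)) = inner ℂ G (𝓕 (p2.toLp _)) := by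
    have : F = 𝓕 H := by rw [hH, FourierTransform.fourier_fourierInv_eq]
    rw [this, hG, Lp.inner_fourier_eq, Lp.inner_fourier_eq, L2.inner_def, L2.inner_def]
    refine integral_congr_ae ?_
    filter_upwards [e2.coeFn_toLp, p2.coeFn_toLp, hHp.coeFn_toLp] with k h1 h2 h3
    rw [h1, h2, h3]
    by_cases hk : 0 < k
    · have : ¬ k < 0 := not_lt.2 hk.le
      simp [oneSidedExp, indicator, hk, this]
    · simp [oneSidedExp, indicator, hk]
  rw [L2.inner_def, L2.inner_def] at key
  have k1 : ∫ s, f s / ((x : ℂ) + y * Complex.I - s)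
      = (-2 * Real.pi * Complex.I) * ∫ s, inner ℂ (F s) ((𝓕 (e2.toLp _) : Lp ℂ 2 _) s) := by
    rw [← integral_const_mul]
    refine integral_congr_ae ?_
    filter_upwards [fourier_toLp_ae_eq e1 e2, hfc.coeFn_toLp] with s h1 h2
    rw [h1, hF, h2, hFe, RCLike.inner_apply, div_eq_mul_one_div, cauchy_kernel_eq]
    simp
    ring
  rw [k1, key, ← integral_const_mul]
  refine integral_congr_ae ?_
  filter_upwards [fourier_toLp_ae_eq p1 p2] with s h1
  rw [h1, hFp, RCLike.inner_apply]
  push_cast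
  field_simp

theorem integral_closedBall_poisson (x : ℝ) {y δ : ℝ} (hy : 0 < y) (hδ : 0 ≤ δ) :
    ∫ s in Metric.closedBall x δ, y / (y ^ 2 + (s - x) ^ 2) = 2 * Real.arctan (δ / y) := by
  rw [Real.closedBall_eq_Icc, integral_Icc_eq_integral_Ioc,
    ← intervalIntegral.integral_of_le (by linarith)]
  have hd : ∀ s ∈ uIcc (x - δ) (x + δ), HasDerivAt (fun s => Real.arctan ((s - x) / y))
      (y / (y ^ 2 + (s - x) ^ 2)) s := by
    intro s _
    have h1 : HasDerivAt (fun s => (s - x) / y) (1 / y) s :=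
      ((hasDerivAt_id s).sub_const x).div_const y
    refine h1.arctan.congr_deriv ?_
    field_simp
  rw [intervalIntegral.integral_eq_sub_of_hasDerivAt hd]
  · simp [neg_div, Real.arctan_neg]
    ring
  · apply Continuous.intervalIntegrable
    have : ∀ s, y ^ 2 + (s - x) ^ 2 ≠ 0 := fun s => by positivity
    fun_prop (disch := assumption)

theorem tendsto_arctan_div {δ : ℝ} (hδ : 0 < δ) :
    Tendsto (fun y => Real.arctan (δ / y)) (𝓝[>] 0) (𝓝 (Real.pi / 2)) := by
  have h1 : Tendsto (fun y : ℝ => δ / y) (𝓝[>] 0) atTop := by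
    simp_rw [div_eq_mul_inv]
    exact tendsto_inv_nhdsGT_zero.const_mul_atTop hδ
  exact (tendsto_nhds_of_tendsto_nhdsWithin Real.tendsto_arctan_atTop).comp h1

theorem integrableOn_compl_closedBall_inv_sq (x : ℝ) {δ : ℝ} (hδ : 0 < δ) :
    IntegrableOn (fun s => 1 / (s - x) ^ 2) (Metric.closedBall x δ)ᶜ := by
  have h : IntegrableOn (fun s : ℝ => 2 * (1 + δ⁻¹ ^ 2) * (1 + (s - x) ^ 2)⁻¹)
      (Metric.closedBall x δ)ᶜ :=
    ((integrable_inv_one_add_sq.comp_sub_right x).const_mul _).integrableOn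
  refine h.mono' (Measurable.aestronglyMeasurable (by fun_prop)) ((ae_restrict_iff' measurableSet_closedBall.compl).2
    (ae_of_all _ fun s hs => ?_))
  have hs' : δ < |s - x| := by simpa [Real.dist_eq] using hs
  have h1 : δ ^ 2 < (s - x) ^ 2 := by rw [← sq_abs (s - x)]; gcongr
  have h0 : 0 < (s - x) ^ 2 := lt_trans (by positivity) h1
  rw [Real.norm_of_nonneg (by positivity), div_le_iff₀ h0, ← div_eq_mul_inv, div_mul_eq_mul_div,
    le_div_iff₀ (by positivity)]
  have h2 : 1 ≤ δ⁻¹ ^ 2 * (s - x) ^ 2 := by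
    rw [inv_pow, ← div_eq_inv_mul, one_le_div (by positivity)]
    exact h1.le
  nlinarith

/-- The Poisson integral of an `L²` function converges at each Lebesgue point. -/
theorem tendsto_poisson {g : ℝ → ℂ} (hg : MemLp g 2) {x : ℝ} (hx : IsLebesguePoint g x) :
    Tendsto (fun y : ℝ => ∫ s, g s * ((y / (y ^ 2 + (s - x) ^ 2) : ℝ) : ℂ)) (𝓝[>] 0)
      (𝓝 (g x * Real.pi)) := by
  have hloc : LocallyIntegrable g := hg.locallyIntegrable (by norm_num)
  set B := Metric.closedBall x 1 with hB
  have hBm : MeasurableSet B := measurableSet_closedBall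
  have hfar : IntegrableOn (fun s => ‖g s‖ * (1 / (s - x) ^ 2)) Bᶜ := by
    have h1 := integrableOn_compl_closedBall_inv_sq x one_pos
    have h2 : MemLp (fun s : ℝ => 1 / (s - x) ^ 2) 2 (volume.restrict Bᶜ) := by
      rw [memLp_two_iff_integrable_sq_norm (Measurable.aestronglyMeasurable (by fun_prop))]
      refine h1.mono' (Measurable.aestronglyMeasurable (by fun_prop)) ((ae_restrict_iff' hBm.compl).2 (ae_of_all _ fun s hs => ?_))
      have hs' : 1 < |s - x| := by simpa [hB, Real.dist_eq] using hs
      have h1 : 1 < (s - x) ^ 2 := by rw [← sq_abs (s - x)]; nlinarith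
      have h3 : 0 ≤ 1 / (s - x) ^ 2 := by positivity
      have h4 : 1 / (s - x) ^ 2 ≤ 1 := by rw [div_le_one (by linarith)]; exact h1.le
      rw [Real.norm_of_nonneg (by positivity), Real.norm_of_nonneg h3]
      nlinarith
    exact (hg.norm.restrict _).integrable_mul h2
  have hkc : ∀ y : ℝ, 0 < y → Continuous fun s => y / (y ^ 2 + (s - x) ^ 2) := fun y hy => by
    have : ∀ s, y ^ 2 + (s - x) ^ 2 ≠ 0 := fun s => by positivity
    fun_prop (disch := assumption)
  have hk0 : ∀ y s : ℝ, 0 < y → 0 ≤ y / (y ^ 2 + (s - x) ^ 2) := fun y s hy => by positivity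
  have hki : ∀ y : ℝ, 0 < y → ∀ s, ‖((y / (y ^ 2 + (s - x) ^ 2) : ℝ) : ℂ)‖ ≤ 1 / y := by
    intro y hy s
    rw [Complex.norm_real, Real.norm_of_nonneg (hk0 y s hy), div_le_div_iff₀ (by positivity) hy]
    nlinarith [sq_nonneg (s - x)]
  have hcc : ∀ y : ℝ, 0 < y → Continuous fun s => ((y / (y ^ 2 + (s - x) ^ 2) : ℝ) : ℂ) :=
    fun y hy => Complex.continuous_ofReal.comp (hkc y hy)
  have hgB : IntegrableOn g B := hloc.integrableOn_isCompact (isCompact_closedBall x 1)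
  have hcB : IntegrableOn (fun _ => g x) B := integrableOn_const measure_closedBall_lt_top.ne
  have hfm : ∀ y : ℝ, 0 < y → ∀ s ∈ Bᶜ, ‖g s * ((y / (y ^ 2 + (s - x) ^ 2) : ℝ) : ℂ)‖
      ≤ y * (‖g s‖ * (1 / (s - x) ^ 2)) := by
    intro y hy s hs
    have hs' : 1 < |s - x| := by simpa [hB, Real.dist_eq] using hs
    have h1 : 1 < (s - x) ^ 2 := by rw [← sq_abs (s - x)]; nlinarith
    rw [norm_mul, Complex.norm_real, Real.norm_of_nonneg (hk0 y s hy), mul_left_comm, mul_one_div]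
    gcongr
    nlinarith
  have hfi : ∀ y : ℝ, 0 < y →
      IntegrableOn (fun s => g s * ((y / (y ^ 2 + (s - x) ^ 2) : ℝ) : ℂ)) Bᶜ := fun y hy =>
    (hfar.const_mul y).mono' (hloc.aestronglyMeasurable.restrict.mul
      (hcc y hy).aestronglyMeasurable)
      ((ae_restrict_iff' hBm.compl).2 (ae_of_all _ (hfm y hy)))
  have hsplit : ∀ y : ℝ, 0 < y → ∫ s, g s * ((y / (y ^ 2 + (s - x) ^ 2) : ℝ) : ℂ)
      = (∫ s in B, (g s - g x) * ((y / (y ^ 2 + (s - x) ^ 2) : ℝ) : ℂ))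
        + g x * ((2 * Real.arctan (1 / y) : ℝ) : ℂ)
        + ∫ s in Bᶜ, g s * ((y / (y ^ 2 + (s - x) ^ 2) : ℝ) : ℂ) := by
    intro y hy
    have i1 := (hgB.sub hcB).mul_bdd (hcc y hy).aestronglyMeasurable (ae_of_all _ (hki y hy))
    have i2 := hcB.mul_bdd (hcc y hy).aestronglyMeasurable (ae_of_all _ (hki y hy))
    have i3 : IntegrableOn (fun s => g s * ((y / (y ^ 2 + (s - x) ^ 2) : ℝ) : ℂ)) B :=
      hgB.mul_bdd (hcc y hy).aestronglyMeasurable (ae_of_all _ (hki y hy))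
    rw [← integral_closedBall_poisson x hy zero_le_one, ← integral_complex_ofReal,
      ← integral_const_mul, ← hB]
    have i12 := integral_add i1 i2
    simp only [Pi.sub_apply] at i12
    rw [← i12, ← integral_add_compl hBm]
    · simp only [sub_mul, sub_add_cancel]
    · rw [← integrableOn_univ, ← union_compl_self B]
      exact i3.union (hfi y hy)
  have l1 : Tendsto (fun y : ℝ => ∫ s in B, (g s - g x) * ((y / (y ^ 2 + (s - x) ^ 2) : ℝ) : ℂ))
      (𝓝[>] 0) (𝓝 0) := by
    have h := (hx.tendsto_kernel hloc (δ := 1)).const_mul 2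
    rw [mul_zero] at h
    refine squeeze_zero_norm' ?_ h
    filter_upwards [self_mem_nhdsWithin] with y (hy : 0 < y)
    rw [← integral_const_mul]
    refine norm_integral_le_of_norm_le ?_ (ae_of_all _ fun s => ?_)
    · refine Integrable.const_mul ?_ _
      have hc : Continuous fun s => y / (y + |s - x|) ^ 2 := by
        have : ∀ s, (y + |s - x|) ^ 2 ≠ 0 := fun s => by positivity
        fun_prop (disch := assumption)
      refine (hgB.sub hcB).norm.mul_bdd (c := 1 / y) hc.aestronglyMeasurable (ae_of_all _ fun s => ?_)
      rw [Real.norm_of_nonneg (by positivity), div_le_div_iff₀ (by positivity) hy]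
      nlinarith [abs_nonneg (s - x), mul_nonneg hy.le (abs_nonneg (s - x))]
    · rw [norm_mul, Complex.norm_real, Real.norm_of_nonneg (hk0 y s hy), mul_left_comm]
      gcongr
      rw [mul_div_assoc', div_le_div_iff₀ (by positivity) (by positivity), ← sq_abs (s - x)]
      nlinarith [mul_nonneg hy.le (sq_nonneg (y - |s - x|))]
  have l2 : Tendsto (fun y : ℝ => g x * ((2 * Real.arctan (1 / y) : ℝ) : ℂ)) (𝓝[>] 0)
      (𝓝 (g x * Real.pi)) := by
    refine Tendsto.const_mul _ ?_
    have := (tendsto_arctan_div one_pos).const_mul 2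
    rw [mul_div_cancel₀ _ two_ne_zero] at this
    exact (Complex.continuous_ofReal.tendsto _).comp this
  have l3 : Tendsto (fun y : ℝ => ∫ s in Bᶜ, g s * ((y / (y ^ 2 + (s - x) ^ 2) : ℝ) : ℂ))
      (𝓝[>] 0) (𝓝 0) := by
    have h : Tendsto (fun y : ℝ => y * ∫ s in Bᶜ, ‖g s‖ * (1 / (s - x) ^ 2)) (𝓝[>] 0) (𝓝 0) := by
      apply Tendsto.mono_left _ nhdsWithin_le_nhds
      have := (tendsto_id (α := ℝ) (x := 𝓝 0)).mul_const (∫ s in Bᶜ, ‖g s‖ * (1 / (s - x) ^ 2))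
      rwa [zero_mul] at this
    refine squeeze_zero_norm' ?_ h
    filter_upwards [self_mem_nhdsWithin] with y (hy : 0 < y)
    rw [← integral_const_mul]
    exact norm_integral_le_of_norm_le (hfar.const_mul y)
      ((ae_restrict_iff' hBm.compl).2 (ae_of_all _ (hfm y hy)))
  have := (l1.add l2).add l3
  rw [zero_add, add_zero] at this
  refine this.congr' ?_
  filter_upwards [self_mem_nhdsWithin] with y (hy : 0 < y)
  exact (hsplit y hy).symm

/-- The Cauchy integral of an `L²` function over the line converges along almost every vertical
ray. -/
theorem ae_exists_tendsto_cauchy {f : ℝ → ℂ} (hf : MemLp f 2) :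
    ∀ᵐ x : ℝ, ∃ L : ℂ, Tendsto (fun y : ℝ => ∫ s, f s / ((x : ℂ) + y * Complex.I - s))
      (𝓝[>] 0) (𝓝 L) := by
  obtain ⟨g, hg, h⟩ := exists_cauchy_eq_poisson hf
  filter_upwards [ae_isLebesguePoint (hg.locallyIntegrable (by norm_num))] with x hx
  refine ⟨_, (tendsto_poisson hg hx).congr' ?_⟩
  filter_upwards [self_mem_nhdsWithin] with y (hy : 0 < y)
  exact (h x y hy).symm

/-! ### Geometry of the curve -/

/-- A `C²` curve with chord-arc constant `K` and speed between `1 / M` and `M`. -/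
structure IsChordArcCurve (ξ : ℝ → ℂ) (K M : ℝ) : Prop where
  contDiff : ContDiff ℝ 2 ξ
  K_pos : 0 < K
  M_pos : 0 < M
  le_dist : ∀ s t : ℝ, K * |s - t| ≤ ‖ξ s - ξ t‖
  le_speed : ∀ s, 1 / M ≤ ‖deriv ξ s‖
  speed_le : ∀ s, ‖deriv ξ s‖ ≤ M

theorem ChordArc.exists_le {ξ : ℝ → ℂ} (h : ChordArc ξ) :
    ∃ K > 0, ∀ s t : ℝ, K * |s - t| ≤ ‖ξ s - ξ t‖ := by
  obtain ⟨K, hK, h⟩ := h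
  refine ⟨K, hK, fun s t => ?_⟩
  rcases eq_or_ne s t with rfl | hst
  · simp
  · have := h s t hst
    rwa [norm_div, Complex.norm_real, Real.norm_eq_abs,
      le_div_iff₀ (abs_pos.2 (sub_ne_zero.2 hst))] at this

theorem deriv_ofReal (s : ℝ) : deriv (fun s : ℝ => (s : ℂ)) s = 1 := by
  simpa using ((hasDerivAt_id s).ofReal_comp).deriv

theorem isChordArcCurve_ofReal : IsChordArcCurve (fun s : ℝ => (s : ℂ)) 1 1 where
  contDiff := Complex.ofRealCLM.contDiff
  K_pos := one_pos
  M_pos := one_pos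
  le_dist s t := by rw [one_mul, ← Complex.ofReal_sub, Complex.norm_real, Real.norm_eq_abs]
  le_speed s := by simp [deriv_ofReal]
  speed_le s := by simp [deriv_ofReal]

namespace IsChordArcCurve

variable {ξ : ℝ → ℂ} {K M : ℝ}

theorem continuous (h : IsChordArcCurve ξ K M) : Continuous ξ := h.contDiff.continuous

theorem differentiable (h : IsChordArcCurve ξ K M) : Differentiable ℝ ξ :=
  h.contDiff.differentiable (by norm_num)

theorem continuous_deriv (h : IsChordArcCurve ξ K M) : Continuous (deriv ξ) :=
  h.contDiff.continuous_deriv (by norm_num)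

theorem speed_pos (h : IsChordArcCurve ξ K M) (s : ℝ) : 0 < ‖deriv ξ s‖ :=
  lt_of_lt_of_le (by have := h.M_pos; positivity) (h.le_speed s)

theorem deriv_ne_zero (h : IsChordArcCurve ξ K M) (s : ℝ) : deriv ξ s ≠ 0 :=
  norm_pos_iff.1 (h.speed_pos s)

theorem ne (h : IsChordArcCurve ξ K M) {s t : ℝ} (hst : s ≠ t) : ξ s - ξ t ≠ 0 := by
  have h1 := h.le_dist s t
  have : 0 < |s - t| := abs_pos.2 (sub_ne_zero.2 hst)
  have := mul_pos h.K_pos this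
  exact norm_pos_iff.1 (by linarith)

theorem le_dist' (h : IsChordArcCurve ξ K M) (α s : ℝ) : K * |s - α| ≤ ‖ξ α - ξ s‖ := by
  rw [abs_sub_comm]
  exact h.le_dist α s

theorem isClosed_range (h : IsChordArcCurve ξ K M) : IsClosed (range ξ) := by
  have ha : AntilipschitzWith (Real.toNNReal K⁻¹) ξ := by
    refine AntilipschitzWith.of_le_mul_dist fun s t => ?_
    rw [Real.coe_toNNReal _ (inv_nonneg.2 h.K_pos.le), Real.dist_eq, dist_eq_norm,
      ← div_eq_inv_mul, le_div_iff₀ h.K_pos, mul_comm]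
    exact h.le_dist s t
  have hl : LipschitzWith (Real.toNNReal M) ξ := by
    refine lipschitzWith_of_nnnorm_deriv_le h.differentiable fun s => ?_
    rw [← NNReal.coe_le_coe, Real.coe_toNNReal _ h.M_pos.le]
    exact h.speed_le s
  exact ha.isClosed_range hl.uniformContinuous

theorem infDist_pos (h : IsChordArcCurve ξ K M) {z : ℂ} (hz : z ∉ range ξ) :
    0 < Metric.infDist z (range ξ) :=
  (h.isClosed_range.notMem_iff_infDist_pos (range_nonempty ξ)).1 hz

/-- Taylor's formula to first order, uniformly for base points `β` near `α`. -/
theorem exists_taylor (h : IsChordArcCurve ξ K M) (α : ℝ) :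
    ∃ B > 0, ∀ β t : ℝ, |β - α| ≤ 1 → |t| ≤ 1 →
      ‖ξ (β + t) - ξ β - deriv ξ β * t‖ ≤ B * t ^ 2 := by
  have hd : ContDiff ℝ 1 (deriv ξ) := ContDiff.deriv' (by rw [one_add_one_eq_two]; exact h.contDiff)
  have hdd : Continuous (deriv (deriv ξ)) := hd.continuous_deriv le_rfl
  obtain ⟨B, hB⟩ := (isCompact_Icc (a := α - 2) (b := α + 2)).exists_bound_of_continuousOn
    hdd.continuousOn
  refine ⟨max B 1, by positivity, fun β t hβ ht => ?_⟩
  have hβ' := abs_le.1 hβ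
  have ht' := abs_le.1 ht
  have hlip : ∀ u ∈ Icc (α - 2) (α + 2), ∀ v ∈ Icc (α - 2) (α + 2),
      ‖deriv ξ v - deriv ξ u‖ ≤ max B 1 * |v - u| := fun u hu v hv =>
    (convex_Icc _ _).norm_image_sub_le_of_norm_deriv_le
      (fun x _ => hd.differentiable (by norm_num) x)
      (fun x hx => (hB x hx).trans (le_max_left _ _)) hu hv
  have hder : ∀ x, HasDerivAt (fun s : ℝ => ξ s - deriv ξ β * s) (deriv ξ x - deriv ξ β) x := by
    intro x
    have := (Complex.ofRealCLM.hasDerivAt (x := x)).const_mul (deriv ξ β)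
    simpa using (h.differentiable x).hasDerivAt.fun_sub this
  have hb : ‖(ξ (β + t) - deriv ξ β * ((β + t : ℝ) : ℂ)) - (ξ β - deriv ξ β * (β : ℂ))‖
      ≤ max B 1 * |t| * ‖(β + t) - β‖ := by
    refine (convex_uIcc β (β + t)).norm_image_sub_le_of_norm_hasDerivWithin_le
      (fun x _ => (hder x).hasDerivWithinAt) (fun x hx => ?_) left_mem_uIcc right_mem_uIcc
    have h1 : |x - β| ≤ |t| := by
      have := abs_sub_left_of_mem_uIcc hx
      simpa using this
    have h2 := abs_le.1 (h1.trans ht)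
    refine (hlip β ⟨by linarith, by linarith⟩ x ⟨by linarith, by linarith⟩).trans ?_
    gcongr
  rw [add_sub_cancel_left, Real.norm_eq_abs, mul_assoc, ← sq, sq_abs] at hb
  convert hb using 2
  push_cast
  ring

theorem _root_.unitNormal_eq (ξ : ℝ → ℂ) (β : ℝ) :
    unitNormal ξ β = deriv ξ β * (Complex.I / ‖deriv ξ β‖) := by
  have : (⟨-(deriv ξ β).im, (deriv ξ β).re⟩ : ℂ) = deriv ξ β * Complex.I := by
    apply Complex.ext <;> simp
  rw [unitNormal, arclengthElement, this, mul_div_assoc]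

theorem norm_unitNormal (h : IsChordArcCurve ξ K M) (β : ℝ) : ‖unitNormal ξ β‖ = 1 := by
  rw [unitNormal_eq]
  have := h.speed_pos β
  simp [this.ne']

theorem continuous_unitNormal (h : IsChordArcCurve ξ K M) : Continuous (unitNormal ξ) := by
  have h1 : unitNormal ξ = fun β => deriv ξ β * (Complex.I / ‖deriv ξ β‖) :=
    funext (unitNormal_eq ξ)
  have h2 := h.continuous_deriv
  have h3 : ∀ β, (‖deriv ξ β‖ : ℂ) ≠ 0 := fun β => by exact_mod_cast (h.speed_pos β).ne'
  rw [h1]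
  exact h2.mul (continuous_const.div (Complex.continuous_ofReal.comp h2.norm) h3)

/-- In normal coordinates `(β, r)` near `α` the distance to the curve point with parameter
`β + t` is at least a multiple of `|r| + |t|`. -/
theorem exists_normal_coordinates (h : IsChordArcCurve ξ K M) (α : ℝ) :
    ∃ η > 0, ∃ c > 0, ∀ β r t : ℝ, |β - α| < η → |r| < η →
      c * (|r| + |t|) ≤ ‖ξ β + (r : ℂ) * unitNormal ξ β - ξ (β + t)‖ := by
  obtain ⟨B, hB, hT⟩ := h.exists_taylor α
  have hK := h.K_pos
  have hM := h.M_pos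
  set t₀ := min 1 (1 / (4 * M * B)) with ht₀
  have ht₀p : 0 < t₀ := by positivity
  refine ⟨min 1 (K * t₀ / 4), by positivity, min (1 / 2) (min (1 / (4 * M)) (K / 2)),
    by positivity, fun β r t hβ hr => ?_⟩
  set c := min (1 / 2) (min (1 / (4 * M)) (K / 2)) with hc
  have hc1 : c ≤ 1 / 2 := min_le_left _ _
  have hc2 : c ≤ 1 / (4 * M) := (min_le_right _ _).trans (min_le_left _ _)
  have hc3 : c ≤ K / 2 := (min_le_right _ _).trans (min_le_right _ _)
  have hr1 : |r| < K * t₀ / 4 := hr.trans_le (min_le_right _ _)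
  have hr0 := abs_nonneg r
  have ht0 := abs_nonneg t
  -- for `|t| ≤ t₀` the tangent line at `ξ β` governs the distance, for larger `|t|` the chord-arc
  -- condition does
  rcases le_or_gt |t| t₀ with ht | ht
  · have h1 := hT β t (hβ.le.trans (min_le_left _ _)) (ht.trans (min_le_left _ _))
    have h2 : B * t ^ 2 ≤ 1 / (4 * M) * |t| := by
      rw [← sq_abs]
      have : |t| ≤ 1 / (4 * M * B) := ht.trans (min_le_right _ _)
      calc B * |t| ^ 2 = B * |t| * |t| := by ring
        _ ≤ B * |t| * (1 / (4 * M * B)) := by gcongr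
        _ = _ := by field_simp
    set σ := ‖deriv ξ β‖ with hσ
    have hσp : 0 < σ := h.speed_pos β
    have hσM : 1 / M ≤ σ := h.le_speed β
    have h3 : (|r| + σ * |t|) / 2 ≤ ‖(r : ℂ) * unitNormal ξ β - deriv ξ β * t‖ := by
      have e : (r : ℂ) * unitNormal ξ β - deriv ξ β * t
          = deriv ξ β * (((-t : ℝ) : ℂ) + ((r / σ : ℝ) : ℂ) * Complex.I) := by
        rw [unitNormal_eq]
        push_cast
        ring
      set w : ℂ := ((-t : ℝ) : ℂ) + ((r / σ : ℝ) : ℂ) * Complex.I with hw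
      have hre : |w.re| = |t| := by simp [hw]
      have him : σ * |w.im| = |r| := by
        simp only [hw, Complex.add_im, Complex.ofReal_im, Complex.mul_im, Complex.ofReal_re,
          Complex.I_im, Complex.I_re, mul_one, mul_zero, zero_add, add_zero]
        rw [abs_div, abs_of_pos hσp, mul_div_cancel₀ _ hσp.ne']
      have n1 := Complex.abs_re_le_norm w
      have n2 := Complex.abs_im_le_norm w
      rw [e, norm_mul, ← hσ, ← him, ← hre]
      nlinarith
    have h4 : ‖(r : ℂ) * unitNormal ξ β - deriv ξ β * t‖
        ≤ ‖ξ β + (r : ℂ) * unitNormal ξ β - ξ (β + t)‖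
          + ‖ξ (β + t) - ξ β - deriv ξ β * t‖ := by
      refine le_trans (le_of_eq ?_) (norm_add_le _ _)
      congr 1
      ring
    have h5 : 1 / M * |t| ≤ σ * |t| := by gcongr
    have h6 : c * |r| ≤ 1 / 2 * |r| := by gcongr
    have h7 : c * |t| ≤ 1 / (4 * M) * |t| := by gcongr
    have h8 : 1 / (4 * M) * |t| = 1 / M * |t| / 4 := by field_simp
    linarith
  · have h1 := h.le_dist (β + t) β
    rw [add_sub_cancel_left] at h1
    have h2 : ‖ξ (β + t) - ξ β‖ ≤ ‖ξ β + (r : ℂ) * unitNormal ξ β - ξ (β + t)‖ + |r| := by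
      have : |r| = ‖(r : ℂ) * unitNormal ξ β‖ := by
        rw [norm_mul, h.norm_unitNormal, Complex.norm_real, Real.norm_eq_abs, mul_one]
      rw [this, ← norm_neg (ξ β + (r : ℂ) * unitNormal ξ β - ξ (β + t))]
      refine le_trans (le_of_eq ?_) (norm_add_le _ _)
      congr 1
      ring
    have h3 : K * t₀ ≤ K * |t| := by gcongr
    have h6 : c * |r| ≤ 1 / 2 * |r| := by gcongr
    have h7 : c * |t| ≤ K / 2 * |t| := by gcongr
    linarith

end IsChordArcCurve

/-! ### Cauchy integrals of Hölder continuous densities -/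

theorem integrable_indicator_abs_rpow {θ R : ℝ} (hθ : 0 < θ) :
    Integrable ((Metric.closedBall (0 : ℝ) R).indicator fun t : ℝ => |t| ^ (θ - 1)) := by
  rw [integrable_indicator_iff measurableSet_closedBall]
  rcases lt_or_ge R 0 with hR | hR
  · simp [Metric.closedBall_eq_empty.2 hR]
  have h1 : IntegrableOn (fun t : ℝ => |t| ^ (θ - 1)) (Icc 0 R) := by
    have := (intervalIntegral.intervalIntegrable_rpow' (a := 0) (b := R)
      (by linarith : -1 < θ - 1))
    rw [intervalIntegrable_iff_integrableOn_Icc_of_le hR] at this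
    refine this.congr_fun (fun t ht => ?_) measurableSet_Icc
    simp [abs_of_nonneg ht.1]
  have h2 : IntegrableOn (fun t : ℝ => |t| ^ (θ - 1)) (Icc (-R) 0) := by
    have := (Measure.measurePreserving_neg (volume : Measure ℝ)).integrableOn_comp_preimage
      (Homeomorph.neg ℝ).measurableEmbedding (f := fun t : ℝ => |t| ^ (θ - 1)) (s := Icc 0 R)
    have h3 := this.2 h1
    simpa [Function.comp_def] using h3
  have := h2.union h1
  rwa [Icc_union_Icc_eq_Icc (by linarith) hR, show Icc (-R) R = Metric.closedBall 0 R by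
    rw [Real.closedBall_eq_Icc, zero_sub, zero_add]] at this

/-- The Cauchy integral of the constant density on a segment `[-m, m]`, at height `ρ` above its
midpoint. Its real part vanishes by symmetry, and its imaginary part is a Poisson integral. -/
theorem integral_closedBall_cauchy {m ρ : ℝ} (hm : 0 < m) (hρ : ρ ≠ 0) :
    ∫ t in Metric.closedBall (0 : ℝ) m, 1 / (Complex.I * ρ - t : ℂ)
      = -2 * Complex.I * Real.arctan (m / ρ) := by
  have hne : ∀ t : ℝ, (Complex.I * ρ - t : ℂ) ≠ 0 := fun t h => hρ (by simpa using congrArg Complex.im h)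
  have hne' : ∀ t : ℝ, (Complex.I * ρ + t : ℂ) ≠ 0 := fun t h => hρ (by simpa using congrArg Complex.im h)
  have hc : Continuous fun t : ℝ => 1 / (Complex.I * ρ - t : ℂ) := by
    fun_prop (disch := assumption)
  have hc' : Continuous fun t : ℝ => 1 / (Complex.I * ρ + t : ℂ) := by
    fun_prop (disch := assumption)
  have hi : IntegrableOn (fun t : ℝ => 1 / (Complex.I * ρ - t : ℂ)) (Metric.closedBall 0 m) :=
    hc.locallyIntegrable.integrableOn_isCompact (isCompact_closedBall _ _)
  have hi' : IntegrableOn (fun t : ℝ => 1 / (Complex.I * ρ + t : ℂ)) (Metric.closedBall 0 m) :=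
    hc'.locallyIntegrable.integrableOn_isCompact (isCompact_closedBall _ _)
  have hflip : ∫ t in Metric.closedBall (0 : ℝ) m, 1 / (Complex.I * ρ - t : ℂ)
      = ∫ t in Metric.closedBall (0 : ℝ) m, 1 / (Complex.I * ρ + t : ℂ) := by
    have := (Measure.measurePreserving_neg (volume : Measure ℝ)).setIntegral_preimage_emb
      (Homeomorph.neg ℝ).measurableEmbedding (fun t : ℝ => 1 / (Complex.I * ρ + t : ℂ))
      (Metric.closedBall 0 m)
    rw [← this]
    simp [sub_eq_add_neg]
  have hsum : (∫ t in Metric.closedBall (0 : ℝ) m, 1 / (Complex.I * ρ - t : ℂ))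
      + ∫ t in Metric.closedBall (0 : ℝ) m, 1 / (Complex.I * ρ + t : ℂ)
      = -2 * Complex.I * (2 * Real.arctan (m / ρ)) := by
    rw [← integral_add hi hi']
    have : ∀ t : ℝ, 1 / (Complex.I * ρ - t : ℂ) + 1 / (Complex.I * ρ + t : ℂ)
        = -2 * Complex.I * ((ρ / (ρ ^ 2 + (t - 0) ^ 2) : ℝ) : ℂ) := by
      intro t
      have h3 : (ρ : ℂ) ^ 2 + t ^ 2 = -((Complex.I * ρ - t) * (Complex.I * ρ + t)) := by
        linear_combination (ρ : ℂ) ^ 2 * Complex.I_sq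
      push_cast
      rw [sub_zero, h3]
      have h1 := hne t
      have h2 := hne' t
      field_simp
      ring
    simp_rw [this]
    rw [integral_const_mul, integral_complex_ofReal]
    congr 1
    rcases lt_or_gt_of_ne hρ with h | h
    · have := integral_closedBall_poisson 0 (neg_pos.2 h) hm.le
      simp only [div_neg, Real.arctan_neg, neg_div, neg_sq, integral_neg] at this
      have h4 : ∫ s in Metric.closedBall (0 : ℝ) m, ρ / (ρ ^ 2 + (s - 0) ^ 2)
        = 2 * Real.arctan (m / ρ) := by linarith
      rw [h4]
      push_cast
      ring
    · rw [integral_closedBall_poisson 0 h hm.le]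
      push_cast
      ring
  rw [← hflip] at hsum
  linear_combination hsum / 2

/-- The symmetric truncations of `1 / t` have integral zero. -/
theorem integral_annulus_inv (ε m : ℝ) (k : ℂ) :
    ∫ t in {t : ℝ | ε < |t|} ∩ Metric.closedBall 0 m, k / (t : ℂ) = 0 := by
  have := (Measure.measurePreserving_neg (volume : Measure ℝ)).setIntegral_preimage_emb
    (Homeomorph.neg ℝ).measurableEmbedding (fun t : ℝ => k / (t : ℂ))
    ({t : ℝ | ε < |t|} ∩ Metric.closedBall 0 m)
  have h2 : (Neg.neg ⁻¹' ({t : ℝ | ε < |t|} ∩ Metric.closedBall 0 m))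
      = {t : ℝ | ε < |t|} ∩ Metric.closedBall 0 m := by
    ext t
    simp
  rw [h2] at this
  simp only [Complex.ofReal_neg, div_neg, integral_neg] at this
  exact self_eq_neg.1 this.symm

theorem measurableSet_truncation (α ε : ℝ) : MeasurableSet {s : ℝ | ε < |s - α|} :=
  measurableSet_lt measurable_const (by fun_prop)

theorem tendsto_integral_truncation {k : ℝ → ℂ} (hk : Integrable k) (α : ℝ) :
    Tendsto (fun ε : ℝ => ∫ s in {s | ε < |s - α|}, k s) (𝓝[>] 0) (𝓝 (∫ s, k s)) := by
  simp_rw [← integral_indicator (measurableSet_truncation α _)]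
  refine tendsto_integral_filter_of_dominated_convergence (fun s => ‖k s‖)
    (Eventually.of_forall fun ε => hk.aestronglyMeasurable.indicator (measurableSet_truncation α ε))
    (Eventually.of_forall fun ε => ae_of_all _ fun t => norm_indicator_le_norm_self _ _)
    hk.norm ?_
  filter_upwards [compl_mem_ae_iff.2 (measure_singleton (μ := (volume : Measure ℝ)) α)] with s hs
  have hs0 : 0 < |s - α| := abs_pos.2 (sub_ne_zero.2 hs)
  refine tendsto_const_nhds.congr' ?_
  filter_upwards [nhdsWithin_le_nhds (gt_mem_nhds hs0)] with ε hε
  rw [indicator_of_mem (by exact hε)]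

/-- The Cauchy integral of the density `h` along `ξ`. -/
noncomputable def cauchyIntegral (ξ : ℝ → ℂ) (h : ℝ → ℂ) (z : ℂ) : ℂ := ∫ s, h s / (z - ξ s)

/-- The symmetric truncations at `α` of the Cauchy integral of `h` at `ξ α` converge to `N`. -/
def HasCauchyPV (ξ : ℝ → ℂ) (h : ℝ → ℂ) (α : ℝ) (N : ℂ) : Prop :=
  Tendsto (fun ε : ℝ => ∫ s in {s | ε < |s - α|}, h s / (ξ α - ξ s)) (𝓝[>] 0) (𝓝 N)

theorem continuousAt_of_holder {f : ℝ → ℂ} {s δ H θ : ℝ} (hδ : 0 < δ) (hθ : 0 < θ)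
    (h : ∀ t, |t - s| < δ → ‖f t - f s‖ ≤ H * |t - s| ^ θ) : ContinuousAt f s := by
  rw [ContinuousAt, tendsto_iff_norm_sub_tendsto_zero]
  have h1 : Tendsto (fun t : ℝ => H * |t - s| ^ θ) (𝓝 s) (𝓝 0) := by
    have : ContinuousAt (fun t : ℝ => H * |t - s| ^ θ) s := by
      refine ContinuousAt.const_mul ?_ _
      exact ContinuousAt.rpow_const (by fun_prop) (Or.inr hθ.le)
    simpa [ContinuousAt, Real.zero_rpow hθ.ne'] using this
  refine squeeze_zero_norm' ?_ h1
  have : ∀ᶠ t in 𝓝 s, |t - s| < δ := Metric.ball_mem_nhds s hδ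
  filter_upwards [this] with t ht
  rw [norm_norm]
  exact h t ht

/-- A bounded density of compact support which is continuous almost everywhere and Hölder
continuous near `α`. -/
structure IsHolderDensity (h : ℝ → ℂ) (α : ℝ) : Prop where
  meas : AEStronglyMeasurable h
  bdd : ∃ S, ∀ s, ‖h s‖ ≤ S
  supp : ∃ R, ∀ s, R < |s - α| → h s = 0
  cont : ∀ᵐ s, ContinuousAt h s
  holder : ∃ δ > (0 : ℝ), ∃ H ≥ (0 : ℝ), ∃ θ > (0 : ℝ), ∀ s t, |s - α| < δ → |t - α| < δ →
    ‖h s - h t‖ ≤ H * |s - t| ^ θ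

theorem IsHolderDensity.continuousAt {h : ℝ → ℂ} {α : ℝ} (hh : IsHolderDensity h α) :
    ContinuousAt h α := by
  obtain ⟨δ, hδ, H, hH, θ, hθ, hol⟩ := hh.holder
  exact continuousAt_of_holder hδ hθ fun t ht => hol t α ht (by simpa using hδ)

/-- The Cauchy integrand at the point `z = ξ β + r n̂(β)` with normal coordinates `p = (β, r)`, as a
function of `t = s - β`. For `|t| ≤ m` the integrand of the constant density `h β` on the tangent
line through `ξ β` is subtracted; on this line `z - ξ β - t ξ'(β) = ξ'(β) (i r / |ξ'(β)| - t)`. -/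
noncomputable def regularizedKernel (ξ : ℝ → ℂ) (h : ℝ → ℂ) (m : ℝ) (p : ℝ × ℝ) (t : ℝ) : ℂ :=
  h (p.1 + t) / (ξ p.1 + (p.2 : ℂ) * unitNormal ξ p.1 - ξ (p.1 + t))
    - (Metric.closedBall (0 : ℝ) m).indicator
      (fun t : ℝ => h p.1 / deriv ξ p.1 * (1 / (Complex.I * ((p.2 / ‖deriv ξ p.1‖ : ℝ) : ℂ) - t))) t

theorem integrableOn_closedBall_cauchy (m : ℝ) {ρ : ℝ} (hρ : ρ ≠ 0) (k : ℂ) :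
    IntegrableOn (fun t : ℝ => k * (1 / (Complex.I * (ρ : ℂ) - t))) (Metric.closedBall 0 m) := by
  have hne : ∀ t : ℝ, (Complex.I * ρ - t : ℂ) ≠ 0 := fun t h => hρ (by simpa using congrArg Complex.im h)
  have hc : Continuous fun t : ℝ => 1 / (Complex.I * ρ - t : ℂ) := by
    fun_prop (disch := assumption)
  exact (hc.locallyIntegrable.integrableOn_isCompact (isCompact_closedBall _ _)).const_mul k

namespace IsChordArcCurve

variable {ξ : ℝ → ℂ} {K M : ℝ}

theorem aestronglyMeasurable_regularizedKernel (hc : IsChordArcCurve ξ K M) {h : ℝ → ℂ}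
    (hm : AEStronglyMeasurable h) (m : ℝ) (p : ℝ × ℝ) :
    AEStronglyMeasurable (regularizedKernel ξ h m p) := by
  have h1 : AEStronglyMeasurable fun t => h (p.1 + t) :=
    hm.comp_measurePreserving (measurePreserving_add_left volume p.1)
  have h2 := hc.continuous
  refine AEStronglyMeasurable.sub ?_ ?_
  · refine (h1.aemeasurable.div (Continuous.aemeasurable ?_)).aestronglyMeasurable
    fun_prop
  · exact (Measurable.aestronglyMeasurable (by fun_prop)).indicator measurableSet_closedBall

/-- The regularized kernels of all points near `ξ α` have a common integrable bound, of order
`|t|^(θ - 1)` near `t = 0`. -/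
theorem exists_regularizedKernel_bound (hc : IsChordArcCurve ξ K M) {h : ℝ → ℂ} {α : ℝ}
    (hh : IsHolderDensity h α) :
    ∃ m > 0, ∃ G : ℝ → ℝ, Integrable G ∧ ∀ᶠ p : ℝ × ℝ in 𝓝 (α, 0),
      ∀ᵐ t, ‖regularizedKernel ξ h m p t‖ ≤ G t := by
  obtain ⟨δ, hδ, H, hH, θ, hθ, hol⟩ := hh.holder
  obtain ⟨S, hS⟩ := hh.bdd
  obtain ⟨R, hR⟩ := hh.supp
  obtain ⟨B, hB, hT⟩ := hc.exists_taylor α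
  obtain ⟨η, hη, c, hcpos, hgeo⟩ := hc.exists_normal_coordinates α
  have hM := hc.M_pos
  have hS0 : 0 ≤ S := (norm_nonneg _).trans (hS 0)
  set m := min (δ / 2) 1 with hm
  have hmp : 0 < m := by positivity
  set R' := max (R + 1) 1 with hR'
  have hmR : m ≤ R' := (min_le_right _ _).trans (le_max_right _ _)
  refine ⟨m, hmp, fun t => H / c * ((Metric.closedBall (0 : ℝ) R').indicator
    (fun t : ℝ => |t| ^ (θ - 1)) t) + (Metric.closedBall (0 : ℝ) R').indicator
    (fun _ => S * M * B / c + S / (c * m)) t, ?_, ?_⟩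
  · refine ((integrable_indicator_abs_rpow hθ).const_mul _).add ?_
    rw [integrable_indicator_iff measurableSet_closedBall]
    exact integrableOn_const measure_closedBall_lt_top.ne
  have hev : ∀ᶠ p : ℝ × ℝ in 𝓝 (α, 0), |p.1 - α| < min η m ∧ |p.2| < η := by
    rw [nhds_prod_eq]
    have h1 : ∀ᶠ β in 𝓝 α, |β - α| < min η m := Metric.ball_mem_nhds α (lt_min hη hmp)
    have h2 : ∀ᶠ r in 𝓝 (0 : ℝ), |r| < η := by
      filter_upwards [Metric.ball_mem_nhds (0 : ℝ) hη] with r hr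
      simpa using hr
    exact h1.prod_mk h2
  filter_upwards [hev] with ⟨β, r⟩ ⟨hβ, hr⟩
  simp only at hβ hr
  have hβη := hβ.trans_le (min_le_left _ _)
  have hβm := hβ.trans_le (min_le_right _ _)
  have hβ1 : |β - α| ≤ 1 := hβm.le.trans (min_le_right _ _)
  have hβδ : |β - α| < δ / 2 := hβm.trans_le (min_le_left _ _)
  filter_upwards [compl_mem_ae_iff.2 (measure_singleton (μ := (volume : Measure ℝ)) 0)] with t ht
  have ht0 : 0 < |t| := abs_pos.2 ht
  have hg := hgeo β r t hβη hr
  set w := ξ β + (r : ℂ) * unitNormal ξ β - ξ (β + t) with hw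
  have hg' : c * |t| ≤ ‖w‖ := le_trans (by nlinarith [abs_nonneg r]) hg
  have hwp : 0 < ‖w‖ := lt_of_lt_of_le (by positivity) hg'
  have hw0 : w ≠ 0 := norm_pos_iff.1 hwp
  have hrp : 0 ≤ |t| ^ (θ - 1) := Real.rpow_nonneg ht0.le _
  by_cases htm : |t| ≤ m
  · have htB : t ∈ Metric.closedBall (0 : ℝ) m := by simpa [Real.dist_eq] using htm
    have htB' : t ∈ Metric.closedBall (0 : ℝ) R' := by simpa [Real.dist_eq] using htm.trans hmR
    have htay := hT β t hβ1 (htm.trans (min_le_right _ _))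
    set q : ℂ := Complex.I * ((r / ‖deriv ξ β‖ : ℝ) : ℂ) - t with hq
    have hqt : |t| ≤ ‖q‖ := by
      have := Complex.abs_re_le_norm q
      simpa [hq] using this
    have hq0 : q ≠ 0 := norm_pos_iff.1 (ht0.trans_le hqt)
    have hd0 := hc.deriv_ne_zero β
    have hdq : deriv ξ β * q - w = ξ (β + t) - ξ β - deriv ξ β * t := by
      rw [hq, hw, unitNormal_eq]
      push_cast
      ring
    -- Hölder continuity controls the first term, the curvature of `ξ` the second
    have e : regularizedKernel ξ h m (β, r) t
        = (h (β + t) - h β) / w + h β * (deriv ξ β * q - w) / (w * (deriv ξ β * q)) := by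
      rw [regularizedKernel, indicator_of_mem htB]
      simp only [← hw, ← hq]
      field_simp
      ring
    have hdt : 1 / M * |t| ≤ ‖deriv ξ β * q‖ := by
      rw [norm_mul]
      exact mul_le_mul (hc.le_speed β) hqt ht0.le (norm_nonneg _)
    have b1 : ‖(h (β + t) - h β) / w‖ ≤ H / c * |t| ^ (θ - 1) := by
      rw [norm_div]
      have h1 := hol (β + t) β (by
        have := abs_add_le t (β - α)
        have h2 : m ≤ δ / 2 := min_le_left _ _
        rw [show β + t - α = t + (β - α) by ring]
        linarith) (by linarith)
      rw [add_sub_cancel_left] at h1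
      calc ‖h (β + t) - h β‖ / ‖w‖ ≤ H * |t| ^ θ / (c * |t|) := by gcongr
        _ = _ := by rw [Real.rpow_sub_one ht0.ne']; field_simp
    have b2 : ‖h β * (deriv ξ β * q - w) / (w * (deriv ξ β * q))‖ ≤ S * M * B / c := by
      rw [norm_div, norm_mul, norm_mul w, hdq]
      calc _ ≤ S * (B * t ^ 2) / ((c * |t|) * (1 / M * |t|)) := by
            gcongr
            exact hS β
        _ = _ := by rw [← sq_abs t]; field_simp
    rw [e, indicator_of_mem htB', indicator_of_mem htB']
    have : 0 ≤ S / (c * m) := by positivity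
    exact (norm_add_le _ _).trans (by linarith)
  · have htB : t ∉ Metric.closedBall (0 : ℝ) m := by simpa [Real.dist_eq] using htm
    have e : regularizedKernel ξ h m (β, r) t = h (β + t) / w := by
      rw [regularizedKernel, indicator_of_notMem htB, sub_zero]
    rw [e]
    by_cases htR : t ∈ Metric.closedBall (0 : ℝ) R'
    · rw [indicator_of_mem htR, indicator_of_mem htR, norm_div]
      have h1 : ‖h (β + t)‖ / ‖w‖ ≤ S / (c * m) := by
        push Not at htm
        have : c * m ≤ ‖w‖ := le_trans (by gcongr) hg'
        gcongr
        exact hS _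
      have h2 : 0 ≤ S * M * B / c := by positivity
      have h3 : 0 ≤ H / c * |t| ^ (θ - 1) := by positivity
      linarith
    · rw [indicator_of_notMem htR, indicator_of_notMem htR, hR (β + t)]
      · simp
      · have h1 : R' < |t| := by simpa [Real.dist_eq] using htR
        have h2 : R + 1 ≤ R' := le_max_left _ _
        have h3 := abs_add_le (β + t - α) (α - β)
        rw [abs_sub_comm α β, show β + t - α + (α - β) = t by ring] at h3
        linarith

/-- The regularized kernel is continuous up to the curve, `r = 0`, for almost every `t`. -/
theorem ae_tendsto_regularizedKernel (hc : IsChordArcCurve ξ K M) {h : ℝ → ℂ} {α : ℝ}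
    (hh : IsHolderDensity h α) (m : ℝ) :
    ∀ᵐ t, Tendsto (fun p => regularizedKernel ξ h m p t) (𝓝 (α, 0))
      (𝓝 (regularizedKernel ξ h m (α, 0) t)) := by
  have hae : ∀ᵐ t, ContinuousAt h (α + t) :=
    (measurePreserving_add_left volume α).quasiMeasurePreserving.ae hh.cont
  filter_upwards [hae, compl_mem_ae_iff.2 (measure_singleton (μ := (volume : Measure ℝ)) 0)]
    with t hct ht
  have ht : t ≠ 0 := ht
  have hξ := hc.continuous
  have hn := hc.continuous_unitNormal
  have hd := hc.continuous_deriv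
  have c1 : ContinuousAt (fun p : ℝ × ℝ => h (p.1 + t)) (α, 0) :=
    ContinuousAt.comp (f := fun p : ℝ × ℝ => p.1 + t) (x := (α, (0 : ℝ))) hct (by fun_prop)
  have c2 : ContinuousAt (fun p : ℝ × ℝ =>
      ξ p.1 + (p.2 : ℂ) * unitNormal ξ p.1 - ξ (p.1 + t)) (α, 0) := by
    apply Continuous.continuousAt
    fun_prop
  have c3 : ContinuousAt (fun p : ℝ × ℝ => h p.1) (α, 0) :=
    ContinuousAt.comp (f := fun p : ℝ × ℝ => p.1) (x := (α, (0 : ℝ))) hh.continuousAt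
      continuousAt_fst
  have c4 : ContinuousAt (fun p : ℝ × ℝ => deriv ξ p.1) (α, 0) := by
    apply Continuous.continuousAt
    fun_prop
  have c5 : ContinuousAt (fun p : ℝ × ℝ =>
      (Complex.I * ((p.2 / ‖deriv ξ p.1‖ : ℝ) : ℂ) - t)) (α, 0) := by
    have h0 : ∀ p : ℝ × ℝ, ‖deriv ξ p.1‖ ≠ 0 := fun p => (hc.speed_pos p.1).ne'
    apply Continuous.continuousAt
    fun_prop (disch := assumption)
  have n2 : ξ α + ((0 : ℝ) : ℂ) * unitNormal ξ α - ξ (α + t) ≠ 0 := by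
    simpa using hc.ne (show α ≠ α + t by simpa using ht)
  have n5 : Complex.I * (((0 : ℝ) / ‖deriv ξ α‖ : ℝ) : ℂ) - t ≠ 0 := by simpa using ht
  have t1 := c1.div c2 n2
  have t2 := (c3.div c4 (hc.deriv_ne_zero α)).mul ((continuousAt_const (y := (1 : ℂ))).div c5 n5)
  by_cases htm : t ∈ Metric.closedBall (0 : ℝ) m
  · simp only [regularizedKernel, indicator_of_mem htm]
    exact t1.sub t2
  · simp only [regularizedKernel, indicator_of_notMem htm, sub_zero]
    exact t1

/-- Off the curve the Cauchy integral is the integral of the regularized kernel plus the explicit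
integral of what was subtracted; only the latter jumps at `p.2 = 0`. -/
theorem cauchyIntegral_eq_regularized (hc : IsChordArcCurve ξ K M) {h : ℝ → ℂ} {m : ℝ}
    (hm : 0 < m) {p : ℝ × ℝ} (hp : p.2 ≠ 0) (hi : Integrable (regularizedKernel ξ h m p)) :
    cauchyIntegral ξ h (ξ p.1 + (p.2 : ℂ) * unitNormal ξ p.1)
      = (∫ t, regularizedKernel ξ h m p t) + h p.1 / deriv ξ p.1 *
        (-2 * Complex.I * Real.arctan (m / (p.2 / ‖deriv ξ p.1‖))) := by
  have hρ : p.2 / ‖deriv ξ p.1‖ ≠ 0 := div_ne_zero hp (hc.speed_pos _).ne'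
  have hi2 := integrableOn_closedBall_cauchy m hρ (h p.1 / deriv ξ p.1)
  rw [← integral_closedBall_cauchy hm hρ, ← integral_const_mul,
    ← integral_indicator measurableSet_closedBall,
    ← integral_add hi (hi2.integrable_indicator measurableSet_closedBall), cauchyIntegral,
    ← integral_add_left_eq_self _ p.1]
  simp [regularizedKernel]

/-- Plemelj's formula for Hölder densities: the principal value of the Cauchy integral at `ξ α`
exists, and the limits of the Cauchy integral from the two sides differ from it by
`∓ π i h(α) / ξ'(α)`. -/
theorem exists_plemelj_of_isHolderDensity (hc : IsChordArcCurve ξ K M) {h : ℝ → ℂ} {α : ℝ}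
    (hh : IsHolderDensity h α) :
    ∃ N : ℂ, HasCauchyPV ξ h α N ∧
      Tendsto (cauchyIntegral ξ h) (approachAbove ξ α)
        (𝓝 (N - Real.pi * Complex.I * h α / deriv ξ α)) ∧
      Tendsto (cauchyIntegral ξ h) (approachBelow ξ α)
        (𝓝 (N + Real.pi * Complex.I * h α / deriv ξ α)) := by
  obtain ⟨m, hm, G, hG, hbound⟩ := hc.exists_regularizedKernel_bound hh
  have hint : ∀ᶠ p : ℝ × ℝ in 𝓝 (α, 0), Integrable (regularizedKernel ξ h m p) := by
    filter_upwards [hbound] with p hp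
    exact hG.mono' (hc.aestronglyMeasurable_regularizedKernel hh.meas m p) hp
  have hlim : Tendsto (fun p => ∫ t, regularizedKernel ξ h m p t) (𝓝 (α, 0))
      (𝓝 (∫ t, regularizedKernel ξ h m (α, 0) t)) :=
    tendsto_integral_filter_of_dominated_convergence G
      (Eventually.of_forall fun p => hc.aestronglyMeasurable_regularizedKernel hh.meas m p)
      hbound hG (hc.ae_tendsto_regularizedKernel hh m)
  have hfst : Tendsto (fun p : ℝ × ℝ => h p.1 / deriv ξ p.1) (𝓝 (α, 0))
      (𝓝 (h α / deriv ξ α)) := by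
    have h1 := hh.continuousAt.div hc.continuous_deriv.continuousAt (hc.deriv_ne_zero α)
    exact Tendsto.comp (g := fun s => h s / deriv ξ s) h1 (continuous_fst.tendsto' (α, (0 : ℝ)) α rfl)
  have harc : ∀ (l : Filter ℝ), l ≤ 𝓝 0 → ∀ v : ℝ,
      Tendsto (fun p : ℝ × ℝ => Real.arctan (m / (p.2 / ‖deriv ξ p.1‖))) (𝓝 α ×ˢ l) (𝓝 v) →
      (∀ᶠ r in l, r ≠ 0) →
      Tendsto (fun p : ℝ × ℝ => cauchyIntegral ξ h (ξ p.1 + (p.2 : ℂ) * unitNormal ξ p.1))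
        (𝓝 α ×ˢ l) (𝓝 ((∫ t, regularizedKernel ξ h m (α, 0) t) +
          h α / deriv ξ α * (-2 * Complex.I * v))) := by
    intro l hl v hv hne
    have hle : 𝓝 α ×ˢ l ≤ 𝓝 (α, (0 : ℝ)) := by
      rw [nhds_prod_eq]
      exact Filter.prod_mono le_rfl hl
    have hv' : Tendsto (fun p : ℝ × ℝ =>
        (-2 * Complex.I * (Real.arctan (m / (p.2 / ‖deriv ξ p.1‖)) : ℂ))) (𝓝 α ×ˢ l)
        (𝓝 (-2 * Complex.I * v)) :=
      ((Complex.continuous_ofReal.tendsto _).comp hv).const_mul _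
    refine ((hlim.mono_left hle).add ((hfst.mono_left hle).mul hv')).congr' ?_
    filter_upwards [hle hint, tendsto_snd.eventually hne] with p hp hp2
    exact (hc.cauchyIntegral_eq_regularized hm hp2 hp).symm
  have hσ : Tendsto (fun β => m * ‖deriv ξ β‖) (𝓝 α) (𝓝 (m * ‖deriv ξ α‖)) :=
    (hc.continuous_deriv.norm.tendsto α).const_mul m
  have hσpos : 0 < m * ‖deriv ξ α‖ := mul_pos hm (hc.speed_pos α)
  have hform : ∀ p : ℝ × ℝ, m / (p.2 / ‖deriv ξ p.1‖) = m * ‖deriv ξ p.1‖ * p.2⁻¹ := by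
    intro p
    rw [div_div_eq_mul_div, div_eq_mul_inv]
  refine ⟨∫ t, regularizedKernel ξ h m (α, 0) t, ?_, ?_, ?_⟩
  -- on the curve the subtracted term is `1 / t` up to a constant, whose truncations integrate to zero
  · have h0 : Integrable (regularizedKernel ξ h m (α, 0)) := hint.self_of_nhds
    have hset : ∀ ε : ℝ, MeasurableSet {t : ℝ | ε < |t|} := fun ε =>
      measurableSet_lt measurable_const continuous_abs.measurable
    have htr := tendsto_integral_truncation h0 0
    simp only [sub_zero] at htr
    refine htr.congr' ?_
    filter_upwards [self_mem_nhdsWithin] with ε (hε : 0 < ε)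
    have e1 : ∫ s in {s | ε < |s - α|}, h s / (ξ α - ξ s)
        = ∫ t in {t : ℝ | ε < |t|}, h (α + t) / (ξ α - ξ (α + t)) := by
      have := (measurePreserving_add_left volume α).setIntegral_preimage_emb
        (measurableEmbedding_addLeft α) (fun s => h s / (ξ α - ξ s)) {s | ε < |s - α|}
      rw [← this]
      congr 2
      ext t
      simp
    have e2 : ∀ t, h (α + t) / (ξ α - ξ (α + t)) = regularizedKernel ξ h m (α, 0) t +
        (Metric.closedBall (0 : ℝ) m).indicator
          (fun t : ℝ => -(h α / deriv ξ α) / (t : ℂ)) t := by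
      intro t
      by_cases ht : t ∈ Metric.closedBall (0 : ℝ) m
      · simp only [regularizedKernel, indicator_of_mem ht]
        simp
        ring
      · simp [regularizedKernel, indicator_of_notMem ht]
    have hint2 : IntegrableOn ((Metric.closedBall (0 : ℝ) m).indicator
        (fun t : ℝ => -(h α / deriv ξ α) / (t : ℂ))) {t : ℝ | ε < |t|} := by
      have hfin : IntegrableOn ((Metric.closedBall (0 : ℝ) m).indicator
          (fun _ => ‖h α / deriv ξ α‖ / ε)) {t : ℝ | ε < |t|} := by
        refine Integrable.integrableOn ?_
        rw [integrable_indicator_iff measurableSet_closedBall]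
        exact integrableOn_const measure_closedBall_lt_top.ne
      refine hfin.mono' ?_ ((ae_restrict_iff' (hset ε)).2 (ae_of_all _ fun t ht => ?_))
      · exact ((Measurable.aestronglyMeasurable (by fun_prop)).indicator
          measurableSet_closedBall)
      · have ht : ε < |t| := ht
        by_cases htm : t ∈ Metric.closedBall (0 : ℝ) m
        · rw [indicator_of_mem htm, indicator_of_mem htm, norm_div, norm_neg,
            Complex.norm_real, Real.norm_eq_abs]
          gcongr
        · rw [indicator_of_notMem htm, indicator_of_notMem htm, norm_zero]
    rw [e1]
    simp_rw [e2]
    rw [integral_add h0.integrableOn hint2, setIntegral_indicator measurableSet_closedBall,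
      integral_annulus_inv, add_zero]
  · have ha : Tendsto (fun p : ℝ × ℝ => Real.arctan (m / (p.2 / ‖deriv ξ p.1‖)))
        (𝓝 α ×ˢ 𝓝[>] 0) (𝓝 (Real.pi / 2)) := by
      refine (tendsto_nhds_of_tendsto_nhdsWithin Real.tendsto_arctan_atTop).comp ?_
      simp_rw [hform]
      exact (hσ.comp tendsto_fst).pos_mul_atTop hσpos (tendsto_inv_nhdsGT_zero.comp tendsto_snd)
    have := harc (𝓝[>] 0) nhdsWithin_le_nhds _ ha
      (by filter_upwards [self_mem_nhdsWithin] with r hr using ne_of_gt hr)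
    rw [approachAbove, tendsto_map'_iff]
    have e : h α / deriv ξ α * (-2 * Complex.I * ((Real.pi / 2 : ℝ) : ℂ))
        = -(Real.pi * Complex.I * h α / deriv ξ α) := by
      push_cast
      ring
    rw [e] at this
    rw [sub_eq_add_neg]
    exact this
  · have ha : Tendsto (fun p : ℝ × ℝ => Real.arctan (m / (p.2 / ‖deriv ξ p.1‖)))
        (𝓝 α ×ˢ 𝓝[<] 0) (𝓝 (-(Real.pi / 2))) := by
      refine (tendsto_nhds_of_tendsto_nhdsWithin Real.tendsto_arctan_atBot).comp ?_
      simp_rw [hform]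
      exact (hσ.comp tendsto_fst).pos_mul_atBot hσpos (tendsto_inv_nhdsLT_zero.comp tendsto_snd)
    have := harc (𝓝[<] 0) nhdsWithin_le_nhds _ ha
      (by filter_upwards [self_mem_nhdsWithin] with r hr using ne_of_lt hr)
    rw [approachBelow, tendsto_map'_iff]
    have e : h α / deriv ξ α * (-2 * Complex.I * ((-(Real.pi / 2) : ℝ) : ℂ))
        = Real.pi * Complex.I * h α / deriv ξ α := by
      push_cast
      ring
    rw [e] at this
    exact this

end IsChordArcCurve

/-- Cutting off outside `[α - δ, α + δ]` destroys continuity only at the two endpoints. -/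
theorem isHolderDensity_indicator {f : ℝ → ℂ} {α δ δ' H θ : ℝ} (hδ : 0 < δ) (hδ' : δ < δ')
    (hH : 0 ≤ H) (hθ : 0 < θ) (hol : ∀ s t, |s - α| < δ' → |t - α| < δ' →
      ‖f s - f t‖ ≤ H * |s - t| ^ θ) :
    IsHolderDensity ((Metric.closedBall α δ).indicator f) α := by
  have hcont : ∀ s, |s - α| < δ' → ContinuousAt f s := by
    intro s hs
    refine continuousAt_of_holder (sub_pos.2 hs) hθ fun t ht => hol t s ?_ hs
    have := abs_add_le (t - s) (s - α)
    rw [sub_add_sub_cancel] at this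
    linarith
  have hmem : ∀ s, s ∈ Metric.closedBall α δ ↔ |s - α| ≤ δ := fun s => by
    rw [Metric.mem_closedBall, Real.dist_eq]
  have hon : ContinuousOn f (Metric.closedBall α δ) := fun s hs =>
    (hcont s (((hmem s).1 hs).trans_lt hδ')).continuousWithinAt
  refine ⟨?_, ?_, ⟨δ, ?_⟩, ?_, δ, hδ, H, hH, θ, hθ, ?_⟩
  · rw [aestronglyMeasurable_indicator_iff measurableSet_closedBall]
    exact hon.aestronglyMeasurable measurableSet_closedBall
  · obtain ⟨S, hS⟩ := (isCompact_closedBall α δ).exists_bound_of_continuousOn hon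
    refine ⟨max S 0, fun s => ?_⟩
    by_cases hs : s ∈ Metric.closedBall α δ
    · rw [indicator_of_mem hs]
      exact (hS s hs).trans (le_max_left _ _)
    · rw [indicator_of_notMem hs, norm_zero]
      exact le_max_right _ _
  · intro s hs
    rw [indicator_of_notMem]
    rw [hmem]
    exact not_le.2 hs
  · have hnull : volume (Metric.sphere α δ) = 0 := Measure.addHaar_sphere_of_ne_zero _ _ hδ.ne'
    filter_upwards [compl_mem_ae_iff.2 hnull] with s hs
    have hs : |s - α| ≠ δ := by simpa [Real.dist_eq] using hs
    rcases lt_or_gt_of_ne hs with h | h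
    · refine (hcont s (h.trans hδ')).congr ?_
      have : ∀ᶠ t in 𝓝 s, |t - α| < δ :=
        (by fun_prop : Continuous fun t => |t - α|).continuousAt.eventually (gt_mem_nhds h)
      filter_upwards [this] with t ht
      rw [indicator_of_mem ((hmem t).2 ht.le)]
    · refine (continuousAt_const (y := (0 : ℂ))).congr ?_
      have : ∀ᶠ t in 𝓝 s, δ < |t - α| :=
        (by fun_prop : Continuous fun t => |t - α|).continuousAt.eventually (lt_mem_nhds h)
      filter_upwards [this] with t ht
      rw [indicator_of_notMem]
      rw [hmem]
      exact not_le.2 ht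
  · intro s t hs ht
    rw [indicator_of_mem ((hmem s).2 hs.le), indicator_of_mem ((hmem t).2 ht.le)]
    exact hol s t (hs.trans hδ') (ht.trans hδ')

theorem isHolderDensity_indicator_const {α δ : ℝ} (hδ : 0 < δ) (k : ℂ) :
    IsHolderDensity ((Metric.closedBall α δ).indicator fun _ => k) α :=
  isHolderDensity_indicator (H := 0) (θ := 1) hδ (lt_add_one δ) le_rfl one_pos (by simp)

/-! ### Approach to the curve -/

namespace IsChordArcCurve

variable {ξ : ℝ → ℂ} {K M : ℝ}

theorem tendsto_normal_coordinates (hc : IsChordArcCurve ξ K M) (α : ℝ) :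
    Tendsto (fun p : ℝ × ℝ => ξ p.1 + (p.2 : ℂ) * unitNormal ξ p.1) (𝓝 (α, 0)) (𝓝 (ξ α)) := by
  have h1 := hc.continuous
  have h2 := hc.continuous_unitNormal
  have : Continuous fun p : ℝ × ℝ => ξ p.1 + (p.2 : ℂ) * unitNormal ξ p.1 := by fun_prop
  exact this.tendsto' _ _ (by simp)

/-- Approach in normal coordinates with `r ≠ 0` is approach to `ξ α` through points off the curve. -/
theorem map_normal_coordinates_le (hc : IsChordArcCurve ξ K M) (α : ℝ) {l : Filter ℝ}
    (hl : l ≤ 𝓝 0) (hne : ∀ᶠ r in l, r ≠ 0) :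
    map (fun p : ℝ × ℝ => ξ p.1 + (p.2 : ℂ) * unitNormal ξ p.1) (𝓝 α ×ˢ l)
      ≤ 𝓝 (ξ α) ⊓ 𝓟 (range ξ)ᶜ := by
  have hle : 𝓝 α ×ˢ l ≤ 𝓝 (α, (0 : ℝ)) := by
    rw [nhds_prod_eq]
    exact Filter.prod_mono le_rfl hl
  refine le_inf ((hc.tendsto_normal_coordinates α).mono_left hle) ?_
  rw [le_principal_iff, mem_map]
  obtain ⟨η, hη, c, hcpos, hgeo⟩ := hc.exists_normal_coordinates α
  have h1 : ∀ᶠ β in 𝓝 α, |β - α| < η := Metric.ball_mem_nhds α hη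
  have h2 : ∀ᶠ r in 𝓝 (0 : ℝ), |r| < η := by
    filter_upwards [Metric.ball_mem_nhds (0 : ℝ) hη] with r hr
    simpa using hr
  filter_upwards [h1.prod_mk ((h2.filter_mono hl).and hne)] with ⟨β, r⟩ ⟨hβ, hr, hr0⟩
  rintro ⟨s, hs⟩
  have h3 := hgeo β r (s - β) hβ hr
  simp only at hs
  rw [add_sub_cancel, hs, sub_self, norm_zero] at h3
  have : 0 < |r| := abs_pos.2 hr0
  have : 0 < c * (|r| + |s - β|) := by positivity
  linarith

theorem approachAbove_le (hc : IsChordArcCurve ξ K M) (α : ℝ) :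
    approachAbove ξ α ≤ 𝓝 (ξ α) ⊓ 𝓟 (range ξ)ᶜ :=
  hc.map_normal_coordinates_le α nhdsWithin_le_nhds
    (by filter_upwards [self_mem_nhdsWithin] with r hr using ne_of_gt hr)

theorem approachBelow_le (hc : IsChordArcCurve ξ K M) (α : ℝ) :
    approachBelow ξ α ≤ 𝓝 (ξ α) ⊓ 𝓟 (range ξ)ᶜ :=
  hc.map_normal_coordinates_le α nhdsWithin_le_nhds
    (by filter_upwards [self_mem_nhdsWithin] with r hr using ne_of_lt hr)

/-- Away from the parameter `α` the distance from `z` near `ξ α` to the curve grows linearly. -/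
theorem le_norm_sub_of_far (hc : IsChordArcCurve ξ K M) {α δ s : ℝ} {z : ℂ}
    (hz : ‖z - ξ α‖ ≤ K * δ / 2) (hs : δ ≤ |s - α|) : K / 2 * |s - α| ≤ ‖z - ξ s‖ := by
  have h1 := hc.le_dist s α
  have h2 := norm_sub_le_norm_sub_add_norm_sub (ξ s) z (ξ α)
  rw [norm_sub_rev (ξ s) z] at h2
  have h3 : K * δ ≤ K * |s - α| := by
    have := hc.K_pos
    gcongr
  linarith

/-- The Cauchy integral of a density which vanishes near `α` is continuous at `ξ α`. -/
theorem continuousAt_cauchyIntegral (hc : IsChordArcCurve ξ K M) {h : ℝ → ℂ} {α δ : ℝ}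
    (hδ : 0 < δ) (hh : Integrable h) (h0 : ∀ s, |s - α| ≤ δ → h s = 0) :
    ContinuousAt (cauchyIntegral ξ h) (ξ α) := by
  have hK := hc.K_pos
  have hball : ∀ᶠ z in 𝓝 (ξ α), ‖z - ξ α‖ < K * δ / 2 := by
    filter_upwards [Metric.ball_mem_nhds (ξ α) (by positivity : 0 < K * δ / 2)] with z hz
    rwa [mem_ball_iff_norm] at hz
  have hlow : ∀ z, ‖z - ξ α‖ < K * δ / 2 → ∀ s, δ < |s - α| → K / 2 * δ ≤ ‖z - ξ s‖ :=
    fun z hz s hs => le_trans (by gcongr) (hc.le_norm_sub_of_far hz.le hs.le)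
  refine continuousAt_of_dominated (bound := fun s => ‖h s‖ / (K / 2 * δ)) ?_ ?_
    (hh.norm.div_const _) (ae_of_all _ fun s => ?_)
  · have h2 := hc.continuous
    refine Eventually.of_forall fun z => ?_
    refine (hh.aemeasurable.div (Continuous.aemeasurable ?_)).aestronglyMeasurable
    fun_prop
  · filter_upwards [hball] with z hz
    refine ae_of_all _ fun s => ?_
    rcases le_or_gt |s - α| δ with hs | hs
    · simp [h0 s hs]
    · rw [norm_div]
      have := hlow z hz s hs
      gcongr
  · rcases le_or_gt |s - α| δ with hs | hs
    · simp only [h0 s hs, zero_div]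
      exact continuousAt_const
    · refine continuousAt_const.div (by fun_prop) ?_
      have := hlow (ξ α) (by simp; positivity) s hs
      exact norm_pos_iff.1 (lt_of_lt_of_le (by positivity) this)

/-! ### Cauchy integrals at Lebesgue points -/

/-- Nontangentially, with `ε = |z - ξ(α)|`, the Cauchy kernel at `z` differs from the kernel at `ξ α`
truncated to `|s - α| > ε` by at most a multiple of the averaging kernel `ε / (ε + |s - α|)²`. -/
theorem norm_kernel_sub_truncated_le (hc : IsChordArcCurve ξ K M) {α A s : ℝ} {z : ℂ}
    (hA : 0 < A) (hz : 0 < ‖z - ξ α‖) (hzs : ‖z - ξ α‖ ≤ A * ‖z - ξ s‖) :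
    ‖1 / (z - ξ s) - {s | ‖z - ξ α‖ < |s - α|}.indicator (fun s => 1 / (ξ α - ξ s)) s‖
      ≤ 2 * (A + (1 + A) / K) * (1 + 1 / K) *
        (‖z - ξ α‖ / (‖z - ξ α‖ + |s - α|) ^ 2) := by
  have hK := hc.K_pos
  set ε := ‖z - ξ α‖ with hε
  set D := A + (1 + A) / K with hD
  have hDpos : 0 < D := by positivity
  have hτ : 0 ≤ |s - α| := abs_nonneg _
  have hw : ε + |s - α| ≤ D * ‖z - ξ s‖ := by
    have h1 := hc.le_dist s α
    have h2 := norm_sub_le_norm_sub_add_norm_sub (ξ s) z (ξ α)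
    rw [norm_sub_rev (ξ s) z, ← hε] at h2
    have h3 : |s - α| ≤ (1 + A) / K * ‖z - ξ s‖ := by
      rw [div_mul_eq_mul_div, le_div_iff₀ hK]
      linarith
    rw [hD, add_mul]
    linarith
  have hwpos : 0 < ‖z - ξ s‖ := by
    by_contra hcon
    have : ‖z - ξ s‖ = 0 := le_antisymm (not_lt.1 hcon) (norm_nonneg _)
    rw [this, mul_zero] at hw
    linarith
  have hinv : 1 / ‖z - ξ s‖ ≤ D / (ε + |s - α|) := by
    rw [div_le_div_iff₀ hwpos (by positivity)]
    linarith
  by_cases hs : ε < |s - α|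
  · have hne : ξ α - ξ s ≠ 0 := hc.ne fun h => by
      rw [h, sub_self, abs_zero] at hs
      linarith
    have hz0 : z - ξ s ≠ 0 := norm_pos_iff.1 hwpos
    have h1 := hc.le_dist α s
    rw [abs_sub_comm] at h1
    rw [indicator_of_mem (by exact hs), show 1 / (z - ξ s) - 1 / (ξ α - ξ s)
      = -(z - ξ α) * (1 / (z - ξ s)) * (1 / (ξ α - ξ s)) by field_simp; ring, norm_mul, norm_mul,
      norm_neg, ← hε, norm_div, norm_div, norm_one]
    have h2 : 1 / ‖ξ α - ξ s‖ ≤ 2 / (K * (ε + |s - α|)) := by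
      have h3 : K * (ε + |s - α|) ≤ K * (2 * |s - α|) := by gcongr; linarith
      rw [div_le_div_iff₀ (norm_pos_iff.2 hne) (by positivity)]
      linarith
    calc ε * (1 / ‖z - ξ s‖) * (1 / ‖ξ α - ξ s‖)
        ≤ ε * (D / (ε + |s - α|)) * (2 / (K * (ε + |s - α|))) := by gcongr
      _ = 2 * D * (1 / K) * (ε / (ε + |s - α|) ^ 2) := by field_simp
      _ ≤ _ := by gcongr; linarith
  · rw [indicator_of_notMem (by exact hs), sub_zero, norm_div, norm_one]
    push Not at hs
    refine hinv.trans ?_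
    calc D / (ε + |s - α|) = D * ((ε + |s - α|) / (ε + |s - α|) ^ 2) := by
          field_simp
      _ ≤ D * (2 * ε / (ε + |s - α|) ^ 2) := by gcongr; linarith
      _ = 2 * D * 1 * (ε / (ε + |s - α|) ^ 2) := by ring
      _ ≤ _ := by
          gcongr
          have : 0 < 1 / K := by positivity
          linarith

/-- At a Lebesgue point `α` of `f`, along a nontangential filter, the Cauchy integral of
`f - f(α)` over `|s - α| ≤ δ` and its truncation at distance `|z - ξ(α)|` from `α` are
asymptotically equal. -/
theorem tendsto_cauchyIntegral_sub_truncated (hc : IsChordArcCurve ξ K M) {f : ℝ → ℂ} {α δ A : ℝ}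
    (hf : LocallyIntegrable f) (hα : IsLebesguePoint f α) (hA : 0 < A)
    {l : Filter ℂ} (hl : l ≤ 𝓝 (ξ α))
    (hnt : ∀ᶠ z in l, 0 < ‖z - ξ α‖ ∧ ∀ s, ‖z - ξ α‖ ≤ A * ‖z - ξ s‖) :
    Tendsto (fun z => cauchyIntegral ξ ((Metric.closedBall α δ).indicator fun s => f s - f α) z
      - ∫ s in {s | ‖z - ξ α‖ < |s - α|},
        (Metric.closedBall α δ).indicator (fun s => f s - f α) s / (ξ α - ξ s)) l (𝓝 0) := by
  set φ := (Metric.closedBall α δ).indicator fun s => f s - f α with hφ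
  set C := 2 * (A + (1 + A) / K) * (1 + 1 / K) with hC
  have hK := hc.K_pos
  have hCpos : 0 < C := by positivity
  have hξ := hc.continuous
  have hBi : IntegrableOn (fun s => f s - f α) (Metric.closedBall α δ) :=
    (hf.integrableOn_isCompact (isCompact_closedBall α δ)).sub
      (integrableOn_const measure_closedBall_lt_top.ne)
  have hφi : Integrable φ := hBi.integrable_indicator measurableSet_closedBall
  have hε0 : Tendsto (fun z => ‖z - ξ α‖) l (𝓝[>] 0) := by
    rw [tendsto_nhdsWithin_iff]
    refine ⟨?_, hnt.mono fun z hz => hz.1⟩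
    refine Tendsto.mono_left ?_ hl
    exact (by fun_prop : Continuous fun z => ‖z - ξ α‖).tendsto' _ _ (by simp)
  have hmain := ((hα.tendsto_kernel hf (δ := δ)).const_mul C).comp hε0
  rw [mul_zero] at hmain
  refine squeeze_zero_norm' ?_ hmain
  filter_upwards [hnt] with z ⟨hz, hzs⟩
  set ε := ‖z - ξ α‖ with hε
  have hset : MeasurableSet {s : ℝ | ε < |s - α|} :=
    measurableSet_lt measurable_const (by fun_prop)
  have hlow : ∀ s, ε / A ≤ ‖z - ξ s‖ := fun s => by
    rw [div_le_iff₀ hA, mul_comm]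
    exact hzs s
  have i1 : Integrable fun s => φ s / (z - ξ s) := by
    refine (hφi.norm.div_const (ε / A)).mono' ?_ (ae_of_all _ fun s => ?_)
    · refine (hφi.aemeasurable.div (Continuous.aemeasurable ?_)).aestronglyMeasurable
      fun_prop
    · rw [norm_div]
      have := hlow s
      gcongr
  have i2 : Integrable ({s | ε < |s - α|}.indicator fun s => φ s / (ξ α - ξ s)) := by
    refine (hφi.norm.div_const (K * ε)).mono' ?_ (ae_of_all _ fun s => ?_)
    · refine AEStronglyMeasurable.indicator ?_ hset
      refine (hφi.aemeasurable.div (Continuous.aemeasurable ?_)).aestronglyMeasurable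
      fun_prop
    · by_cases hs : s ∈ {s | ε < |s - α|}
      · rw [indicator_of_mem hs, norm_div]
        have h1 := hc.le_dist α s
        rw [abs_sub_comm] at h1
        have h2 : K * ε ≤ ‖ξ α - ξ s‖ := le_trans (by gcongr; exact le_of_lt hs) h1
        gcongr
      · rw [indicator_of_notMem hs, norm_zero]
        positivity
  have hcont : Continuous fun s => ε / (ε + |s - α|) ^ 2 := by
    have : ∀ s, (ε + |s - α|) ^ 2 ≠ 0 := fun s => by positivity
    fun_prop (disch := assumption)
  have hint : Integrable fun s => C * (‖φ s‖ * (ε / (ε + |s - α|) ^ 2)) := by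
    refine Integrable.const_mul ?_ C
    refine hφi.norm.mul_bdd (c := 1 / ε) hcont.aestronglyMeasurable (ae_of_all _ fun s => ?_)
    rw [Real.norm_of_nonneg (by positivity), div_le_div_iff₀ (by positivity) hz]
    nlinarith [abs_nonneg (s - α), mul_nonneg hz.le (abs_nonneg (s - α))]
  rw [cauchyIntegral, ← integral_indicator hset, ← integral_sub i1 i2]
  have hval : ∫ s, C * (‖φ s‖ * (ε / (ε + |s - α|) ^ 2))
      = C * ∫ s in Metric.closedBall α δ, ‖f s - f α‖ * (ε / (ε + |s - α|) ^ 2) := by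
    rw [integral_const_mul, ← integral_indicator measurableSet_closedBall]
    congr 2
    ext s
    by_cases hs : s ∈ Metric.closedBall α δ
    · simp only [hφ, indicator_of_mem hs]
    · simp only [hφ, indicator_of_notMem hs, norm_zero, zero_mul]
  simp only [Function.comp_apply]
  rw [← hval]
  refine norm_integral_le_of_norm_le hint (ae_of_all _ fun s => ?_)
  have hk := hc.norm_kernel_sub_truncated_le (s := s) hA hz (hzs s)
  have e : φ s / (z - ξ s) - {s | ε < |s - α|}.indicator (fun s => φ s / (ξ α - ξ s)) s
      = φ s * (1 / (z - ξ s) - {s | ε < |s - α|}.indicator (fun s => 1 / (ξ α - ξ s)) s) := by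
    by_cases hs : s ∈ {s | ε < |s - α|}
    · simp only [indicator_of_mem hs]
      ring
    · simp only [indicator_of_notMem hs]
      ring
  rw [e, norm_mul, mul_left_comm]
  gcongr

end IsChordArcCurve

/-! ### Almost everywhere existence of the principal values -/

theorem integrableOn_truncation {ξ : ℝ → ℂ} {α K ε : ℝ} (hK : 0 < K)
    (hle : ∀ s, K * |s - α| ≤ ‖ξ α - ξ s‖) (hξ : Continuous ξ) {g : ℝ → ℂ} (hg : Integrable g)
    (hε : 0 < ε) : IntegrableOn (fun s => g s / (ξ α - ξ s)) {s | ε < |s - α|} := by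
  refine (hg.norm.div_const (K * ε)).integrableOn.mono' ?_
    ((ae_restrict_iff' (measurableSet_truncation α ε)).2 (ae_of_all _ fun s hs => ?_))
  · refine (hg.aemeasurable.div (Continuous.aemeasurable ?_)).aestronglyMeasurable.restrict
    fun_prop
  · rw [norm_div]
    have h2 : K * ε ≤ ‖ξ α - ξ s‖ := le_trans (by gcongr; exact le_of_lt hs) (hle s)
    gcongr

theorem HasCauchyPV.add {ξ h k : ℝ → ℂ} {α : ℝ} {N N' : ℂ}
    {K : ℝ} (hK : 0 < K) (hle : ∀ s, K * |s - α| ≤ ‖ξ α - ξ s‖) (hξ : Continuous ξ)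
    (hi : Integrable h) (ki : Integrable k)
    (hh : HasCauchyPV ξ h α N) (hk : HasCauchyPV ξ k α N') :
    HasCauchyPV ξ (fun s => h s + k s) α (N + N') := by
  refine (Tendsto.add hh hk).congr' ?_
  filter_upwards [self_mem_nhdsWithin] with ε hε
  rw [← integral_add (integrableOn_truncation hK hle hξ hi hε) (integrableOn_truncation hK hle hξ ki hε)]
  simp_rw [add_div]

theorem le_norm_add_mul_I_sub (α : ℝ) {y : ℝ} (hy : 0 < y) (s : ℝ) :
    y ≤ ‖(α : ℂ) + y * Complex.I - s‖ := by
  have := Complex.abs_im_le_norm ((α : ℂ) + y * Complex.I - s)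
  simp only [Complex.sub_im, Complex.add_im, Complex.ofReal_im, Complex.mul_im,
    Complex.ofReal_re, Complex.I_im, Complex.I_re, mul_one, mul_zero, zero_add, add_zero,
    sub_zero] at this
  rwa [abs_of_pos hy] at this

theorem approachAbove_ofReal_tendsto (α : ℝ) :
    Tendsto (fun y : ℝ => (α : ℂ) + y * Complex.I) (𝓝[>] 0)
      (approachAbove (fun s : ℝ => (s : ℂ)) α) := by
  have h1 : Tendsto (fun y : ℝ => (α, y)) (𝓝[>] (0 : ℝ)) (𝓝 α ×ˢ 𝓝[>] 0) :=
    (tendsto_const_nhds).prodMk tendsto_id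
  refine (tendsto_map.comp h1).congr fun y => ?_
  simp [unitNormal_eq, deriv_ofReal]

theorem locallyIntegrable_of_memLp_Icc {f : ℝ → ℂ}
    (hf : ∀ R, MemLp f 2 (volume.restrict (Icc (-R) R))) : LocallyIntegrable f := by
  rw [locallyIntegrable_iff]
  intro k hk
  obtain ⟨R, hR⟩ := hk.isBounded.subset_closedBall 0
  rw [Real.closedBall_eq_Icc, zero_sub, zero_add] at hR
  exact IntegrableOn.mono_set ((hf R).integrable (by norm_num)) hR

/-- The principal value over the real line of a locally `L²` density exists almost everywhere. The
value `f α` is subtracted from the density before it is cut off, as the comparison with truncations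
requires. -/
theorem ae_exists_hasCauchyPV_line {f : ℝ → ℂ} (hf : ∀ R, MemLp f 2 (volume.restrict (Icc (-R) R))) :
    ∀ᵐ α : ℝ, ∀ δ > 0, ∃ L : ℂ, HasCauchyPV (fun s : ℝ => (s : ℂ))
      ((Metric.closedBall α δ).indicator fun s => f s - f α) α L := by
  have hfn : ∀ n : ℕ, MemLp ((Icc (-(n : ℝ)) n).indicator f) 2 := fun n =>
    (memLp_indicator_iff_restrict measurableSet_Icc).2 (hf n)
  have hfi : ∀ n : ℕ, Integrable ((Icc (-(n : ℝ)) n).indicator f) := fun n => by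
    rw [integrable_indicator_iff measurableSet_Icc]
    exact (hf n).integrable (by norm_num)
  have hloc : LocallyIntegrable f := locallyIntegrable_of_memLp_Icc hf
  have hc := isChordArcCurve_ofReal
  filter_upwards [ae_all_iff.2 fun n : ℕ => ae_exists_tendsto_cauchy (hfn n),
    ae_isLebesguePoint hloc] with α hα hleb δ hδ
  obtain ⟨n, hn⟩ := exists_nat_gt (|α| + δ)
  obtain ⟨L, hL⟩ := hα n
  set F := (Icc (-(n : ℝ)) n).indicator f with hF
  set B := Metric.closedBall α δ with hB
  have hBn : ∀ s ∈ B, F s = f s := by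
    intro s hs
    have h1 : |s - α| ≤ δ := by rwa [hB, Metric.mem_closedBall, Real.dist_eq] at hs
    have h2 := abs_add_le (s - α) α
    rw [sub_add_cancel] at h2
    have h3 := abs_le.1 (show |s| ≤ n by linarith)
    rw [hF, indicator_of_mem (by exact h3)]
  have hφi : Integrable (B.indicator fun s => f s - f α) :=
    ((hloc.integrableOn_isCompact (isCompact_closedBall α δ)).sub
      (integrableOn_const measure_closedBall_lt_top.ne)).integrable_indicator
      measurableSet_closedBall
  have hki : Integrable (B.indicator fun _ => f α) :=
    (integrableOn_const measure_closedBall_lt_top.ne).integrable_indicator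
      measurableSet_closedBall
  -- the cut off and centred density differs from `F` by a density that vanishes near `α` and by a
  -- constant on `B`, and the Cauchy integrals of both have vertical limits
  have hfar : ContinuousAt (cauchyIntegral (fun s : ℝ => (s : ℂ)) (Bᶜ.indicator F)) (α : ℂ) := by
    refine hc.continuousAt_cauchyIntegral hδ
      ((hfi n).indicator measurableSet_closedBall.compl) fun s hs => ?_
    rw [indicator_of_notMem]
    rwa [notMem_compl_iff, hB, Metric.mem_closedBall, Real.dist_eq]
  obtain ⟨N, -, hN, -⟩ := hc.exists_plemelj_of_isHolderDensity
    (isHolderDensity_indicator_const (α := α) hδ (f α))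
  have hvert := approachAbove_ofReal_tendsto α
  have hvert' : Tendsto (fun y : ℝ => (α : ℂ) + y * Complex.I) (𝓝[>] 0) (𝓝 (α : ℂ)) :=
    hvert.mono_right ((hc.approachAbove_le α).trans inf_le_left)
  have hsub := (hL.sub (hN.comp hvert)).sub (hfar.tendsto.comp hvert')
  obtain ⟨v, hφlim⟩ : ∃ v, Tendsto (fun y : ℝ => cauchyIntegral (fun s : ℝ => (s : ℂ))
      (B.indicator fun s => f s - f α) ((α : ℂ) + y * Complex.I)) (𝓝[>] 0) (𝓝 v) := by
    refine ⟨_, hsub.congr' ?_⟩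
    filter_upwards [self_mem_nhdsWithin] with y (hy : 0 < y)
    have hden : ∀ g : ℝ → ℂ, Integrable g →
        Integrable fun s : ℝ => g s / ((α : ℂ) + y * Complex.I - s) := by
      intro g hg
      refine (hg.norm.div_const y).mono' ?_ (ae_of_all _ fun s => ?_)
      · refine (hg.aemeasurable.div (Continuous.aemeasurable ?_)).aestronglyMeasurable
        fun_prop
      · rw [norm_div]
        have := le_norm_add_mul_I_sub α hy s
        gcongr
    simp only [Function.comp_apply, cauchyIntegral]
    have i12 : Integrable fun s : ℝ => F s / ((α : ℂ) + y * Complex.I - s) -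
        B.indicator (fun _ => f α) s / ((α : ℂ) + y * Complex.I - s) :=
      (hden F (hfi n)).sub (hden _ hki)
    have i3 : Integrable (Bᶜ.indicator F) := (hfi n).indicator measurableSet_closedBall.compl
    rw [← integral_sub (hden F (hfi n)) (hden _ hki), ← integral_sub i12 (hden _ i3)]
    congr 1
    ext s
    by_cases hs : s ∈ B
    · simp only [indicator_of_mem hs, indicator_of_notMem (notMem_compl_iff.2 hs), hBn s hs]
      ring
    · simp only [indicator_of_notMem hs, indicator_of_mem (mem_compl hs)]
      ring
  refine ⟨v, ?_⟩
  -- at height `y` the vertical limit is compared with the truncation at `|s - α| > y`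
  have htr := hc.tendsto_cauchyIntegral_sub_truncated (δ := δ) (A := 1)
    (l := map (fun y : ℝ => (α : ℂ) + y * Complex.I) (𝓝[>] 0)) hloc hleb one_pos hvert' (by
      rw [eventually_map]
      filter_upwards [self_mem_nhdsWithin] with y (hy : 0 < y)
      have e : (α : ℂ) + y * Complex.I - α = y * Complex.I := by ring
      have hn : ‖(α : ℂ) + y * Complex.I - α‖ = y := by
        rw [e, norm_mul, Complex.norm_I, mul_one, Complex.norm_real, Real.norm_of_nonneg hy.le]
      rw [hn]
      refine ⟨hy, fun s => ?_⟩
      rw [one_mul]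
      exact le_norm_add_mul_I_sub α hy s)
  rw [tendsto_map'_iff, ← hB] at htr
  have := hφlim.sub htr
  rw [sub_zero] at this
  refine this.congr' ?_
  filter_upwards [self_mem_nhdsWithin] with y (hy : 0 < y)
  have hn : ‖(α : ℂ) + y * Complex.I - α‖ = y := by
    rw [add_sub_cancel_left, norm_mul, Complex.norm_I, mul_one, Complex.norm_real,
      Real.norm_of_nonneg hy.le]
  simp only [Function.comp_apply, sub_sub_cancel, hn]

namespace IsChordArcCurve

variable {ξ : ℝ → ℂ} {K M : ℝ}

/-- The Cauchy kernel of the curve differs from that of its tangent line at `ξ α` by a bounded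
function, so that the principal values exist together. -/
theorem exists_hasCauchyPV_of_line (hc : IsChordArcCurve ξ K M) {φ : ℝ → ℂ} {α δ : ℝ} {L : ℂ}
    (hδ1 : δ ≤ 1) (hφ : Integrable φ) (h0 : ∀ s, δ < |s - α| → φ s = 0)
    (hL : HasCauchyPV (fun s : ℝ => (s : ℂ)) φ α L) : ∃ N, HasCauchyPV ξ φ α N := by
  obtain ⟨B, hB, hT⟩ := hc.exists_taylor α
  have hK := hc.K_pos
  have hM := hc.M_pos
  have hξ := hc.continuous
  have hd := hc.deriv_ne_zero α
  set D : ℝ → ℂ := fun s => φ s / (ξ α - ξ s) - φ s / (deriv ξ α * ((α : ℂ) - s)) with hD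
  have hDi : Integrable D := by
    refine (hφ.norm.mul_const (B * M / K)).mono' ?_ ?_
    · refine AEStronglyMeasurable.sub ?_ ?_
      · refine (hφ.aemeasurable.div (Continuous.aemeasurable ?_)).aestronglyMeasurable
        fun_prop
      · refine (hφ.aemeasurable.div (Continuous.aemeasurable ?_)).aestronglyMeasurable
        fun_prop
    · filter_upwards [compl_mem_ae_iff.2 (measure_singleton (μ := (volume : Measure ℝ)) α)]
        with s hs
      have hs : s ≠ α := hs
      rcases lt_or_ge δ |s - α| with h | h
      · simp [hD, h0 s h]
      · have hpos : 0 < |s - α| := abs_pos.2 (sub_ne_zero.2 hs)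
        have t1 := hT α (s - α) (by simp) (h.trans hδ1)
        rw [add_sub_cancel, ← sq_abs] at t1
        have n1 : ξ α - ξ s ≠ 0 := hc.ne hs.symm
        have n2 : ((α : ℂ) - s) ≠ 0 := by
          rw [sub_ne_zero]
          exact_mod_cast hs.symm
        have e : D s = φ s * ((ξ s - ξ α - deriv ξ α * ((s - α : ℝ) : ℂ)) /
            ((ξ α - ξ s) * (deriv ξ α * ((α : ℂ) - s)))) := by
          simp only [hD]
          push_cast
          field_simp
          ring
        rw [e, norm_mul, norm_div, norm_mul, norm_mul (deriv ξ α)]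
        have b1 : K * |s - α| ≤ ‖ξ α - ξ s‖ := by
          rw [abs_sub_comm]
          exact hc.le_dist α s
        have b2 : ‖(α : ℂ) - s‖ = |s - α| := by
          rw [← Complex.ofReal_sub, Complex.norm_real, Real.norm_eq_abs, abs_sub_comm]
        have b3 := hc.le_speed α
        rw [b2]
        refine mul_le_mul_of_nonneg_left ?_ (norm_nonneg _)
        calc _ ≤ B * |s - α| ^ 2 / ((K * |s - α|) * (1 / M * |s - α|)) := by gcongr
          _ = B * M / K := by field_simp
  have htr := tendsto_integral_truncation hDi α
  refine ⟨(∫ s, D s) + (deriv ξ α)⁻¹ * L, ?_⟩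
  refine (htr.add (hL.const_mul (deriv ξ α)⁻¹)).congr' ?_
  filter_upwards [self_mem_nhdsWithin] with ε (hε : 0 < ε)
  have hline : IntegrableOn (fun s : ℝ => φ s / ((α : ℂ) - s)) {s | ε < |s - α|} := by
    refine (hφ.norm.div_const ε).integrableOn.mono' ?_
      ((ae_restrict_iff' (measurableSet_truncation α ε)).2 (ae_of_all _ fun s hs => ?_))
    · refine (hφ.aemeasurable.div (Continuous.aemeasurable ?_)).aestronglyMeasurable.restrict
      fun_prop
    · have hs : ε < |s - α| := hs
      rw [norm_div, ← Complex.ofReal_sub, Complex.norm_real, Real.norm_eq_abs, abs_sub_comm]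
      gcongr
  rw [← integral_const_mul, ← integral_add hDi.integrableOn (hline.const_mul _)]
  congr 1
  ext s
  simp only [hD, div_eq_mul_inv, mul_inv]
  ring

/-- In a nontangential region the distance to `ξ α` is comparable with that to any point of the curve.
The maximum with `1` makes the constant positive for every aperture. -/
theorem _root_.eventually_nontangential {ξ : ℝ → ℂ} {α A : ℝ} {l : Filter ℂ}
    (hl : l ≤ 𝓝 (ξ α) ⊓ 𝓟 (range ξ)ᶜ) :
    ∀ᶠ z in l ⊓ 𝓟 (nontangentialRegion ξ α A),
      0 < ‖z - ξ α‖ ∧ ∀ s, ‖z - ξ α‖ ≤ max A 1 * ‖z - ξ s‖ := by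
  have h1 : ∀ᶠ z in l, z ∉ range ξ := (hl.trans inf_le_right) (mem_principal_self _)
  filter_upwards [mem_inf_of_left h1, mem_inf_of_right (mem_principal_self _)] with z hz hzA
  refine ⟨norm_pos_iff.2 (sub_ne_zero.2 fun h => hz ⟨α, h.symm⟩), fun s => ?_⟩
  have h2 : ‖z - ξ α‖ ≤ A * Metric.infDist z (range ξ) := hzA
  have h3 : Metric.infDist z (range ξ) ≤ ‖z - ξ s‖ := by
    rw [← dist_eq_norm]
    exact Metric.infDist_le_dist_of_mem (mem_range_self s)
  refine h2.trans (mul_le_mul (le_max_left _ _) h3 Metric.infDist_nonneg ?_)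
  positivity

/-- Plemelj's formula for locally `L²` densities: almost everywhere the principal value exists, and
the nontangential limits from the two sides differ from it by `∓ π i f(α) / ξ'(α)`. -/
theorem ae_exists_plemelj (hc : IsChordArcCurve ξ K M) {f : ℝ → ℂ}
    (hf : ∀ R, MemLp f 2 (volume.restrict (Icc (-R) R))) :
    ∀ᵐ α : ℝ, ∀ δ > 0, δ ≤ 1 → ∃ N : ℂ,
      HasCauchyPV ξ ((Metric.closedBall α δ).indicator f) α N ∧ ∀ A : ℝ,
      Tendsto (cauchyIntegral ξ ((Metric.closedBall α δ).indicator f))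
        (approachAbove ξ α ⊓ 𝓟 (nontangentialRegion ξ α A))
        (𝓝 (N - Real.pi * Complex.I * f α / deriv ξ α)) ∧
      Tendsto (cauchyIntegral ξ ((Metric.closedBall α δ).indicator f))
        (approachBelow ξ α ⊓ 𝓟 (nontangentialRegion ξ α A))
        (𝓝 (N + Real.pi * Complex.I * f α / deriv ξ α)) := by
  have hloc : LocallyIntegrable f := locallyIntegrable_of_memLp_Icc hf
  filter_upwards [ae_exists_hasCauchyPV_line hf, ae_isLebesguePoint hloc] with α hpv hleb δ hδ hδ1
  obtain ⟨L, hL⟩ := hpv δ hδ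
  set B := Metric.closedBall α δ with hB
  set φ := B.indicator fun s => f s - f α with hφ
  set k := B.indicator fun _ => f α with hk
  have hφi : Integrable φ :=
    ((hloc.integrableOn_isCompact (isCompact_closedBall α δ)).sub
      (integrableOn_const measure_closedBall_lt_top.ne)).integrable_indicator
      measurableSet_closedBall
  have hki : Integrable k :=
    (integrableOn_const measure_closedBall_lt_top.ne).integrable_indicator
      measurableSet_closedBall
  have hsum : B.indicator f = fun s => φ s + k s := by
    ext s
    by_cases hs : s ∈ B
    · simp only [hφ, hk, indicator_of_mem hs, sub_add_cancel]
    · simp only [hφ, hk, indicator_of_notMem hs, add_zero]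
  obtain ⟨N₁, hN₁⟩ := hc.exists_hasCauchyPV_of_line hδ1 hφi (fun s hs => by
    rw [hφ, indicator_of_notMem]
    rw [hB, Metric.mem_closedBall, Real.dist_eq]
    exact not_le.2 hs) hL
  obtain ⟨N₂, hN₂, habove, hbelow⟩ := hc.exists_plemelj_of_isHolderDensity
    (isHolderDensity_indicator_const (α := α) hδ (f α))
  have hkα : k α = f α := indicator_of_mem (Metric.mem_closedBall_self hδ.le) _
  rw [← hB, ← hk, hkα] at habove hbelow
  -- `f - f(α)` contributes its principal value on both sides, the constant `f(α)` carries the jump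
  have hside : ∀ l : Filter ℂ, l ≤ 𝓝 (ξ α) ⊓ 𝓟 (range ξ)ᶜ → ∀ v A,
      Tendsto (cauchyIntegral ξ k) l (𝓝 v) →
      Tendsto (cauchyIntegral ξ (B.indicator f)) (l ⊓ 𝓟 (nontangentialRegion ξ α A))
        (𝓝 (N₁ + v)) := by
    intro l hl v A hv
    have hnt := eventually_nontangential (A := A) hl
    have hl' : l ⊓ 𝓟 (nontangentialRegion ξ α A) ≤ 𝓝 (ξ α) :=
      inf_le_left.trans (hl.trans inf_le_left)
    have hdiff := hc.tendsto_cauchyIntegral_sub_truncated (δ := δ) hloc hleb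
      (by positivity : 0 < max A 1) hl' hnt
    rw [← hB, ← hφ] at hdiff
    have hε0 : Tendsto (fun z => ‖z - ξ α‖) (l ⊓ 𝓟 (nontangentialRegion ξ α A)) (𝓝[>] 0) := by
      rw [tendsto_nhdsWithin_iff]
      refine ⟨Tendsto.mono_left ?_ hl', hnt.mono fun z hz => hz.1⟩
      exact (by fun_prop : Continuous fun z => ‖z - ξ α‖).tendsto' _ _ (by simp)
    have h1 := (hdiff.add (hN₁.comp hε0)).add (hv.mono_left (inf_le_left :
      l ⊓ 𝓟 (nontangentialRegion ξ α A) ≤ l))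
    rw [zero_add] at h1
    refine h1.congr' ?_
    filter_upwards [hnt] with z ⟨hz, hzs⟩
    have hden : ∀ g : ℝ → ℂ, Integrable g → Integrable fun s : ℝ => g s / (z - ξ s) := by
      intro g hg
      refine (hg.norm.div_const (‖z - ξ α‖ / max A 1)).mono' ?_ (ae_of_all _ fun s => ?_)
      · have hξ := hc.continuous
        refine (hg.aemeasurable.div (Continuous.aemeasurable ?_)).aestronglyMeasurable
        fun_prop
      · rw [norm_div]
        have : ‖z - ξ α‖ / max A 1 ≤ ‖z - ξ s‖ := by
          rw [div_le_iff₀ (by positivity), mul_comm]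
          exact hzs s
        gcongr
    simp only [Function.comp_apply, sub_add_cancel, cauchyIntegral, hsum, add_div]
    rw [integral_add (hden φ hφi) (hden k hki)]
  refine ⟨N₁ + N₂, ?_, fun A => ⟨?_, ?_⟩⟩
  · rw [hsum]
    exact HasCauchyPV.add hc.K_pos (hc.le_dist' α) hc.continuous hφi hki hN₁ hN₂
  · rw [add_sub_assoc]
    exact hside _ (hc.approachAbove_le α) _ A habove
  · rw [add_assoc]
    exact hside _ (hc.approachBelow_le α) _ A hbelow

end IsChordArcCurve

/-! ### Principal values at infinity -/

theorem tendsto_intervalIntegral_symm {h : ℝ → ℂ} (hh : Integrable h) (p : ℝ) {R : ℕ → ℝ}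
    (hR : Tendsto R atTop atTop) :
    Tendsto (fun n => ∫ s in (p - R n)..(p + R n), h s) atTop (𝓝 (∫ s, h s)) := by
  refine intervalIntegral_tendsto_integral hh ?_ (tendsto_atTop_add_const_left _ _ hR)
  exact tendsto_atBot_add_const_left _ p (tendsto_neg_atTop_atBot.comp hR)

theorem HasPVInfty.add_integrable {g h : ℝ → ℂ} {L : ℂ} (hg : HasPVInfty g L)
    (hh : Integrable h) : HasPVInfty (fun s => g s + h s) (L + ∫ s, h s) := by
  obtain ⟨hloc, ⟨p, R, hR, hR', hlim⟩, huniq⟩ := hg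
  have hsplit : ∀ u v : ℝ, ∫ s in u..v, (g s + h s) = (∫ s in u..v, g s) + ∫ s in u..v, h s :=
    fun u v => intervalIntegral.integral_add
      (hloc.integrableOn_isCompact isCompact_uIcc).intervalIntegrable hh.intervalIntegrable
  refine ⟨hloc.add hh.locallyIntegrable, ⟨p, R, hR, hR', ?_⟩, fun p R L' hR hR' hlim' => ?_⟩
  · simp_rw [hsplit]
    exact hlim.add (tendsto_intervalIntegral_symm hh p hR')
  · simp_rw [hsplit] at hlim'
    have := hlim'.sub (tendsto_intervalIntegral_symm hh p hR')
    simp only [add_sub_cancel_right] at this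
    rw [← huniq p R _ hR hR' this, sub_add_cancel]

theorem hasPVInfty_zero : HasPVInfty (fun _ => 0) 0 := by
  refine ⟨locallyIntegrable_const 0,
    ⟨0, fun n => n, Nat.mono_cast, tendsto_natCast_atTop_atTop, by simp⟩,
    fun p R L' _ _ h => ?_⟩
  simp only [intervalIntegral.integral_zero] at h
  exact tendsto_nhds_unique h tendsto_const_nhds

theorem hasPVInfty_of_integrable {h : ℝ → ℂ} (hh : Integrable h) :
    HasPVInfty h (∫ s, h s) := by
  simpa using hasPVInfty_zero.add_integrable hh

theorem HasPVInfty.const_mul {g : ℝ → ℂ} {L : ℂ} (hg : HasPVInfty g L) (k : ℂ) :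
    HasPVInfty (fun s => k * g s) (k * L) := by
  rcases eq_or_ne k 0 with rfl | hk
  · simpa using hasPVInfty_zero
  obtain ⟨hloc, ⟨p, R, hR, hR', hlim⟩, huniq⟩ := hg
  refine ⟨hloc.smul k, ⟨p, R, hR, hR', ?_⟩, fun p R L' hR hR' hlim' => ?_⟩
  · simp_rw [intervalIntegral.integral_const_mul]
    exact hlim.const_mul k
  · simp_rw [intervalIntegral.integral_const_mul] at hlim'
    have := hlim'.const_mul k⁻¹
    simp only [inv_mul_cancel_left₀ hk] at this
    rw [← huniq p R _ hR hR' this, mul_inv_cancel_left₀ hk]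

/-- A kernel that is a Cauchy kernel near `α` and is otherwise integrable near `α` has a principal
value as soon as its part near infinity has one. -/
theorem hasPV_of_hasCauchyPV {ξ g h k : ℝ → ℂ} {α δ K : ℝ} {N F : ℂ} (hδ1 : δ ≤ 1) (hK : 0 < K)
    (hle : ∀ s, K * |s - α| ≤ ‖ξ α - ξ s‖) (hξ : Continuous ξ)
    (hh : Integrable h) (h0 : ∀ s, δ < |s - α| → h s = 0) (hN : HasCauchyPV ξ h α N)
    (hk : IntegrableOn k {s | |s - α| ≤ 1})
    (hF : HasPVInfty ({s | 1 < |s - α|}.indicator k) F)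
    (hg : ∀ s, g s = h s / (ξ α - ξ s) + k s) :
    HasPV g α (N + ((∫ s in {s | |s - α| ≤ 1}, k s) + F)) := by
  have hset := measurableSet_truncation α
  have hset1 : MeasurableSet {s : ℝ | |s - α| ≤ 1} :=
    measurableSet_le (by fun_prop) measurable_const
  have hann : ∀ ε : ℝ, {s : ℝ | ε < |s - α| ∧ |s - α| ≤ 1}
      = {s | ε < |s - α|} ∩ {s | |s - α| ≤ 1} := fun ε => rfl
  have hi : ∀ ε > 0, IntegrableOn (fun s => h s / (ξ α - ξ s)) {s | ε < |s - α|} :=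
    fun ε hε => integrableOn_truncation hK hle hξ hh hε
  have hgeq : g = fun s => h s / (ξ α - ξ s) + k s := funext hg
  refine ⟨N + ∫ s in {s | |s - α| ≤ 1}, k s, F, fun ε hε => ?_, ?_, ?_, (add_assoc _ _ _).symm⟩
  · rw [hgeq, hann]
    exact ((hi ε hε).mono_set inter_subset_left).add (hk.mono_set inter_subset_right)
  · have hktr : Tendsto (fun ε : ℝ => ∫ s in {s | ε < |s - α| ∧ |s - α| ≤ 1}, k s) (𝓝[>] 0)
        (𝓝 (∫ s in {s | |s - α| ≤ 1}, k s)) := by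
      have := tendsto_integral_truncation (hk.integrable_indicator hset1) α
      simp_rw [setIntegral_indicator hset1, integral_indicator hset1] at this
      exact this
    refine (Tendsto.add hN hktr).congr' ?_
    filter_upwards [self_mem_nhdsWithin] with ε (hε : 0 < ε)
    have e1 : ∫ s in {s | ε < |s - α|}, h s / (ξ α - ξ s)
        = ∫ s in {s | ε < |s - α| ∧ |s - α| ≤ 1}, h s / (ξ α - ξ s) := by
      have hsub : {s : ℝ | ε < |s - α| ∧ |s - α| ≤ 1} ⊆ {s | ε < |s - α|} := fun s hs => hs.1
      refine setIntegral_eq_of_subset_of_forall_sdiff_eq_zero (hset ε) hsub fun s hs => ?_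
      have h1 : 1 < |s - α| := by
        by_contra hcon
        exact hs.2 ⟨hs.1, not_lt.1 hcon⟩
      rw [h0 s (hδ1.trans_lt h1), zero_div]
    rw [e1, hgeq, ← integral_add]
    · rw [hann]
      exact (hi ε hε).mono_set inter_subset_left
    · rw [hann]
      exact hk.mono_set inter_subset_right
  · have : {s | 1 < |s - α|}.indicator g = {s | 1 < |s - α|}.indicator k := by
      ext s
      by_cases hs : 1 < |s - α|
      · rw [indicator_of_mem (by exact hs), indicator_of_mem (by exact hs), hg,
          h0 s (hδ1.trans_lt hs), zero_div, zero_add]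
      · rw [indicator_of_notMem (by exact hs), indicator_of_notMem (by exact hs)]
    rw [this]
    exact hF

/-! ### The cutoff and the primitive -/

namespace IsCutoff

variable {a : ℝ → ℝ}

theorem exists_abs_le (ha : IsCutoff a) : ∃ S, 0 ≤ S ∧ ∀ s, |a s| ≤ S := by
  obtain ⟨S, hS⟩ := (isCompact_Icc (a := -2) (b := 2)).exists_bound_of_continuousOn
    ha.smooth.continuous.continuousOn
  refine ⟨max S 0, le_max_right _ _, fun s => ?_⟩
  rcases le_or_gt 2 |s| with h | h
  · simp [ha.eq_zero s h]
  · have := abs_le.1 h.le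
    exact (hS s this).trans (le_max_left _ _)

theorem continuous_deriv (ha : IsCutoff a) : Continuous (deriv a) :=
  ha.smooth.continuous_deriv (by norm_num)

theorem deriv_eq_zero_of_lt (ha : IsCutoff a) {s : ℝ} (hs : |s| < 1) : deriv a s = 0 := by
  have : a =ᶠ[𝓝 s] fun _ => 1 := by
    filter_upwards [continuous_abs.continuousAt.eventually (gt_mem_nhds hs)] with t ht
    exact ha.eq_one t ht.le
  rw [this.deriv_eq, deriv_const]

theorem deriv_eq_zero_of_gt (ha : IsCutoff a) {s : ℝ} (hs : 2 < |s|) : deriv a s = 0 := by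
  have : a =ᶠ[𝓝 s] fun _ => 0 := by
    filter_upwards [continuous_abs.continuousAt.eventually (lt_mem_nhds hs)] with t ht
    exact ha.eq_zero t (le_of_lt ht)
  rw [this.deriv_eq, deriv_const]

theorem exists_abs_deriv_le (ha : IsCutoff a) : ∃ S, 0 ≤ S ∧ ∀ s, |deriv a s| ≤ S := by
  obtain ⟨S, hS⟩ := (isCompact_Icc (a := -2) (b := 2)).exists_bound_of_continuousOn
    ha.continuous_deriv.continuousOn
  refine ⟨max S 0, le_max_right _ _, fun s => ?_⟩
  rcases lt_or_ge 2 |s| with h | h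
  · simp [ha.deriv_eq_zero_of_gt h]
  · have := abs_le.1 h
    exact (hS s this).trans (le_max_left _ _)

end IsCutoff

theorem LocallyL2.memLp_sub {γ : ℝ → ℝ} (hγ : LocallyL2 γ) (c R : ℝ) :
    MemLp (fun s => ((γ s - c : ℝ) : ℂ)) 2 (volume.restrict (Icc (-R) R)) := by
  have h1 : MemLp (fun s => γ s - c) 2 (volume.restrict (Icc (-R) R)) :=
    (hγ R).sub (memLp_const c)
  exact h1.ofReal

theorem LocallyL2.locallyIntegrable_sub {γ : ℝ → ℝ} (hγ : LocallyL2 γ) (c : ℝ) :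
    LocallyIntegrable fun s => ((γ s - c : ℝ) : ℂ) :=
  locallyIntegrable_of_memLp_Icc (hγ.memLp_sub c)

namespace IsSublinearPrimitive

variable {γ Γ : ℝ → ℝ} {c : ℝ}

theorem continuous (hΓ : IsSublinearPrimitive γ c Γ) (hγ : LocallyL2 γ) : Continuous Γ := by
  have hloc : LocallyIntegrable fun s => γ s - c := by
    have := hγ.locallyIntegrable_sub c
    intro x
    obtain ⟨U, hU, hi⟩ := this x
    exact ⟨U, hU, hi.re⟩
  have h1 : Γ = fun q => Γ 0 + ∫ s in (0 : ℝ)..q, (γ s - c) := by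
    ext q
    rw [← hΓ.1 0 q]
    ring
  rw [h1]
  exact continuous_const.add (intervalIntegral.continuous_primitive
    (fun u v => (hloc.integrableOn_isCompact isCompact_uIcc).intervalIntegrable) 0)

/-- The growth condition in a form without exceptional interval; it uses the continuity of `Γ`. -/
theorem exists_bound (hΓ : IsSublinearPrimitive γ c Γ) (hγ : LocallyL2 γ) :
    ∃ C ≥ (0 : ℝ), ∃ β < (1 : ℝ), ∀ s, |Γ s| ≤ C * (1 + |s|) ^ β := by
  obtain ⟨ε, hε, C, hC, β, hβ0, hβ1, hb⟩ := hΓ.2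
  obtain ⟨S, hS⟩ := (isCompact_Icc (a := -ε) (b := ε)).exists_bound_of_continuousOn
    (hΓ.continuous hγ).continuousOn
  refine ⟨max C S, le_trans hC.le (le_max_left _ _), β, hβ1, fun s => ?_⟩
  have hs0 := abs_nonneg s
  rcases lt_or_ge ε |s| with h | h
  · have hp : 0 < |s| := hε.trans h
    have := hb s h
    rw [div_le_iff₀ (Real.rpow_pos_of_pos hp β)] at this
    refine this.trans ?_
    have h2 : |s| ^ β ≤ (1 + |s|) ^ β := Real.rpow_le_rpow hs0 (by linarith) hβ0
    exact mul_le_mul (le_max_left _ _) h2 (by positivity) (le_trans hC.le (le_max_left _ _))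
  · have h1 := (hS s (abs_le.1 h)).trans (le_max_right C S)
    have h2 : 1 ≤ (1 + |s|) ^ β := Real.one_le_rpow (by linarith) hβ0
    rw [Real.norm_eq_abs] at h1
    exact h1.trans (le_mul_of_one_le_right (le_trans hC.le (le_max_left _ _)) h2)

end IsSublinearPrimitive

/-! ### Continuity of the regular integrals -/

theorem integrable_and_continuous_of_dominated {G : ℂ → ℝ → ℂ}
    (hm : ∀ z, AEStronglyMeasurable (G z)) (hc : ∀ s, Continuous fun z => G z s)
    (hb : ∀ R : ℝ, ∃ b : ℝ → ℝ, Integrable b ∧ ∀ z, ‖z‖ ≤ R → ∀ s, ‖G z s‖ ≤ b s) :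
    (∀ z, Integrable (G z)) ∧ Continuous fun z => ∫ s, G z s := by
  refine ⟨fun z => ?_, continuous_iff_continuousAt.2 fun z₀ => ?_⟩
  · obtain ⟨b, hbi, hle⟩ := hb ‖z‖
    exact hbi.mono' (hm z) (ae_of_all _ (hle z le_rfl))
  · obtain ⟨b, hbi, hle⟩ := hb (‖z₀‖ + 1)
    refine continuousAt_of_dominated (bound := b) (Eventually.of_forall hm) ?_ hbi
      (ae_of_all _ fun s => (hc s).continuousAt)
    have : ∀ᶠ z in 𝓝 z₀, ‖z‖ < ‖z₀‖ + 1 :=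
      continuous_norm.continuousAt.eventually (gt_mem_nhds (lt_add_one _))
    filter_upwards [this] with z hz
    exact ae_of_all _ (hle z hz.le)

namespace IsChordArcCurve

variable {ξ : ℝ → ℂ} {K M : ℝ}

theorem mul_abs_le (hc : IsChordArcCurve ξ K M) (z : ℂ) (s : ℝ) :
    K * |s| ≤ ‖z - ξ s‖ + ‖z‖ + ‖ξ 0‖ := by
  have h1 := hc.le_dist s 0
  rw [sub_zero] at h1
  have h2 : ‖ξ s - ξ 0‖ ≤ ‖z - ξ s‖ + ‖z‖ + ‖ξ 0‖ := by
    have : ξ s - ξ 0 = -(z - ξ s) + z - ξ 0 := by ring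
    rw [this]
    refine (norm_sub_le _ _).trans ?_
    gcongr
    refine (norm_add_le _ _).trans ?_
    rw [norm_neg]
  linarith

/-- The second integrand is bounded with support in a bounded interval: `a'(|z - ξ|²)` vanishes for
`|z - ξ| < 1`, where it removes the singularity, and for `|z - ξ|² > 2`. -/
theorem integrand₂_regular (hc : IsChordArcCurve ξ K M) {a Γ : ℝ → ℝ} (ha : IsCutoff a)
    (hΓ : Continuous Γ) :
    (∀ z, Integrable (integrand₂ ξ a Γ z)) ∧ Continuous fun z => ∫ s, integrand₂ ξ a Γ z s := by
  have hξ := hc.continuous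
  have hξ' := hc.continuous_deriv
  have ha' := ha.continuous_deriv
  have hK := hc.K_pos
  refine integrable_and_continuous_of_dominated (fun z => ?_) (fun s => ?_) fun R => ?_
  · refine Measurable.aestronglyMeasurable (Measurable.div ?_ ?_)
    · exact Complex.measurable_ofReal.comp (Continuous.measurable (by fun_prop))
    · exact Continuous.measurable (by fun_prop)
  · rw [continuous_iff_continuousAt]
    intro z
    rcases eq_or_ne z (ξ s) with rfl | hz
    · refine (continuousAt_const (y := (0 : ℂ))).congr ?_
      have : ∀ᶠ z in 𝓝 (ξ s), |‖z - ξ s‖ ^ 2| < 1 := by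
        refine (by fun_prop : Continuous fun z => |‖z - ξ s‖ ^ 2|).continuousAt.eventually
          (gt_mem_nhds (by simp))
      filter_upwards [this] with z hz
      simp [integrand₂, ha.deriv_eq_zero_of_lt hz]
    · refine ContinuousAt.div ?_ (by fun_prop) (sub_ne_zero.2 hz)
      exact Complex.continuous_ofReal.continuousAt.comp (Continuous.continuousAt (by fun_prop))
  · obtain ⟨S, hS0, hS⟩ := ha.exists_abs_deriv_le
    set ρ := (2 + R + ‖ξ 0‖) / K with hρ
    obtain ⟨G, hG⟩ := (isCompact_closedBall (0 : ℝ) ρ).exists_bound_of_continuousOn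
      hΓ.continuousOn
    refine ⟨(Metric.closedBall (0 : ℝ) ρ).indicator fun _ => 2 * S * M * max G 0, ?_,
      fun z hz s => ?_⟩
    · rw [integrable_indicator_iff measurableSet_closedBall]
      exact integrableOn_const measure_closedBall_lt_top.ne
    · by_cases hs : s ∈ Metric.closedBall (0 : ℝ) ρ
      · rw [indicator_of_mem hs, integrand₂, norm_div, Complex.norm_real, Real.norm_eq_abs,
          abs_mul, abs_mul, abs_mul, abs_two]
        rcases eq_or_ne (z - ξ s) 0 with h0 | h0
        · rw [h0, norm_zero, div_zero]
          have := hc.M_pos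
          positivity
        have hp : 0 < ‖z - ξ s‖ := norm_pos_iff.2 h0
        rw [div_le_iff₀ hp]
        have h1 : |(deriv ξ s * conj (z - ξ s)).re| ≤ M * ‖z - ξ s‖ := by
          refine (Complex.abs_re_le_norm _).trans ?_
          rw [norm_mul, RCLike.norm_conj]
          gcongr
          exact hc.speed_le s
        have h2 : |Γ s| ≤ max G 0 := (hG s hs).trans (le_max_left _ _)
        calc _ ≤ 2 * S * (M * ‖z - ξ s‖) * max G 0 := by
              have := hc.M_pos
              gcongr
              exact hS _
          _ = _ := by ring
      · have h1 : ρ < |s| := by simpa [Real.dist_eq] using hs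
        rw [hρ, div_lt_iff₀ hK] at h1
        have h2 := hc.mul_abs_le z s
        have h3 : 2 < ‖z - ξ s‖ := by linarith
        have h4 : 2 < |‖z - ξ s‖ ^ 2| := by
          rw [abs_of_nonneg (by positivity)]
          nlinarith
        simp [integrand₂, ha.deriv_eq_zero_of_gt h4, indicator_of_notMem hs]

/-- The third integrand vanishes for `|z - ξ| ≤ 1` and is `O(|s|^(β - 2))` with `β < 1` at infinity. -/
theorem integrand₃_regular (hc : IsChordArcCurve ξ K M) {a Γ : ℝ → ℝ} (ha : IsCutoff a)
    (hΓ : Continuous Γ) (hΓb : ∃ C ≥ (0 : ℝ), ∃ β < (1 : ℝ), ∀ s, |Γ s| ≤ C * (1 + |s|) ^ β) :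
    (∀ z, Integrable (integrand₃ ξ a Γ z)) ∧ Continuous fun z => ∫ s, integrand₃ ξ a Γ z s := by
  have hξ := hc.continuous
  have hξ' := hc.continuous_deriv
  have hac := ha.smooth.continuous
  have hK := hc.K_pos
  have hM := hc.M_pos
  have hzero : ∀ z s, ‖z - ξ s‖ ≤ 1 → integrand₃ ξ a Γ z s = 0 := by
    intro z s h
    have : |‖z - ξ s‖ ^ 2| ≤ 1 := by
      rw [abs_of_nonneg (by positivity)]
      exact pow_le_one₀ (norm_nonneg _) h
    simp [integrand₃, ha.eq_one _ this]
  refine integrable_and_continuous_of_dominated (fun z => ?_) (fun s => ?_) fun R => ?_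
  · refine Measurable.aestronglyMeasurable (Measurable.div ?_ ?_)
    · exact Continuous.measurable (by fun_prop)
    · exact Continuous.measurable (by fun_prop)
  · rw [continuous_iff_continuousAt]
    intro z
    rcases eq_or_ne z (ξ s) with rfl | hz
    · refine (continuousAt_const (y := (0 : ℂ))).congr ?_
      have : ∀ᶠ z in 𝓝 (ξ s), ‖z - ξ s‖ < 1 := by
        refine (by fun_prop : Continuous fun z => ‖z - ξ s‖).continuousAt.eventually
          (gt_mem_nhds (by simp))
      filter_upwards [this] with z hz
      exact (hzero z s hz.le).symm
    · refine ContinuousAt.div ?_ (by fun_prop) (pow_ne_zero 2 (sub_ne_zero.2 hz))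
      exact Continuous.continuousAt (by fun_prop)
  · obtain ⟨S, hS0, hS⟩ := ha.exists_abs_le
    obtain ⟨C, hC, β, hβ, hb⟩ := hΓb
    set D := 1 + (1 + max R 0 + ‖ξ 0‖) / K with hD
    have hDp : 0 < D := by positivity
    refine ⟨fun s => (1 + S) * M * C * D ^ 2 * (1 + ‖s‖) ^ (-(2 - β)), ?_, fun z hz s => ?_⟩
    · refine (integrable_one_add_norm ?_).const_mul _
      simp
      linarith
    · have hs1 : 0 < 1 + |s| := by positivity
      simp only [Real.norm_eq_abs]
      rw [show -(2 - β) = β - (2 : ℕ) by push_cast; ring,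
        Real.rpow_sub_natCast hs1.ne']
      rcases le_or_gt ‖z - ξ s‖ 1 with h | h
      · rw [hzero z s h, norm_zero]
        positivity
      · have h1 : 1 + |s| ≤ D * ‖z - ξ s‖ := by
          have h2 := hc.mul_abs_le z s
          have h3 : |s| ≤ (1 + max R 0 + ‖ξ 0‖) / K * ‖z - ξ s‖ := by
            rw [div_mul_eq_mul_div, le_div_iff₀ hK]
            have h5 : ‖z‖ ≤ max R 0 := hz.trans (le_max_left _ _)
            nlinarith [norm_nonneg (ξ 0), le_max_right R 0]
          rw [hD, add_mul]
          linarith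
        have hp : 0 < ‖z - ξ s‖ := one_pos.trans h
        have h4 : 1 / ‖z - ξ s‖ ^ 2 ≤ D ^ 2 / (1 + |s|) ^ 2 := by
          rw [div_le_div_iff₀ (by positivity) (by positivity), one_mul, ← mul_pow]
          gcongr
        have h6 : ‖((1 - a (‖z - ξ s‖ ^ 2) : ℝ) : ℂ)‖ ≤ 1 + S := by
          rw [Complex.norm_real, Real.norm_eq_abs]
          refine (abs_sub _ _).trans ?_
          rw [abs_one]
          gcongr
          exact hS _
        rw [integrand₃, norm_div, norm_mul, norm_mul, norm_pow, Complex.norm_real (Γ s),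
          Real.norm_eq_abs, div_eq_mul_one_div]
        calc _ ≤ (1 + S) * M * (C * (1 + |s|) ^ β) * (D ^ 2 / (1 + |s|) ^ 2) := by
              gcongr
              · exact hc.speed_le s
              · exact hb s
          _ = _ := by ring

end IsChordArcCurve

/-! ### The singular integrals near a point of the curve -/

namespace IsChordArcCurve

variable {ξ : ℝ → ℂ} {K M : ℝ}

theorem integrable_div_of_notMem (hc : IsChordArcCurve ξ K M) {g : ℝ → ℂ} (hg : Integrable g)
    {z : ℂ} (hz : z ∉ range ξ) : Integrable fun s => g s / (z - ξ s) := by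
  have hd := hc.infDist_pos hz
  refine (hg.norm.div_const (Metric.infDist z (range ξ))).mono' ?_ (ae_of_all _ fun s => ?_)
  · have hξ := hc.continuous
    refine (hg.aemeasurable.div (Continuous.aemeasurable ?_)).aestronglyMeasurable
    fun_prop
  · rw [norm_div]
    have : Metric.infDist z (range ξ) ≤ ‖z - ξ s‖ := by
      rw [← dist_eq_norm]
      exact Metric.infDist_le_dist_of_mem (mem_range_self s)
    gcongr

theorem aestronglyMeasurable_integrand₁ (hc : IsChordArcCurve ξ K M) {γ a : ℝ → ℝ}
    (hγ : LocallyL2 γ) (ha : IsCutoff a) (c : ℝ) (z : ℂ) :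
    AEStronglyMeasurable (integrand₁ ξ γ a c z) := by
  have hξ := hc.continuous
  have hac := ha.smooth.continuous
  have h1 := (hγ.locallyIntegrable_sub c).aestronglyMeasurable
  have h2 : AEStronglyMeasurable fun s => ((a (‖z - ξ s‖ ^ 2) : ℝ) : ℂ) :=
    (Continuous.aestronglyMeasurable (by fun_prop))
  have h3 := h2.mul h1
  have h4 : AEMeasurable fun s => z - ξ s := (Continuous.aemeasurable (by fun_prop))
  refine (h3.aemeasurable.div h4).aestronglyMeasurable.congr (ae_of_all _ fun s => ?_)
  simp [integrand₁]

/-- A bound for the first integrand where the denominator is at least `d`: the cutoff confines the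
parameter to a bounded interval. -/
theorem exists_integrand₁_bound (hc : IsChordArcCurve ξ K M) {γ a : ℝ → ℝ}
    (hγ : LocallyL2 γ) (ha : IsCutoff a) (c R : ℝ) {d : ℝ} (hd : 0 < d) :
    ∃ b : ℝ → ℝ, Integrable b ∧ (∀ s, 0 ≤ b s) ∧ ∀ z, ‖z‖ ≤ R → ∀ s, d ≤ ‖z - ξ s‖ →
      ‖integrand₁ ξ γ a c z s‖ ≤ b s := by
  have hK := hc.K_pos
  obtain ⟨S, hS0, hS⟩ := ha.exists_abs_le
  set ρ := (2 + R + ‖ξ 0‖) / K with hρ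
  refine ⟨(Metric.closedBall (0 : ℝ) ρ).indicator fun s => S * ‖((γ s - c : ℝ) : ℂ)‖ / d, ?_,
    fun s => indicator_nonneg (fun s _ => by positivity) s, fun z hz s hs => ?_⟩
  · rw [integrable_indicator_iff measurableSet_closedBall]
    exact ((((hγ.locallyIntegrable_sub c).integrableOn_isCompact
      (isCompact_closedBall _ _)).norm).const_mul S).div_const d
  · by_cases hsρ : s ∈ Metric.closedBall (0 : ℝ) ρ
    · rw [indicator_of_mem hsρ, integrand₁, norm_div, Complex.ofReal_mul, norm_mul,
        Complex.norm_real (a _), Real.norm_eq_abs]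
      gcongr
      exact hS _
    · have h1 : ρ < |s| := by simpa [Real.dist_eq] using hsρ
      rw [hρ, div_lt_iff₀ hK] at h1
      have h2 := hc.mul_abs_le z s
      have h3 : 2 < ‖z - ξ s‖ := by linarith
      have h4 : 2 ≤ |‖z - ξ s‖ ^ 2| := by
        rw [abs_of_nonneg (by positivity)]
        nlinarith
      simp [integrand₁, ha.eq_zero _ h4, indicator_of_notMem hsρ]

theorem integrable_integrand₁ (hc : IsChordArcCurve ξ K M) {γ a : ℝ → ℝ}
    (hγ : LocallyL2 γ) (ha : IsCutoff a) (c : ℝ) {z : ℂ} (hz : z ∉ range ξ) :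
    Integrable (integrand₁ ξ γ a c z) := by
  obtain ⟨b, hb, -, hle⟩ := hc.exists_integrand₁_bound hγ ha c ‖z‖ (hc.infDist_pos hz)
  refine hb.mono' (hc.aestronglyMeasurable_integrand₁ hγ ha c z)
    (ae_of_all _ fun s => hle z le_rfl s ?_)
  rw [← dist_eq_norm]
  exact Metric.infDist_le_dist_of_mem (mem_range_self s)

/-- The part of the first integral over `|s - α| > δ` is continuous at `ξ α`. -/
theorem far_integrand₁ (hc : IsChordArcCurve ξ K M) {γ a : ℝ → ℝ}
    (hγ : LocallyL2 γ) (ha : IsCutoff a) (c : ℝ) {α δ : ℝ} (hδ : 0 < δ) :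
    Integrable ((Metric.closedBall α δ)ᶜ.indicator (integrand₁ ξ γ a c (ξ α))) ∧
    ContinuousAt (fun z => ∫ s, (Metric.closedBall α δ)ᶜ.indicator (integrand₁ ξ γ a c z) s)
      (ξ α) := by
  have hK := hc.K_pos
  have hac := ha.smooth.continuous
  obtain ⟨b, hb, hb0, hle⟩ := hc.exists_integrand₁_bound hγ ha c (‖ξ α‖ + K * δ / 2)
    (by positivity : 0 < K / 2 * δ)
  have hmeas : ∀ z, AEStronglyMeasurable
      ((Metric.closedBall α δ)ᶜ.indicator (integrand₁ ξ γ a c z)) := fun z =>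
    (hc.aestronglyMeasurable_integrand₁ hγ ha c z).indicator measurableSet_closedBall.compl
  have hbound : ∀ z, ‖z - ξ α‖ ≤ K * δ / 2 → ∀ s,
      ‖(Metric.closedBall α δ)ᶜ.indicator (integrand₁ ξ γ a c z) s‖ ≤ b s := by
    intro z hz s
    by_cases hs : s ∈ Metric.closedBall α δ
    · rw [indicator_of_notMem (notMem_compl_iff.2 hs), norm_zero]
      exact hb0 s
    · rw [indicator_of_mem (mem_compl hs)]
      have h1 : δ < |s - α| := by simpa [Real.dist_eq] using hs
      refine hle z ?_ s (le_trans (by gcongr) (hc.le_norm_sub_of_far hz h1.le))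
      have := norm_add_le (z - ξ α) (ξ α)
      rw [sub_add_cancel] at this
      linarith
  have hself : ‖ξ α - ξ α‖ ≤ K * δ / 2 := by
    rw [sub_self, norm_zero]
    positivity
  refine ⟨hb.mono' (hmeas _) (ae_of_all _ (hbound _ hself)), ?_⟩
  refine continuousAt_of_dominated (bound := b) (Eventually.of_forall hmeas) ?_ hb
    (ae_of_all _ fun s => ?_)
  · filter_upwards [Metric.closedBall_mem_nhds (ξ α) (by positivity : 0 < K * δ / 2)] with z hz
    rw [mem_closedBall_iff_norm] at hz
    exact ae_of_all _ (hbound z hz)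
  · by_cases hs : s ∈ Metric.closedBall α δ
    · simp only [indicator_of_notMem (notMem_compl_iff.2 hs)]
      exact continuousAt_const
    · simp only [indicator_of_mem (mem_compl hs), integrand₁]
      have h1 : α ≠ s := by
        rintro rfl
        exact hs (Metric.mem_closedBall_self hδ.le)
      refine ContinuousAt.div ?_ (by fun_prop) (hc.ne h1)
      exact Complex.continuous_ofReal.continuousAt.comp (Continuous.continuousAt (by fun_prop))

/-- Near `ξ α` the cutoff is `1` for `|s - α| ≤ δ`, so that the first integrand is a Cauchy
kernel there. -/
theorem integrand₁_eq (hc : IsChordArcCurve ξ K M) {γ a : ℝ → ℝ} (ha : IsCutoff a) (c : ℝ)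
    {α δ : ℝ} (hMδ : M * δ ≤ 1 / 2) {z : ℂ} (hz : ‖z - ξ α‖ ≤ 1 / 2) (s : ℝ) :
    integrand₁ ξ γ a c z s
      = (Metric.closedBall α δ).indicator (fun s => ((γ s - c : ℝ) : ℂ)) s / (z - ξ s)
        + (Metric.closedBall α δ)ᶜ.indicator (integrand₁ ξ γ a c z) s := by
  by_cases hs : s ∈ Metric.closedBall α δ
  · rw [indicator_of_mem hs, indicator_of_notMem (notMem_compl_iff.2 hs), add_zero, integrand₁]
    have h1 : |s - α| ≤ δ := by rwa [Metric.mem_closedBall, Real.dist_eq] at hs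
    have h2 : ‖ξ s - ξ α‖ ≤ M * ‖s - α‖ :=
      convex_univ.norm_image_sub_le_of_norm_deriv_le (fun x _ => hc.differentiable x)
        (fun x _ => hc.speed_le x) (mem_univ α) (mem_univ s)
    rw [Real.norm_eq_abs] at h2
    have h3 : M * |s - α| ≤ M * δ := by
      have := hc.M_pos
      gcongr
    have h4 := norm_sub_le_norm_sub_add_norm_sub z (ξ α) (ξ s)
    rw [norm_sub_rev (ξ α)] at h4
    have h5 : |‖z - ξ s‖ ^ 2| ≤ 1 := by
      rw [abs_of_nonneg (by positivity)]
      exact pow_le_one₀ (norm_nonneg _) (by linarith)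
    rw [ha.eq_one _ h5, one_mul]
  · rw [indicator_of_notMem hs, indicator_of_mem (mem_compl hs), zero_div, zero_add]

/-- The difference of the kernels `c / (z - ξ)` and `c / (ξ(α) - ξ)` decays quadratically, and its
integral over `|s - α| > δ` tends to zero as `z → ξ(α)`. -/
theorem far_integrand₀ (hc : IsChordArcCurve ξ K M) (c : ℝ) {α δ : ℝ} (hδ : 0 < δ) :
    (∀ z, ‖z - ξ α‖ ≤ K * δ / 2 → Integrable ((Metric.closedBall α δ)ᶜ.indicator
      fun s => integrand₀ ξ c z s - integrand₀ ξ c (ξ α) s)) ∧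
    Tendsto (fun z => ∫ s, (Metric.closedBall α δ)ᶜ.indicator
      (fun s => integrand₀ ξ c z s - integrand₀ ξ c (ξ α) s) s) (𝓝 (ξ α)) (𝓝 0) := by
  have hK := hc.K_pos
  have hξ := hc.continuous
  set b : ℝ → ℝ := (Metric.closedBall α δ)ᶜ.indicator fun s => 1 / (s - α) ^ 2 with hb
  have hbi : Integrable b :=
    (integrableOn_compl_closedBall_inv_sq α hδ).integrable_indicator measurableSet_closedBall.compl
  have hmeas : ∀ z, AEStronglyMeasurable ((Metric.closedBall α δ)ᶜ.indicator
      fun s => integrand₀ ξ c z s - integrand₀ ξ c (ξ α) s) := by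
    intro z
    refine AEStronglyMeasurable.indicator ?_ measurableSet_closedBall.compl
    have h1 : ∀ w : ℂ, AEStronglyMeasurable fun s => integrand₀ ξ c w s := fun w =>
      (measurable_const.div (Continuous.measurable (by fun_prop))).aestronglyMeasurable
    exact (h1 z).sub (h1 (ξ α))
  have hbound : ∀ z, ‖z - ξ α‖ ≤ K * δ / 2 → ∀ s, ‖(Metric.closedBall α δ)ᶜ.indicator
      (fun s => integrand₀ ξ c z s - integrand₀ ξ c (ξ α) s) s‖
        ≤ ‖z - ξ α‖ * (|c| * (2 / K ^ 2)) * b s := by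
    intro z hz s
    by_cases hs : s ∈ Metric.closedBall α δ
    · rw [hb, indicator_of_notMem (notMem_compl_iff.2 hs),
        indicator_of_notMem (notMem_compl_iff.2 hs), norm_zero, mul_zero]
    · have h1 : δ < |s - α| := by simpa [Real.dist_eq] using hs
      have hp : 0 < |s - α| := hδ.trans h1
      have h2 := hc.le_norm_sub_of_far hz h1.le
      have h3 := hc.le_dist' α s
      have n1 : z - ξ s ≠ 0 := norm_pos_iff.1 (lt_of_lt_of_le (by positivity) h2)
      have n2 : ξ α - ξ s ≠ 0 := norm_pos_iff.1 (lt_of_lt_of_le (by positivity) h3)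
      have e : integrand₀ ξ c z s - integrand₀ ξ c (ξ α) s
          = -(z - ξ α) * ((c : ℂ) / ((z - ξ s) * (ξ α - ξ s))) := by
        simp only [integrand₀]
        field_simp
        ring
      rw [hb, indicator_of_mem (mem_compl hs), indicator_of_mem (mem_compl hs), e, norm_mul,
        norm_neg, norm_div, norm_mul, Complex.norm_real, Real.norm_eq_abs, mul_assoc]
      refine mul_le_mul_of_nonneg_left ?_ (norm_nonneg _)
      calc |c| / (‖z - ξ s‖ * ‖ξ α - ξ s‖) ≤ |c| / ((K / 2 * |s - α|) * (K * |s - α|)) := by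
            gcongr
        _ = _ := by
            rw [← sq_abs (s - α)]
            field_simp
  refine ⟨fun z hz => (hbi.const_mul _).mono' (hmeas z) (ae_of_all _ (hbound z hz)), ?_⟩
  have hlim : Tendsto (fun z => ‖z - ξ α‖ * (|c| * (2 / K ^ 2)) * ∫ s, b s) (𝓝 (ξ α)) (𝓝 0) :=
    (by fun_prop : Continuous fun z => ‖z - ξ α‖ * (|c| * (2 / K ^ 2)) * ∫ s, b s).tendsto' _ _
      (by simp)
  refine squeeze_zero_norm' ?_ hlim
  filter_upwards [Metric.closedBall_mem_nhds (ξ α) (by positivity : 0 < K * δ / 2)] with z hz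
  rw [mem_closedBall_iff_norm] at hz
  rw [← integral_const_mul]
  exact norm_integral_le_of_norm_le (hbi.const_mul _) (ae_of_all _ (hbound z hz))

theorem integrableOn_integrand₀_annulus (hc : IsChordArcCurve ξ K M) (c : ℝ) {α δ : ℝ}
    (hδ : 0 < δ) : IntegrableOn ((Metric.closedBall α δ)ᶜ.indicator (integrand₀ ξ c (ξ α)))
      {s | |s - α| ≤ 1} := by
  have hK := hc.K_pos
  have hξ := hc.continuous
  have hset : {s : ℝ | |s - α| ≤ 1} = Metric.closedBall α 1 := by
    ext s
    simp [Real.dist_eq]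
  rw [hset]
  refine (integrableOn_const (C := |c| / (K * δ)) measure_closedBall_lt_top.ne).mono' ?_
    (ae_of_all _ fun s => ?_)
  · refine AEStronglyMeasurable.indicator ?_ measurableSet_closedBall.compl
    exact (measurable_const.div (Continuous.measurable (by fun_prop))).aestronglyMeasurable
  · by_cases hs : s ∈ Metric.closedBall α δ
    · rw [indicator_of_notMem (notMem_compl_iff.2 hs), norm_zero]
      positivity
    · have h1 : δ < |s - α| := by simpa [Real.dist_eq] using hs
      have h3 : K * δ ≤ ‖ξ α - ξ s‖ := le_trans (by gcongr) (hc.le_dist' α s)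
      rw [indicator_of_mem (mem_compl hs), integrand₀, norm_div, Complex.norm_real,
        Real.norm_eq_abs]
      gcongr

/-- For `z` off the curve and near `ξ α` the principal value at infinity of `c / (z - ξ)` is that
of `c / (ξ(α) - ξ)` plus convergent integrals. -/
theorem hasPVInfty_integrand₀ (hc : IsChordArcCurve ξ K M) (c : ℝ) {α δ : ℝ} {F : ℂ} (hδ : 0 < δ)
    (hδ1 : δ ≤ 1) (hF : HasPVInfty ({s | 1 < |s - α|}.indicator (integrand₀ ξ c (ξ α))) F)
    {z : ℂ} (hz : z ∉ range ξ) (hzα : ‖z - ξ α‖ ≤ K * δ / 2) :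
    HasPVInfty (integrand₀ ξ c z)
      (F + (cauchyIntegral ξ ((Metric.closedBall α δ).indicator fun _ => (c : ℂ)) z
        + (∫ s in {s | |s - α| ≤ 1},
            (Metric.closedBall α δ)ᶜ.indicator (integrand₀ ξ c (ξ α)) s)
        + ∫ s, (Metric.closedBall α δ)ᶜ.indicator
            (fun s => integrand₀ ξ c z s - integrand₀ ξ c (ξ α) s) s)) := by
  set B := Metric.closedBall α δ with hB
  have hset1 : MeasurableSet {s : ℝ | |s - α| ≤ 1} :=
    measurableSet_le (by fun_prop) measurable_const
  have i1 : Integrable fun s => B.indicator (fun _ => (c : ℂ)) s / (z - ξ s) :=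
    hc.integrable_div_of_notMem ((integrableOn_const
      measure_closedBall_lt_top.ne).integrable_indicator measurableSet_closedBall) hz
  have i2 := (hc.integrableOn_integrand₀_annulus c (α := α) hδ).integrable_indicator hset1
  rw [← hB] at i2
  have i3 := (hc.far_integrand₀ c (α := α) hδ).1 z hzα
  rw [← hB] at i3
  have i12 : Integrable fun s => B.indicator (fun _ => (c : ℂ)) s / (z - ξ s)
      + {s : ℝ | |s - α| ≤ 1}.indicator (Bᶜ.indicator (integrand₀ ξ c (ξ α))) s := i1.add i2
  have i123 : Integrable fun s => B.indicator (fun _ => (c : ℂ)) s / (z - ξ s)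
      + {s : ℝ | |s - α| ≤ 1}.indicator (Bᶜ.indicator (integrand₀ ξ c (ξ α))) s
      + Bᶜ.indicator (fun s => integrand₀ ξ c z s - integrand₀ ξ c (ξ α) s) s := i12.add i3
  have h := hF.add_integrable i123
  rw [integral_add i12 i3, integral_add i1 i2, integral_indicator hset1] at h
  convert h using 1
  swap
  · rfl
  ext s
  by_cases hs : s ∈ B
  · have h1 : |s - α| ≤ δ := by rwa [hB, Metric.mem_closedBall, Real.dist_eq] at hs
    have h2 : s ∉ {s : ℝ | 1 < |s - α|} := not_lt.2 (h1.trans hδ1)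
    have h3 : s ∈ {s : ℝ | |s - α| ≤ 1} := h1.trans hδ1
    rw [indicator_of_notMem h2, indicator_of_mem hs, indicator_of_mem h3,
      indicator_of_notMem (notMem_compl_iff.2 hs), indicator_of_notMem (notMem_compl_iff.2 hs)]
    simp [integrand₀]
  · rw [indicator_of_notMem hs, indicator_of_mem (mem_compl hs)]
    by_cases h3 : |s - α| ≤ 1
    · rw [indicator_of_notMem (by exact not_lt.2 h3), indicator_of_mem (by exact h3),
        indicator_of_mem (mem_compl hs)]
      ring
    · rw [indicator_of_mem (by exact not_le.1 h3), indicator_of_notMem (by exact h3)]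
      ring

end IsChordArcCurve

/-! ### The jump relations -/

/-- The jump relations from the limits of the conjugate velocity: conjugation turns the jump
`∓ γ / (2 ξ')` into `∓ (γ / (2 |ξ'|)) ξ' / |ξ'|`, which is tangential. -/
theorem jumpRelations_of_tendsto_conj {ξ : ℝ → ℂ} {γ : ℝ → ℝ} {V : ℂ → ℂ} {α : ℝ} {w : ℂ}
    {la lb : Filter ℂ} (hξ : deriv ξ α ≠ 0)
    (ha : Tendsto (fun z => conj (V z)) la (𝓝 (conj w - γ α / (2 * deriv ξ α))))
    (hb : Tendsto (fun z => conj (V z)) lb (𝓝 (conj w + γ α / (2 * deriv ξ α)))) :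
    JumpRelations ξ γ V α w la lb := by
  have hs : (‖deriv ξ α‖ : ℂ) ≠ 0 := by simpa using hξ
  have hs' : ‖deriv ξ α‖ ≠ 0 := by simpa using hξ
  have hcξ : conj (deriv ξ α) ≠ 0 := by simpa using hξ
  have hj : conj ((γ α : ℂ) / (2 * deriv ξ α))
      = ((γ α / (2 * arclengthElement ξ α) : ℝ) : ℂ) * unitTangent ξ α := by
    have := Complex.mul_conj' (deriv ξ α)
    simp only [arclengthElement, unitTangent, map_div₀, map_mul, Complex.conj_ofReal, map_ofNat]
    push_cast
    field_simp
    linear_combination (-(γ α : ℂ)) * this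
  have ha' := (Complex.continuous_conj.tendsto _).comp ha
  have hb' := (Complex.continuous_conj.tendsto _).comp hb
  simp only [Function.comp_def, map_sub, map_add, hj, Complex.conj_conj] at ha' hb'
  have hn : unitNormal ξ α = unitTangent ξ α * Complex.I := by
    rw [unitNormal_eq, unitTangent, arclengthElement]
    ring
  have htt : inner ℝ (unitTangent ξ α) (unitTangent ξ α) = 1 := by
    rw [real_inner_self_eq_norm_sq, unitTangent, arclengthElement, norm_div, Complex.norm_real,
      norm_norm, div_self hs', one_pow]
  have htn : inner ℝ (unitTangent ξ α) (unitNormal ξ α) = 0 := by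
    rw [hn, Complex.inner]
    simp
    ring
  refine ⟨_, _, ha', hb', rfl, rfl, ?_, ?_⟩
  · rw [← Complex.real_smul, inner_sub_left, inner_add_left, real_inner_smul_left, htn]
    ring
  · rw [← Complex.real_smul, inner_sub_left, inner_add_left, real_inner_smul_left, htt]
    simp only [arclengthElement]
    field_simp
    ring

namespace IsChordArcCurve

variable {ξ : ℝ → ℂ} {K M : ℝ}

/-- Reduction to local Cauchy integrals. The Birkhoff-Rott integral converges once the truncated
Cauchy integrals of `c` and of `γ - c` near `α` have principal values, and the jump relations hold
along any filters along which Plemelj's formula holds for these two densities. -/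
theorem exists_isBirkhoffRott_jumpRelations (hc : IsChordArcCurve ξ K M) {γ a Γ : ℝ → ℝ} {c : ℝ}
    (hγ : LocallyL2 γ) (hΓ : IsSublinearPrimitive γ c Γ) (ha : IsCutoff a) {V : ℂ → ℂ}
    (hV : ∀ z, z ∉ range ξ → IsSheetVelocity ξ γ a c Γ z (V z)) {α δ : ℝ} (hδ : 0 < δ)
    (hδ1 : δ ≤ 1) (hMδ : M * δ ≤ 1 / 2) {F N₀ N₁ : ℂ}
    (hF : HasPVInfty ({s | 1 < |s - α|}.indicator (integrand₀ ξ c (ξ α))) F)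
    (h₀ : HasCauchyPV ξ ((Metric.closedBall α δ).indicator fun _ => (c : ℂ)) α N₀)
    (h₁ : HasCauchyPV ξ ((Metric.closedBall α δ).indicator fun s => ((γ s - c : ℝ) : ℂ)) α N₁) :
    ∃ w : ℂ, IsBirkhoffRott ξ γ a c Γ α w ∧ ∀ la lb : Filter ℂ,
      la ≤ 𝓝 (ξ α) ⊓ 𝓟 (range ξ)ᶜ → lb ≤ 𝓝 (ξ α) ⊓ 𝓟 (range ξ)ᶜ →
      Tendsto (cauchyIntegral ξ ((Metric.closedBall α δ).indicator fun _ => (c : ℂ))) la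
        (𝓝 (N₀ - Real.pi * Complex.I * c / deriv ξ α)) →
      Tendsto (cauchyIntegral ξ ((Metric.closedBall α δ).indicator fun _ => (c : ℂ))) lb
        (𝓝 (N₀ + Real.pi * Complex.I * c / deriv ξ α)) →
      Tendsto (cauchyIntegral ξ ((Metric.closedBall α δ).indicator
        fun s => ((γ s - c : ℝ) : ℂ))) la
        (𝓝 (N₁ - Real.pi * Complex.I * ((γ α - c : ℝ) : ℂ) / deriv ξ α)) →
      Tendsto (cauchyIntegral ξ ((Metric.closedBall α δ).indicator
        fun s => ((γ s - c : ℝ) : ℂ))) lb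
        (𝓝 (N₁ + Real.pi * Complex.I * ((γ α - c : ℝ) : ℂ) / deriv ξ α)) →
      JumpRelations ξ γ V α w la lb := by
  have hK := hc.K_pos
  obtain ⟨hi2, hcont2⟩ := hc.integrand₂_regular ha (hΓ.continuous hγ)
  obtain ⟨hi3, hcont3⟩ := hc.integrand₃_regular ha (hΓ.continuous hγ) (hΓ.exists_bound hγ)
  obtain ⟨hfar1, hcont1⟩ := hc.far_integrand₁ hγ ha c (α := α) hδ
  obtain ⟨hfar0, hlim0⟩ := hc.far_integrand₀ c (α := α) hδ
  set B := Metric.closedBall α δ with hB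
  have hball : ∀ f : ℝ → ℂ, ∀ s, δ < |s - α| → B.indicator f s = 0 := fun f s hs =>
    indicator_of_notMem (by simpa [hB, Real.dist_eq] using hs) _
  have hu : Integrable (B.indicator fun s => ((γ s - c : ℝ) : ℂ)) :=
    ((hγ.locallyIntegrable_sub c).integrableOn_isCompact
      (isCompact_closedBall _ _)).integrable_indicator measurableSet_closedBall
  have hk : Integrable (B.indicator fun _ => (c : ℂ)) :=
    (integrableOn_const measure_closedBall_lt_top.ne).integrable_indicator measurableSet_closedBall
  have hset1 : MeasurableSet {s : ℝ | 1 < |s - α|} := measurableSet_lt measurable_const (by fun_prop)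
  set A₀ := ∫ s in {s | |s - α| ≤ 1}, Bᶜ.indicator (integrand₀ ξ c (ξ α)) s with hA₀
  -- `B` does not meet `|s - α| > 1`, where the definition of `HasPV` splits the line
  have hF' : HasPVInfty ({s | 1 < |s - α|}.indicator (Bᶜ.indicator (integrand₀ ξ c (ξ α)))) F := by
    rw [indicator_indicator, inter_eq_left.2]
    · exact hF
    · intro s (hs : 1 < |s - α|)
      simpa [hB, Real.dist_eq] using hδ1.trans_lt hs
  have hL₀ : HasPV (integrand₀ ξ c (ξ α)) α (N₀ + (A₀ + F)) := by
    refine hasPV_of_hasCauchyPV hδ1 hK (hc.le_dist' α) hc.continuous hk (hball _) h₀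
      (hc.integrableOn_integrand₀_annulus c hδ) hF' fun s => ?_
    by_cases hs : s ∈ B
    · rw [indicator_of_mem hs, indicator_of_notMem (notMem_compl_iff.2 hs), add_zero, integrand₀]
    · rw [indicator_of_notMem hs, indicator_of_mem (mem_compl hs), zero_div, zero_add]
  set E : ℂ → ℂ := fun z => ∫ s, Bᶜ.indicator (integrand₁ ξ γ a c z) s with hE
  have hL₁ : HasPV (integrand₁ ξ γ a c (ξ α)) α (N₁ + E (ξ α)) := by
    have := hasPV_of_hasCauchyPV hδ1 hK (hc.le_dist' α) hc.continuous hu (hball _) h₁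
      hfar1.integrableOn (hasPVInfty_of_integrable (hfar1.indicator hset1))
      (hc.integrand₁_eq ha c hMδ (z := ξ α) (by norm_num))
    rw [integral_indicator hset1] at this
    convert this using 2
    have hset2 : {s : ℝ | 1 < |s - α|} = {s : ℝ | |s - α| ≤ 1}ᶜ := by
      ext s
      simp
    rw [hset2, integral_add_compl (measurableSet_le (by fun_prop) measurable_const) hfar1]
  set k : ℂ := 1 / (2 * (Real.pi : ℂ) * Complex.I) with hkdef
  set w : ℂ := conj (k * ((N₀ + (A₀ + F)) + (N₁ + E (ξ α)) - (∫ s, integrand₂ ξ a Γ (ξ α) s)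
    - ∫ s, integrand₃ ξ a Γ (ξ α) s)) with hw
  have hconjw : conj w = _ := Complex.conj_conj _
  refine ⟨w, ⟨hi2 _, hi3 _, _, _, hL₀, hL₁, hconjw⟩, ?_⟩
  set C₀ := cauchyIntegral ξ (B.indicator fun _ => (c : ℂ)) with hC₀
  set C₁ := cauchyIntegral ξ (B.indicator fun s => ((γ s - c : ℝ) : ℂ)) with hC₁
  set D : ℂ → ℂ := fun z =>
    ∫ s, Bᶜ.indicator (fun s => integrand₀ ξ c z s - integrand₀ ξ c (ξ α) s) s with hD
  have hformula : ∀ z, z ∉ range ξ → ‖z - ξ α‖ ≤ K * δ / 2 → ‖z - ξ α‖ ≤ 1 / 2 →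
      conj (V z) = k * ((F + (C₀ z + A₀ + D z)) + (C₁ z + E z)
        - (∫ s, integrand₂ ξ a Γ z s) - ∫ s, integrand₃ ξ a Γ z s) := by
    intro z hz hz1 hz2
    obtain ⟨j1, -, -, L, hL, hconj⟩ := hV z hz
    rw [hconj, hL.unique (hc.hasPVInfty_integrand₀ c hδ hδ1 hF hz hz1)]
    have e1 : ∫ s, integrand₁ ξ γ a c z s = C₁ z + E z := by
      rw [integral_congr_ae (ae_of_all _ (hc.integrand₁_eq ha c hMδ hz2))]
      refine integral_add (hc.integrable_div_of_notMem hu hz) ?_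
      exact j1.indicator measurableSet_closedBall.compl
    rw [e1]
  -- every term but the two local Cauchy integrals is continuous at `ξ α`
  have key : ∀ l : Filter ℂ, l ≤ 𝓝 (ξ α) ⊓ 𝓟 (range ξ)ᶜ → ∀ v₀ v₁ : ℂ,
      Tendsto C₀ l (𝓝 (N₀ + v₀)) → Tendsto C₁ l (𝓝 (N₁ + v₁)) →
      Tendsto (fun z => conj (V z)) l (𝓝 (conj w + k * (v₀ + v₁))) := by
    intro l hl v₀ v₁ hv₀ hv₁
    have hl' : l ≤ 𝓝 (ξ α) := hl.trans inf_le_left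
    have hlim : Tendsto (fun z => k * ((F + (C₀ z + A₀ + D z)) + (C₁ z + E z)
        - (∫ s, integrand₂ ξ a Γ z s) - ∫ s, integrand₃ ξ a Γ z s)) l
        (𝓝 (k * ((F + ((N₀ + v₀) + A₀ + 0)) + ((N₁ + v₁) + E (ξ α))
        - (∫ s, integrand₂ ξ a Γ (ξ α) s) - ∫ s, integrand₃ ξ a Γ (ξ α) s))) :=
      ((((((hv₀.add_const A₀).add (hlim0.mono_left hl')).const_add F).add
        (hv₁.add (hcont1.tendsto.mono_left hl'))).sub
        ((hcont2.tendsto (ξ α)).mono_left hl')).sub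
        ((hcont3.tendsto (ξ α)).mono_left hl')).const_mul k
    have hval : conj w + k * (v₀ + v₁) = k * ((F + ((N₀ + v₀) + A₀ + 0)) + ((N₁ + v₁) + E (ξ α))
        - (∫ s, integrand₂ ξ a Γ (ξ α) s) - ∫ s, integrand₃ ξ a Γ (ξ α) s) := by
      rw [hconjw]
      ring
    rw [hval]
    refine hlim.congr' ?_
    have n1 := hl' (Metric.closedBall_mem_nhds (ξ α) (by positivity : 0 < K * δ / 2))
    have n2 := hl' (Metric.closedBall_mem_nhds (ξ α) (by norm_num : (0 : ℝ) < 1 / 2))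
    have n3 : (range ξ)ᶜ ∈ l := (hl.trans inf_le_right) (mem_principal_self _)
    filter_upwards [n1, n2, n3] with z hz1 hz2 hz3
    rw [mem_closedBall_iff_norm] at hz1 hz2
    exact (hformula z hz3 hz1 hz2).symm
  intro la lb hla hlb ha0 hb0 ha1 hb1
  have hξ := hc.deriv_ne_zero α
  have hπ : (Real.pi : ℂ) ≠ 0 := by exact_mod_cast Real.pi_ne_zero
  refine jumpRelations_of_tendsto_conj hξ ?_ ?_
  · rw [sub_eq_add_neg] at ha0 ha1
    convert key la hla _ _ ha0 ha1 using 2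
    rw [hkdef, sub_eq_add_neg]
    congr 1
    push_cast
    field_simp
    ring
  · convert key lb hlb _ _ hb0 hb1 using 2
    rw [hkdef]
    congr 1
    push_cast
    field_simp
    ring

/-- The integrals defining the velocity converge at every point off the curve. -/
theorem exists_isSheetVelocity (hc : IsChordArcCurve ξ K M) {γ a Γ : ℝ → ℝ} {c : ℝ}
    (hγ : LocallyL2 γ) (hΓ : IsSublinearPrimitive γ c Γ) (ha : IsCutoff a)
    (hPV : PVKernelConverges ξ ∨ c = 0) {z : ℂ} (hz : z ∉ range ξ) :
    ∃ v, IsSheetVelocity ξ γ a c Γ z v := by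
  have h0 : ∃ L, HasPVInfty (integrand₀ ξ c z) L := by
    rcases hPV with h | rfl
    · obtain ⟨L, hL⟩ := h.2 z (hc.infDist_pos hz)
      refine ⟨c * L, ?_⟩
      convert hL.const_mul c using 2 with s
      rw [integrand₀, mul_one_div]
    · refine ⟨0, ?_⟩
      convert hasPVInfty_zero using 2 with s
      simp [integrand₀]
  obtain ⟨L, hL⟩ := h0
  exact ⟨conj _, hc.integrable_integrand₁ hγ ha c hz,
    (hc.integrand₂_regular ha (hΓ.continuous hγ)).1 z,
    (hc.integrand₃_regular ha (hΓ.continuous hγ) (hΓ.exists_bound hγ)).1 z, L, hL,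
    Complex.conj_conj _⟩

end IsChordArcCurve

theorem exists_hasPVInfty_integrand₀ {ξ : ℝ → ℂ} {c : ℝ} (hPV : PVKernelConverges ξ ∨ c = 0)
    (α : ℝ) : ∃ F, HasPVInfty ({s | 1 < |s - α|}.indicator (integrand₀ ξ c (ξ α))) F := by
  rcases hPV with h | rfl
  · obtain ⟨_, N, F, -, -, hF, -⟩ := h.1 α
    refine ⟨c * F, ?_⟩
    convert hF.const_mul c using 1
    ext s
    rw [← indicator_const_mul]
    simp only [mul_one_div]
    rfl
  · refine ⟨0, ?_⟩
    convert hasPVInfty_zero using 1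
    ext s
    simp [integrand₀, indicator]

theorem mainTheorem5 (ξ : ℝ → ℂ) (γ : ℝ → ℝ) (a : ℝ → ℝ) (c : ℝ) (Γ : ℝ → ℝ)
    (hγ : LocallyL2 γ)
    (hΓ : IsSublinearPrimitive γ c Γ)
    (hPV : PVKernelConverges ξ ∨ c = 0)
    (ha : IsCutoff a)
    (hξ : ContDiff ℝ 2 ξ)
    (hchord : ChordArc ξ)
    (hspeed : ∃ M > (0 : ℝ), ∀ α : ℝ, 1 / M ≤ ‖deriv ξ α‖ ∧ ‖deriv ξ α‖ ≤ M)
    (hdecomp : ∃ f₁ f₂ : ℝ → ℂ, MemLp f₁ 2 volume ∧ MemLp f₂ ⊤ volume ∧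
      ∀ α : ℝ, ξ α - (α : ℂ) = f₁ α + f₂ α) :
    ∃ V : ℂ → ℂ,
      (∀ z : ℂ, z ∉ Set.range ξ → IsSheetVelocity ξ γ a c Γ z (V z)) ∧
      (∀ᵐ α : ℝ, ∃ w : ℂ, IsBirkhoffRott ξ γ a c Γ α w ∧
        ∀ A : ℝ, JumpRelations ξ γ V α w
          (approachAbove ξ α ⊓ 𝓟 (nontangentialRegion ξ α A))
          (approachBelow ξ α ⊓ 𝓟 (nontangentialRegion ξ α A))) ∧
      (∀ α : ℝ, HolderNear γ α → ∃ w : ℂ, IsBirkhoffRott ξ γ a c Γ α w ∧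
        JumpRelations ξ γ V α w (approachAbove ξ α) (approachBelow ξ α)) := by
  obtain ⟨K, hK, hle⟩ := hchord.exists_le
  obtain ⟨M, hM, hspeed⟩ := hspeed
  have hc : IsChordArcCurve ξ K M :=
    ⟨hξ, hK, hM, hle, fun s => (hspeed s).1, fun s => (hspeed s).2⟩
  have hVex : ∀ z, ∃ v, z ∉ range ξ → IsSheetVelocity ξ γ a c Γ z v := by
    intro z
    by_cases hz : z ∈ range ξ
    · exact ⟨0, fun h => absurd hz h⟩
    · obtain ⟨v, hv⟩ := hc.exists_isSheetVelocity hγ hΓ ha hPV hz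
      exact ⟨v, fun _ => hv⟩
  choose V hV using hVex
  have hhalf : ∀ δ, δ ≤ 1 / (2 * M) → M * δ ≤ 1 / 2 := fun δ h => by
    rw [le_div_iff₀ (by positivity)] at h
    linarith
  have hαδ : ∀ {α δ : ℝ}, 0 < δ → α ∈ Metric.closedBall α δ := fun h =>
    Metric.mem_closedBall_self h.le
  refine ⟨V, hV, ?_, fun α hα => ?_⟩
  · filter_upwards [hc.ae_exists_plemelj (hγ.memLp_sub c)] with α hα
    -- `M δ ≤ 1 / 2` keeps the cutoff equal to `1` on `|s - α| ≤ δ` for `z` within `1 / 2` of `ξ α`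
    have hδ : 0 < min 1 (1 / (2 * M)) := by positivity
    obtain ⟨F, hF⟩ := exists_hasPVInfty_integrand₀ hPV α
    obtain ⟨N₁, hN₁, hlim⟩ := hα _ hδ (min_le_left _ _)
    obtain ⟨N₀, hN₀, hab, hbe⟩ :=
      hc.exists_plemelj_of_isHolderDensity (isHolderDensity_indicator_const hδ (c : ℂ) (α := α))
    rw [indicator_of_mem (hαδ hδ)] at hab hbe
    obtain ⟨w, hw, hjump⟩ := hc.exists_isBirkhoffRott_jumpRelations hγ hΓ ha hV hδ
      (min_le_left _ _) (hhalf _ (min_le_right _ _)) hF hN₀ hN₁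
    exact ⟨w, hw, fun A => hjump _ _ (inf_le_left.trans (hc.approachAbove_le α))
      (inf_le_left.trans (hc.approachBelow_le α)) (hab.mono_left inf_le_left)
      (hbe.mono_left inf_le_left) (hlim A).1 (hlim A).2⟩
  · obtain ⟨r, hr, H, hH, θ, hθ, hol⟩ := hα
    set δ := min (min 1 (1 / (2 * M))) (r / 2) with hδdef
    have hδ : 0 < δ := by positivity
    have hδr : δ < r := lt_of_le_of_lt (min_le_right _ _) (half_lt_self hr)
    obtain ⟨F, hF⟩ := exists_hasPVInfty_integrand₀ hPV α
    have hdens : IsHolderDensity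
        ((Metric.closedBall α δ).indicator fun s => ((γ s - c : ℝ) : ℂ)) α := by
      refine isHolderDensity_indicator hδ hδr hH.le hθ fun s t hs ht => ?_
      rw [← Complex.ofReal_sub, Complex.norm_real, sub_sub_sub_cancel_right, Real.norm_eq_abs]
      rw [abs_lt] at hs ht
      exact hol s ⟨by linarith, by linarith⟩ t ⟨by linarith, by linarith⟩
    obtain ⟨N₁, hN₁, hab₁, hbe₁⟩ := hc.exists_plemelj_of_isHolderDensity hdens
    obtain ⟨N₀, hN₀, hab, hbe⟩ :=
      hc.exists_plemelj_of_isHolderDensity (isHolderDensity_indicator_const hδ (c : ℂ) (α := α))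
    rw [indicator_of_mem (hαδ hδ)] at hab hbe hab₁ hbe₁
    obtain ⟨w, hw, hjump⟩ := hc.exists_isBirkhoffRott_jumpRelations hγ hΓ ha hV hδ
      ((min_le_left _ _).trans (min_le_left _ _))
      (hhalf _ ((min_le_left _ _).trans (min_le_right _ _))) hF hN₀ hN₁
    exact ⟨w, hw, hjump _ _ (hc.approachAbove_le α) (hc.approachBelow_le α) hab hbe hab₁ hbe₁⟩
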